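/- Let $\mathcal C$ be a locally small category with a class $\mathcal T$ of morphisms, called covers, that is a subcanonical singleton Grothendieck pretopology: isomorphisms are covers; composites of covers are covers; the pullback of a cover along any morphism exists and is a cover; every representable presheaf is a sheaf for $\mathcal T$. Assume moreover that if $p$ and $q\circ p$ are covers, then $q$ is a cover. For a simplicial object $X$ in $\mathcal C$ and a simplicial set $S$, let $\mathrm{Hom}(S,X)$ be the presheaf on $\mathcal C$ sending $T$ to the set of simplicial maps from $S$ to the simplicial set $[n]\mapsto \mathcal C(T,X_n)$; for $R\to S$ and $f\colon X\to Y$ put $\mathrm{Hom}(R\to S,X\to Y)=\mathrm{Hom}(R,X)\times_{\mathrm{Hom}(R,Y)}\mathrm{Hom}(S,Y)$. A morphism of presheaves is called a cover if both presheaves are representable and the morphism is represented by a cover. A 2-groupoid object in $(\mathcal C,\mathcal T)$ is a simplicial object $X$ in $\mathcal C$ such that $\mathrm{Hom}(\Delta^m,X)\to\mathrm{Hom}(\Lambda^m_k,X)$ is a cover for all $m\ge 1$, $0\le k\le m$, and an isomorphism for $m\ge 3$. Its groupoid of bigons $X^{\to}$ is the fibre of the projection $\mathrm{dec}'(X)\to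 X$ given by $d_0$, where $\mathrm{dec}'(X)_n=X_{n+1}$: its objects are $X_1$ and its arrows are the 2-simplices $\sigma$ with $d_0\sigma\in s_0(X_0)$, such an arrow joining $d_1\sigma$ to $d_2\sigma$; it lies over $X_0\times X_0$ by taking the two endpoints of the 1-simplices. Let $f\colon X\to Y$ be a morphism of 2-groupoid objects in $(\mathcal C,\mathcal T)$. (a) $f$ is a *weak equivalence* if $d_1\circ\mathrm{pr}_2\colon X_0\times_{f_0,Y_0,d_0}Y_1\to Y_0$ is a cover and the functor induced by $f$ on groupoids of bigons relative to the given endpoints in $X_0$, namely $$X^{\to}\longrightarrow (X_0\times X_0)\times_{Y_0\times Y_0}Y^{\to},$$ is a weak equivalence of groupoids. Here a functor $\varphi\colon G\to H$ of groupoids (given by their nerves, with $d_0$ the source and $d_1$ the target) is a weak equivalence if $d_1\circ \mathrm{pr}_2\colon G_0\times_{\varphi_0,H_0,d_0}H_1\to H_0$ is a cover and the square with rows $\varphi_1\colon G_1\to H_1$, $\varphi_0\times\varphi_0\colon G_0\times G_0\to H_0\times H_0$ and columns $(d_0,d_1)$ is a pullback square (products and fibre products are taken as presheaves). (b) $f$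 is a *weak acyclic fibration* if the restriction map $$\mathrm{Hom}(\Delta^k\to\Delta^k\star\Delta^0,\ X\to Y)\longrightarrow\mathrm{Hom}(\partial\Delta^k\to\partial\Delta^k\star\Delta^0,\ X\to Y)$$ is a cover for all $k\ge 0$ and an isomorphism for all $k\ge 2$, where $\star$ is the join of simplicial sets and $S\to S\star\Delta^0$ is the inclusion. Then $f$ is a weak equivalence if and only if $f$ is a weak acyclic fibration. -/

import Mathlib

open CategoryTheory Limits Opposite Simplicial

universe v u

namespace HigherGroupoid

/-! ### Singleton Grothendieck pretopologies -/

section Pretopology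

variable {C : Type u} [Category.{v} C]

/-- `W` is a singleton Grothendieck pretopology on `C`; its members are called covers. -/
structure IsPretopology (W : MorphismProperty C) : Prop where
  of_isIso : ∀ {A B : C} (p : A ⟶ B), IsIso p → W p
  comp : ∀ {A B D : C} (p : A ⟶ B) (q : B ⟶ D), W p → W q → W (p ≫ q)
  pullback : ∀ {A B Z : C} (p : A ⟶ B) (g : Z ⟶ B), W p →
    ∃ (P : C) (fst : P ⟶ A) (snd : P ⟶ Z), IsPullback fst snd p g ∧ W snd

/-- `F` is a sheaf: `F B ⟶ F A ⇉ F (A ×_B A)` is an equaliser diagram for every cover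
`p : A ⟶ B`. -/
def IsSheaf (W : MorphismProperty C) (F : Cᵒᵖ ⥤ Type v) : Prop :=
  ∀ {A B P : C} (p : A ⟶ B) (p₁ p₂ : P ⟶ A), W p → IsPullback p₁ p₂ p p →
    ∀ y : F.obj (op A), F.map p₁.op y = F.map p₂.op y → ∃! x : F.obj (op B), F.map p.op x = y

/-- Every representable presheaf is a sheaf. -/
def IsSubcanonical (W : MorphismProperty C) : Prop :=
  ∀ Z : C, IsSheaf W (yoneda.obj Z)

/-- If `p` and `p ≫ q` are covers, then so is `q`. -/
def IsRightCancellative (W : MorphismProperty C) : Prop :=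
  ∀ {A B D : C} (p : A ⟶ B) (q : B ⟶ D), W p → W (p ≫ q) → W q

/-- A morphism of presheaves is a cover if its source and its target are representable and the
morphism of `C` that it induces between representing objects is a cover. -/
def IsCover (W : MorphismProperty C) {F G : Cᵒᵖ ⥤ Type v} (φ : F ⟶ G) : Prop :=
  ∃ (A B : C) (p : A ⟶ B) (a : yoneda.obj A ≅ F) (b : yoneda.obj B ≅ G),
    W p ∧ a.hom ≫ φ = yoneda.map p ≫ b.hom

end Pretopology

/-! ### Simplicial sets: join, décalage, fibre, bigons -/

section SimplicialSets

/-- An `n`-simplex of the join `S ⋆ T`: a decomposition of the vertices `0, …, n` into an initial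
segment `lower` and the complementary final segment, together with a simplex of `S` on the vertices
in `lower` and a simplex of `T` on the remaining ones. A simplex on a possibly empty set of
vertices is given by its pullbacks along all monotone maps from some `[m]` into this set, so that
it is no datum if the set is empty, and a single `i`-simplex if the set has `i + 1` elements. -/
@[ext]
structure JoinSimplex (S T : SSet.{v}) (n : SimplexCategory) : Type v where
  lower : Set (Fin (n.len + 1))
  isLowerSet : IsLowerSet lower
  left : ∀ (m : SimplexCategory) (φ : m ⟶ n), (∀ i, φ.toOrderHom i ∈ lower) → S.obj (op m)
  left_map : ∀ (m m' : SimplexCategory) (ψ : m' ⟶ m) (φ : m ⟶ n)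
    (h : ∀ i, φ.toOrderHom i ∈ lower),
    S.map ψ.op (left m φ h) = left m' (ψ ≫ φ) (fun i => h (ψ.toOrderHom i))
  right : ∀ (m : SimplexCategory) (φ : m ⟶ n), (∀ i, φ.toOrderHom i ∉ lower) → T.obj (op m)
  right_map : ∀ (m m' : SimplexCategory) (ψ : m' ⟶ m) (φ : m ⟶ n)
    (h : ∀ i, φ.toOrderHom i ∉ lower),
    T.map ψ.op (right m φ h) = right m' (ψ ≫ φ) (fun i => h (ψ.toOrderHom i))

/-- The pullback of a simplex of `S ⋆ T` along a monotone map. -/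
def JoinSimplex.pull {S T : SSet.{v}} {n n' : SimplexCategory} (s : JoinSimplex S T n)
    (θ : n' ⟶ n) : JoinSimplex S T n' where
  lower := θ.toOrderHom ⁻¹' s.lower
  isLowerSet := fun _ _ hab ha => s.isLowerSet (θ.toOrderHom.monotone hab) ha
  left m φ h := s.left m (φ ≫ θ) h
  left_map m m' ψ φ h := s.left_map m m' ψ (φ ≫ θ) h
  right m φ h := s.right m (φ ≫ θ) h
  right_map m m' ψ φ h := s.right_map m m' ψ (φ ≫ θ) h

lemma JoinSimplex.pull_id {S T : SSet.{v}} {n : SimplexCategory} (s : JoinSimplex S T n) :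
    s.pull (𝟙 n) = s := by
  refine JoinSimplex.ext rfl (heq_of_eq ?_) (heq_of_eq ?_)
  · funext m φ h
    change s.left m (φ ≫ 𝟙 n) _ = s.left m φ _
    simp only [Category.comp_id]
  · funext m φ h
    change s.right m (φ ≫ 𝟙 n) _ = s.right m φ _
    simp only [Category.comp_id]

/-- The join `S ⋆ T` of two simplicial sets. -/
def join (S T : SSet.{v}) : SSet.{v} where
  obj n := JoinSimplex S T n.unop
  map θ := ↾fun s => s.pull θ.unop
  map_id _ := ConcreteCategory.hom_ext _ _ fun s => s.pull_id
  map_comp _ _ := ConcreteCategory.hom_ext _ _ fun _ => rfl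

/-- The map `S ⋆ T ⟶ S' ⋆ T` induced by `g : S ⟶ S'`. -/
def joinMapLeft {S S' : SSet.{v}} (g : S ⟶ S') (T : SSet.{v}) : join S T ⟶ join S' T where
  app n := ↾fun (s : JoinSimplex S T n.unop) => show JoinSimplex S' T n.unop from
    { lower := s.lower
      isLowerSet := s.isLowerSet
      left := fun m φ h => g.app (op m) (s.left m φ h)
      left_map := fun m m' ψ φ h => by
        rw [← s.left_map m m' ψ φ h]
        exact (NatTrans.naturality_apply g ψ.op _).symm
      right := s.right
      right_map := s.right_map }
  naturality _ _ _ := rfl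

/-- The inclusion `S ⟶ S ⋆ T`. -/
def joinInl (S T : SSet.{v}) : S ⟶ join S T where
  app n := ↾fun s => show JoinSimplex S T n.unop from
    { lower := Set.univ
      isLowerSet := isLowerSet_univ
      left := fun _ φ _ => S.map φ.op s
      left_map := fun m m' ψ φ _ => by
        rw [op_comp, Functor.map_comp]; rfl
      right := fun _ _ h => (h 0 trivial).elim
      right_map := fun _ _ _ _ h => (h 0 trivial).elim }
  naturality n n' θ := by
    refine ConcreteCategory.hom_ext _ _ fun s => ?_
    refine JoinSimplex.ext rfl (heq_of_eq ?_) (heq_of_eq ?_)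
    · funext m φ h
      change S.map φ.op (S.map θ s) = S.map (φ ≫ θ.unop).op s
      rw [op_comp, Functor.map_comp]; rfl
    · funext m φ h
      exact (h 0 trivial).elim

/-- For `g : S ⟶ S'`, the square from `S ⟶ S ⋆ T` to `S' ⟶ S' ⋆ T`. -/
def joinSquare {S S' : SSet.{v}} (g : S ⟶ S') (T : SSet.{v}) :
    Arrow.mk (joinInl S T) ⟶ Arrow.mk (joinInl S' T) :=
  Arrow.homMk g (joinMapLeft g T) (by
    refine SSet.hom_ext fun n => ConcreteCategory.hom_ext _ _ fun s => ?_
    refine JoinSimplex.ext rfl (heq_of_eq ?_) (heq_of_eq ?_)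
    · funext m φ h
      exact (NatTrans.naturality_apply g φ.op s).symm
    · funext m φ h
      exact (h 0 trivial).elim)

/-- The functor `[n] ↦ [0] ⋆ [n] = [n + 1]` on the simplex category: a map is extended by
`0 ↦ 0`, and the vertex `i` of `[n]` becomes the vertex `i + 1`. -/
def shift : SimplexCategory ⥤ SimplexCategory where
  obj n := .mk (n.len + 1)
  map φ := SimplexCategory.Hom.mk
    { toFun := Fin.cases 0 fun i => (φ.toOrderHom i).succ
      monotone' := by
        intro i j hij
        induction i using Fin.cases with
        | zero => exact Fin.zero_le _
        | succ i =>
          induction j using Fin.cases with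
          | zero => exact absurd hij (by simp)
          | succ j => simpa using φ.toOrderHom.monotone (Fin.succ_le_succ_iff.1 hij) }
  map_id n := by
    ext i : 3
    induction i using Fin.cases <;> rfl
  map_comp φ ψ := by
    ext i : 3
    induction i using Fin.cases <;> rfl

/-- The inclusion `[n] ⟶ [0] ⋆ [n] = [n + 1]`, `i ↦ i + 1`. -/
def toShift : 𝟭 SimplexCategory ⟶ shift where
  app _ := SimplexCategory.Hom.mk ⟨Fin.succ, fun _ _ h => Fin.succ_le_succ_iff.2 h⟩
  naturality _ _ _ := rfl

/-- The décalage `dec' A`, with `(dec' A)_n = A_{n+1}`, that forgets the face `d_0`. -/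
def dec' (A : SSet.{v}) : SSet.{v} := shift.op ⋙ A

/-- The projection `dec' A ⟶ A`, given by the face `d_0`. -/
def decProj (A : SSet.{v}) : dec' A ⟶ A where
  app n := A.map (toShift.app n.unop).op
  naturality _ _ θ := by
    change A.map (shift.op.map θ) ≫ _ = _ ≫ A.map θ
    rw [← A.map_comp, ← A.map_comp]
    rfl

/-- The fibre of `f : A ⟶ B`. An `n`-simplex is a commutative square from `Δ[n] ⟶ Δ[0]` to `f`,
that is, an `n`-simplex of `A` with a vertex of `B` such that `f` sends the former to
the degenerate `n`-simplex on the latter. -/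
def fibre {A B : SSet.{v}} (f : A ⟶ B) : SSet.{v} where
  obj n := { p : A.obj n × B _⦋0⦌ // f.app n p.1 = B.map (n.unop.const ⦋0⦌ 0).op p.2 }
  map {n n'} θ := ↾fun p => ⟨(A.map θ p.1.1, p.1.2), by
    rw [NatTrans.naturality_apply f θ p.1.1, p.2, ← ConcreteCategory.comp_apply,
      ← Functor.map_comp]
    rfl⟩
  map_id n := by
    refine ConcreteCategory.hom_ext _ _ fun p => ?_
    refine Subtype.ext (Prod.ext ?_ rfl)
    exact congrArg (fun t => t p.1.1) (A.map_id n)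
  map_comp θ θ' := by
    refine ConcreteCategory.hom_ext _ _ fun p => ?_
    refine Subtype.ext (Prod.ext ?_ rfl)
    exact congrArg (fun t => t p.1.1) (A.map_comp θ θ')

/-- The groupoid of bigons of a 2-groupoid `A`, as a simplicial set: the fibre of
`dec' A ⟶ A`. Its objects are the 1-simplices of `A`; its arrows are the 2-simplices `σ` for which
`d_0 σ` is degenerate, with the two endpoints `d_1 σ` and `d_2 σ`. -/
def bigons (A : SSet.{v}) : SSet.{v} := fibre (decProj A)

/-- The map induced on bigons. -/
def bigonsMap {A B : SSet.{v}} (f : A ⟶ B) : bigons A ⟶ bigons B where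
  app n := ↾fun p => ⟨(f.app (op (shift.obj n.unop)) p.1.1, f.app (op ⦋0⦌) p.1.2), by
    exact (NatTrans.naturality_apply f (toShift.app n.unop).op p.1.1).symm.trans
      ((congrArg (f.app n) p.2).trans (NatTrans.naturality_apply f _ p.1.2))⟩
  naturality n n' θ := by
    refine ConcreteCategory.hom_ext _ _ fun p => ?_
    refine Subtype.ext (Prod.ext ?_ rfl)
    exact NatTrans.naturality_apply f (shift.op.map θ) p.1.1

/-- The two vertices of a simplex of `bigons A`: all objects (1-simplices of `A`) that occur in
such a simplex run between the vertex `0` of the underlying simplex of `A` and the common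
other vertex. -/
def bigonVertices {A : SSet.{v}} {n : SimplexCategoryᵒᵖ} (p : (bigons A).obj n) :
    A _⦋0⦌ × A _⦋0⦌ :=
  (A.map (SimplexCategory.const ⦋0⦌ (shift.obj n.unop) 0).op p.1.1, p.1.2)

lemma bigonVertices_map {A : SSet.{v}} {n n' : SimplexCategoryᵒᵖ} (θ : n ⟶ n')
    (p : (bigons A).obj n) : bigonVertices ((bigons A).map θ p) = bigonVertices p := by
  refine Prod.ext ?_ rfl
  exact (Functor.map_comp_apply A (shift.op.map θ)
    (SimplexCategory.const ⦋0⦌ (shift.obj n'.unop) 0).op p.1.1).symm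

lemma bigonVertices_bigonsMap {A B : SSet.{v}} (f : A ⟶ B) {n : SimplexCategoryᵒᵖ}
    (p : (bigons A).obj n) :
    bigonVertices ((bigonsMap f).app n p) =
      (f.app (op ⦋0⦌) (bigonVertices p).1, f.app (op ⦋0⦌) (bigonVertices p).2) :=
  Prod.ext (NatTrans.naturality_apply f _ _).symm rfl

/-- For `f : A ⟶ B`, the groupoid of bigons of `B` pulled back to the vertices of `A`, that is
`(A_0 × A_0) ×_{B_0 × B_0} bigons B`: its objects are triples `(a, a', e)` of two vertices `a, a'`
of `A` and a 1-simplex `e` of `B` with vertices `f a, f a'`, and its arrows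
`(a, a', e) ⟶ (a, a', e')` are the arrows `e ⟶ e'` of `bigons B`. -/
def bigonsOver {A B : SSet.{v}} (f : A ⟶ B) : SSet.{v} where
  obj n := { q : (A _⦋0⦌ × A _⦋0⦌) × (bigons B).obj n //
    bigonVertices q.2 = (f.app (op ⦋0⦌) q.1.1, f.app (op ⦋0⦌) q.1.2) }
  map θ := ↾fun q => ⟨(q.1.1, (bigons B).map θ q.1.2), by rw [bigonVertices_map, q.2]⟩
  map_id n := by
    refine ConcreteCategory.hom_ext _ _ fun q => ?_
    refine Subtype.ext (Prod.ext rfl ?_)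
    exact congrArg (fun t => t q.1.2) ((bigons B).map_id n)
  map_comp θ θ' := by
    refine ConcreteCategory.hom_ext _ _ fun q => ?_
    refine Subtype.ext (Prod.ext rfl ?_)
    exact congrArg (fun t => t q.1.2) ((bigons B).map_comp θ θ')

/-- The functor `bigons A ⟶ (A_0 × A_0) ×_{B_0 × B_0} bigons B` induced by `f : A ⟶ B`. -/
def bigonsToOver {A B : SSet.{v}} (f : A ⟶ B) : bigons A ⟶ bigonsOver f where
  app n := ↾fun p => ⟨(bigonVertices p, (bigonsMap f).app n p), bigonVertices_bigonsMap f p⟩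
  naturality n n' θ := by
    refine ConcreteCategory.hom_ext _ _ fun p => ?_
    refine Subtype.ext (Prod.ext (bigonVertices_map θ p) ?_)
    exact NatTrans.naturality_apply (bigonsMap f) θ p

end SimplicialSets

/-! ### Simplicial objects and their `T`-points -/

section SimplicialObjects

variable {C : Type u} [Category.{v} C]

/-- The presheaf of simplicial sets `T ↦ ([n] ↦ Hom(T, X_n))`. -/
def points (X : SimplicialObject C) : Cᵒᵖ ⥤ SSet.{v} :=
  coyoneda ⋙ (SimplicialObject.whiskering C (Type v)).flip.obj X

/-- The map induced by a morphism of simplicial objects on `T`-points. -/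
def pointsMap {X Y : SimplicialObject C} (f : X ⟶ Y) : points X ⟶ points Y :=
  Functor.whiskerLeft coyoneda ((SimplicialObject.whiskering C (Type v)).flip.map f)

/-- The presheaf `Hom(S, X)` of diagrams of shape `S` in `X`. -/
def diagrams (S : SSet.{v}) (X : SimplicialObject C) : Cᵒᵖ ⥤ Type v :=
  points X ⋙ coyoneda.obj (op S)

/-- The restriction `Hom(S, X) ⟶ Hom(R, X)` along `i : R ⟶ S`. -/
def diagramsRestrict {R S : SSet.{v}} (i : R ⟶ S) (X : SimplicialObject C) :
    diagrams S X ⟶ diagrams R X :=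
  Functor.whiskerLeft (points X) (coyoneda.map i.op)

/-- The presheaf of arrows of simplicial sets given by the `T`-points of `f : X ⟶ Y`. -/
def pointsArrow {X Y : SimplicialObject C} (f : X ⟶ Y) : Cᵒᵖ ⥤ Arrow SSet.{v} where
  obj T := Arrow.mk ((pointsMap f).app T)
  map t := Arrow.homMk ((points X).map t) ((points Y).map t) ((pointsMap f).naturality t)
  map_id T := Arrow.hom_ext _ _ ((points X).map_id T) ((points Y).map_id T)
  map_comp t t' := Arrow.hom_ext _ _ ((points X).map_comp t t') ((points Y).map_comp t t')

/-- The presheaf `Hom(R ⟶ S, X ⟶ Y) = Hom(R, X) ×_{Hom(R, Y)} Hom(S, Y)` of commutative squares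
from `i : R ⟶ S` to `f : X ⟶ Y`. -/
def squares (i : Arrow SSet.{v}) {X Y : SimplicialObject C} (f : X ⟶ Y) : Cᵒᵖ ⥤ Type v :=
  pointsArrow f ⋙ coyoneda.obj (op i)

/-- The restriction of commutative squares along a map `i ⟶ j` of arrows of simplicial sets. -/
def squaresRestrict {i j : Arrow SSet.{v}} (a : i ⟶ j) {X Y : SimplicialObject C} (f : X ⟶ Y) :
    squares j f ⟶ squares i f :=
  Functor.whiskerLeft (pointsArrow f) (coyoneda.map a.op)

/-- `X` is an `n`-groupoid object in `(C, W)`: for all `m ≥ 1` and `0 ≤ k ≤ m` the map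
`Hom(Δ[m], X) ⟶ Hom(Λ[m, k], X)` is a cover, and for `m > n` it is an isomorphism. -/
structure IsGroupoidObject (W : MorphismProperty C) (n : ℕ) (X : SimplicialObject C) : Prop where
  kan : ∀ (m : ℕ) (k : Fin (m + 1)), 1 ≤ m →
    IsCover W (diagramsRestrict (SSet.horn.{v} m k).ι X)
  kan_unique : ∀ (m : ℕ) (k : Fin (m + 1)), 1 ≤ m → n < m →
    IsIso (diagramsRestrict (SSet.horn.{v} m k).ι X)

/-- The presheaf of `n`-simplices of a presheaf of simplicial sets. -/
abbrev level (G : Cᵒᵖ ⥤ SSet.{v}) (n : ℕ) : Cᵒᵖ ⥤ Type v :=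
  G ⋙ SSet.evaluation.obj (op ⦋n⦌)

/-- The map on `n`-simplices. -/
abbrev levelMap {G H : Cᵒᵖ ⥤ SSet.{v}} (φ : G ⟶ H) (n : ℕ) : level G n ⟶ level H n :=
  Functor.whiskerRight φ _

/-- The faces `d_0, d_1` from 1-simplices to 0-simplices. -/
abbrev face (G : Cᵒᵖ ⥤ SSet.{v}) (i : Fin 2) : level G 1 ⟶ level G 0 :=
  Functor.whiskerLeft G (SSet.evaluation.map (SimplexCategory.δ i).op)

/-- Essential surjectivity: `d_1 ∘ pr_2 : G_0 ×_{H_0, d_0} H_1 ⟶ H_0` is a cover. -/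
def IsEssSurj (W : MorphismProperty C) {G H : Cᵒᵖ ⥤ SSet.{v}} (φ : G ⟶ H) : Prop :=
  IsCover W (pullback.snd (levelMap φ 0) (face H 0) ≫ face H 1)

/-- Full faithfulness: the square with rows `G_1 ⟶ H_1` and `G_0 × G_0 ⟶ H_0 × H_0`
is a pullback square. -/
def IsFullyFaithful {G H : Cᵒᵖ ⥤ SSet.{v}} (φ : G ⟶ H) : Prop :=
  IsPullback (levelMap φ 1) (prod.lift (face G 0) (face G 1)) (prod.lift (face H 0) (face H 1))
    (prod.map (levelMap φ 0) (levelMap φ 0))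

/-- A functor of groupoids in `(C, W)`, given by its nerve, is a weak equivalence. -/
structure IsGroupoidWeakEquivalence (W : MorphismProperty C) {G H : Cᵒᵖ ⥤ SSet.{v}}
    (φ : G ⟶ H) : Prop where
  essSurj : IsEssSurj W φ
  fullyFaithful : IsFullyFaithful φ

/-- The groupoid of bigons of `X`, by its `T`-points. -/
def bigonGroupoid (X : SimplicialObject C) : Cᵒᵖ ⥤ SSet.{v} where
  obj T := bigons ((points X).obj T)
  map t := bigonsMap ((points X).map t)
  map_id T := by
    refine SSet.hom_ext fun n => ConcreteCategory.hom_ext _ _ fun p => ?_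
    refine Subtype.ext (Prod.ext ?_ ?_)
    · exact Category.id_comp p.1.1
    · exact Category.id_comp p.1.2
  map_comp t t' := by
    refine SSet.hom_ext fun n => ConcreteCategory.hom_ext _ _ fun p => ?_
    refine Subtype.ext (Prod.ext ?_ ?_)
    · exact Category.assoc t'.unop t.unop p.1.1
    · exact Category.assoc t'.unop t.unop p.1.2

/-- The groupoid `(X_0 × X_0) ×_{Y_0 × Y_0} bigonGroupoid Y`, by its `T`-points. -/
def bigonGroupoidOver {X Y : SimplicialObject C} (f : X ⟶ Y) : Cᵒᵖ ⥤ SSet.{v} where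
  obj T := bigonsOver ((pointsMap f).app T)
  map {T T'} t :=
    { app := fun n => ↾fun q =>
        ⟨((((points X).map t).app (op ⦋0⦌) q.1.1.1, ((points X).map t).app (op ⦋0⦌) q.1.1.2),
          (bigonsMap ((points Y).map t)).app n q.1.2), by
          have h := q.2
          have h₁ := congrArg Prod.fst h
          have h₂ := congrArg Prod.snd h
          rw [bigonVertices_bigonsMap]
          refine Prod.ext ?_ ?_
          · change ((points Y).map t).app (op ⦋0⦌) (bigonVertices q.1.2).1 = _
            rw [h₁]
            exact (Category.assoc t.unop q.1.1.1 (f.app (op ⦋0⦌))).symm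
          · change ((points Y).map t).app (op ⦋0⦌) (bigonVertices q.1.2).2 = _
            rw [h₂]
            exact (Category.assoc t.unop q.1.1.2 (f.app (op ⦋0⦌))).symm⟩
      naturality := fun n n' θ => by
        refine ConcreteCategory.hom_ext _ _ fun q => ?_
        refine Subtype.ext (Prod.ext rfl ?_)
        exact NatTrans.naturality_apply (bigonsMap ((points Y).map t)) θ q.1.2 }
  map_id T := by
    refine SSet.hom_ext fun n => ConcreteCategory.hom_ext _ _ fun q => ?_
    refine Subtype.ext (Prod.ext (Prod.ext ?_ ?_) ?_)
    · exact Category.id_comp q.1.1.1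
    · exact Category.id_comp q.1.1.2
    · exact congrArg (fun t => t.app n q.1.2) ((bigonGroupoid Y).map_id T)
  map_comp t t' := by
    refine SSet.hom_ext fun n => ConcreteCategory.hom_ext _ _ fun q => ?_
    refine Subtype.ext (Prod.ext (Prod.ext ?_ ?_) ?_)
    · exact Category.assoc t'.unop t.unop q.1.1.1
    · exact Category.assoc t'.unop t.unop q.1.1.2
    · exact congrArg (fun t => t.app n q.1.2) ((bigonGroupoid Y).map_comp t t')

/-- The functor induced by `f : X ⟶ Y` on groupoids of bigons, relative to the pairs of endpoints
in `X_0`. -/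
def bigonFunctor {X Y : SimplicialObject C} (f : X ⟶ Y) :
    bigonGroupoid X ⟶ bigonGroupoidOver f where
  app T := bigonsToOver ((pointsMap f).app T)
  naturality T T' t := by
    refine SSet.hom_ext fun n => ConcreteCategory.hom_ext _ _ fun p => ?_
    refine Subtype.ext (Prod.ext ?_ ?_)
    · exact bigonVertices_bigonsMap ((points X).map t) p
    · refine Subtype.ext (Prod.ext ?_ ?_)
      · exact Category.assoc t.unop p.1.1 (f.app _)
      · exact Category.assoc t.unop p.1.2 (f.app _)

/-- `f` is a weak equivalence of 2-groupoid objects: it is essentially surjective, and it induces a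
weak equivalence on groupoids of bigons. -/
structure IsWeakEquivalence (W : MorphismProperty C) {X Y : SimplicialObject C}
    (f : X ⟶ Y) : Prop where
  essSurj : IsEssSurj W (pointsMap f)
  bigons : IsGroupoidWeakEquivalence W (bigonFunctor f)

/-- `f` is a weak acyclic fibration: the map
`Hom(Δ[k] ⟶ Δ[k] ⋆ Δ[0], f) ⟶ Hom(∂Δ[k] ⟶ ∂Δ[k] ⋆ Δ[0], f)` is a cover for all `k ≥ 0` and an
isomorphism for `k ≥ 2`. -/
structure IsWeakAcyclicFibration (W : MorphismProperty C) {X Y : SimplicialObject C}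
    (f : X ⟶ Y) : Prop where
  acyc : ∀ k : ℕ, IsCover W (squaresRestrict (joinSquare (SSet.boundary.{v} k).ι Δ[0]) f)
  acyc_unique : ∀ k : ℕ, 2 ≤ k →
    IsIso (squaresRestrict (joinSquare (SSet.boundary.{v} k).ι Δ[0]) f)

end SimplicialObjects

end HigherGroupoid

/-! Each of the two properties unfolds into three conditions: one on vertices, one on edges, one on
unique lifting. The theorem compares the two lists entry by entry.

The join `Δ[k] ⋆ Δ[0]` is `Δ[k + 1]`, and `∂Δ[k] ⋆ Δ[0]` is its horn at the last vertex. So a square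
over `Δ[k]` is a `k`-simplex of `X` with a `(k + 1)`-simplex of `Y` whose last face is its image.
Weak acyclicity for `k = 0` and `k = 1` says that `coneTarget` and `coneBoundary` are covers. For `k
≥ 2` the horns of `Y` in question have unique fillers, and the condition becomes that `k`-simplices
lift uniquely along `f` once their boundary is lifted. Unique fillers in `X` and `Y` reduce this to
triangles (`LiftsSimplices.succ`).

A weak equivalence differs in three respects.

On vertices, the edges of `Y` point the other way. Loops subdivided into two edges cover both spaces
of edges, and right cancellation transfers the condition (`isCover_coconeSource_iff`).

On edges, one asks for a bigon from the image of an edge of `X` to a given edge of `Y`, and not for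
a triangle on a given horn. Unique fillers in dimension three make it possible to compose a triangle
with a bigon (`IsWhiskering`). Turning bigons around in this way exhibits the bigon condition as a
base change of the triangle condition. Conversely, one fills the horn by some triangle and corrects
its third edge by a bigon; this solves the triangle problem up to a cover, which right cancellation
removes (`isCover_sourceTarget_iff`).

On liftings, full faithfulness lifts bigons and not triangles. Two triangles with the same boundary
differ by a bigon, so lifts of triangles are unique. They exist once a horn has been filled in `X`,
hence over a cover, and by uniqueness they descend, because representable presheaves are sheaves
(`liftsTriangles_of_liftsBigons`).

All of this takes place with `IsLocalCover`, which is stable under composition and base change and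
requires no representability; when the target is representable it agrees with `IsCover`. -/

namespace HigherGroupoid

/-! ### Maps out of horns and boundaries as matching families of faces -/

section FaceUnions

/-- `K` is the union of the faces of `Δ[m + 1]` opposite to the vertices in `I`. -/
def IsFaceUnion {m : ℕ} (K : (Δ[m + 1] : SSet.{v}).Subcomplex) (I : Set (Fin (m + 2))) : Prop :=
  ∀ (n : SimplexCategoryᵒᵖ) (s : (Δ[m + 1] : SSet.{v}).obj n),
    s ∈ K.obj n ↔ ∃ j ∈ I, ∀ i, SSet.stdSimplex.asOrderHom s i ≠ j

lemma isFaceUnion_horn {m : ℕ} (k : Fin (m + 2)) :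
    IsFaceUnion (SSet.horn.{v} (m + 1) k) {k}ᶜ := by
  intro n s
  rw [SSet.mem_horn_iff, Set.ne_univ_iff_exists_notMem]
  simp

lemma isFaceUnion_boundary {m : ℕ} :
    IsFaceUnion (SSet.boundary.{v} (m + 1)) Set.univ := by
  intro n s
  change ¬ Function.Surjective _ ↔ _
  simp [Function.Surjective]

/-- The vertices of a family of `m`-simplices, indexed by faces of `Δ[m + 1]`, agree on
intersections. -/
def IsMatching {m : ℕ} (I : Set (Fin (m + 2))) {A : SSet.{v}} (y : ∀ i ∈ I, A _⦋m⦌) : Prop :=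
  ∀ (i j : Fin (m + 2)) (hi : i ∈ I) (hj : j ∈ I) (d : SimplexCategory) (α β : d ⟶ ⦋m⦌),
    α ≫ SimplexCategory.δ i = β ≫ SimplexCategory.δ j → A.map α.op (y i hi) = A.map β.op (y j hj)

/-- A simplex common to two different faces misses both opposite vertices, so it factors through a
face of codimension two. Agreement there is the identity between `δ i` and `δ j`. -/
lemma isMatching_of_δ {m : ℕ} {I : Set (Fin (m + 3))} {A : SSet.{v}} (y : ∀ i ∈ I, A _⦋m + 1⦌)
    (hy : ∀ (i j : Fin (m + 2)) (_ : i ≤ j) (hi : i.castSucc ∈ I) (hj : j.succ ∈ I),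
      A.δ i (y _ hj) = A.δ j (y _ hi)) : IsMatching I y := by
  have key : ∀ (i j : Fin (m + 2)) (_ : i ≤ j) (hi : i.castSucc ∈ I) (hj : j.succ ∈ I)
      (d : SimplexCategory) (α β : d ⟶ ⦋m + 1⦌),
      α ≫ SimplexCategory.δ i.castSucc = β ≫ SimplexCategory.δ j.succ →
        A.map α.op (y _ hi) = A.map β.op (y _ hj) := by
    intro i j hij hi hj d α β h
    obtain ⟨γ, rfl⟩ := SimplexCategory.eq_comp_δ_of_not_surjective' α j (by
      intro x hx
      have h1 := congrArg (fun t => t.toOrderHom x) h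
      change i.castSucc.succAbove (α.toOrderHom x) = j.succ.succAbove (β.toOrderHom x) at h1
      rw [hx, Fin.succAbove_of_le_castSucc _ _ (by simpa using hij)] at h1
      exact Fin.succAbove_ne _ _ h1.symm)
    have hβ : β = γ ≫ SimplexCategory.δ i := by
      rw [← cancel_mono (SimplexCategory.δ j.succ), ← h, Category.assoc, Category.assoc,
        SimplexCategory.δ_comp_δ hij]
    subst hβ
    rw [op_comp, op_comp, Functor.map_comp_apply, Functor.map_comp_apply]
    exact congrArg _ (hy i j hij hi hj).symm
  intro i j hi hj d α β h
  rcases lt_trichotomy i j with hlt | rfl | hlt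
  · obtain ⟨i, rfl⟩ := Fin.eq_castSucc_of_ne_last (Fin.ne_last_of_lt hlt)
    obtain ⟨j, rfl⟩ := Fin.eq_succ_of_ne_zero (Fin.ne_zero_of_lt hlt)
    exact key i j (Fin.castSucc_lt_succ_iff.1 hlt) hi hj d α β h
  · rw [cancel_mono] at h
    rw [h]
  · obtain ⟨j, rfl⟩ := Fin.eq_castSucc_of_ne_last (Fin.ne_last_of_lt hlt)
    obtain ⟨i, rfl⟩ := Fin.eq_succ_of_ne_zero (Fin.ne_zero_of_lt hlt)
    exact (key j i (Fin.castSucc_lt_succ_iff.1 hlt) hj hi d β α h.symm).symm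

/-- The two faces of `Δ[1]` are distinct vertices and have no simplex in common. -/
lemma isMatching_of_zero {I : Set (Fin 2)} {A : SSet.{v}} (y : ∀ i ∈ I, A _⦋0⦌) :
    IsMatching I y := by
  intro i j hi hj d α β h
  obtain rfl : α = β := Subsingleton.elim _ _
  obtain rfl : i = j := by
    have h1 := congrArg (fun t => t.toOrderHom 0) h
    have h2 : (α.toOrderHom 0 : Fin 1) = 0 := Fin.fin_one_eq_zero _
    change Fin.succAbove (n := 1) i (α.toOrderHom 0 : Fin 1) =
      Fin.succAbove (n := 1) j (α.toOrderHom 0 : Fin 1) at h1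
    rw [h2] at h1
    revert h1
    fin_cases i <;> fin_cases j <;> simp [Fin.succAbove]
  rfl

variable {m : ℕ} {K : (Δ[m + 1] : SSet.{v}).Subcomplex} {I : Set (Fin (m + 2))}

lemma IsFaceUnion.δ_mem (hK : IsFaceUnion K I) {j : Fin (m + 2)} (hj : j ∈ I) :
    SSet.stdSimplex.objEquiv.symm (SimplexCategory.δ j) ∈ K.obj (op ⦋m⦌) :=
  (hK _ _).2 ⟨j, hj, fun i => Fin.succAbove_ne j i⟩

/-- The value of a map out of a union of faces on the face opposite to `j`. -/
def IsFaceUnion.eval (hK : IsFaceUnion K I) {A : SSet.{v}} (g : (K : SSet) ⟶ A)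
    (j : Fin (m + 2)) (hj : j ∈ I) : A _⦋m⦌ :=
  g.app (op ⦋m⦌) ⟨_, hK.δ_mem hj⟩

lemma IsFaceUnion.exists_eq (hK : IsFaceUnion K I) {n : SimplexCategoryᵒᵖ}
    (s : (K : SSet).obj n) : ∃ (j : Fin (m + 2)) (hj : j ∈ I) (α : n.unop ⟶ ⦋m⦌),
      s = (K : SSet).map α.op ⟨_, hK.δ_mem hj⟩ ∧
      SSet.stdSimplex.objEquiv s.1 = α ≫ SimplexCategory.δ j := by
  obtain ⟨j, hj, h⟩ := (hK _ _).1 s.2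
  obtain ⟨α, hα⟩ := SimplexCategory.eq_comp_δ_of_not_surjective'
    (SSet.stdSimplex.objEquiv s.1) j h
  refine ⟨j, hj, α, Subtype.ext ?_, hα⟩
  apply SSet.stdSimplex.objEquiv.injective
  rw [hα]
  rfl

lemma IsFaceUnion.app_eq (hK : IsFaceUnion K I) {A : SSet.{v}} (g : (K : SSet) ⟶ A)
    {n : SimplexCategoryᵒᵖ} (j : Fin (m + 2)) (hj : j ∈ I) (α : n.unop ⟶ ⦋m⦌) :
    g.app n ((K : SSet).map α.op ⟨_, hK.δ_mem hj⟩) = A.map α.op (hK.eval g j hj) :=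
  NatTrans.naturality_apply g α.op _

lemma IsFaceUnion.hom_ext (hK : IsFaceUnion K I) {A : SSet.{v}} {g g' : (K : SSet) ⟶ A}
    (h : ∀ j hj, hK.eval g j hj = hK.eval g' j hj) : g = g' := by
  refine SSet.hom_ext fun n => ConcreteCategory.hom_ext _ _ fun s => ?_
  obtain ⟨j, hj, α, rfl, -⟩ := hK.exists_eq s
  rw [hK.app_eq g j hj, hK.app_eq g' j hj, h]

/-- Every simplex of `K` lies in some face. A face is chosen for each simplex, and matching makes
the value independent of the choice, which yields naturality. -/
lemma IsFaceUnion.exists_hom (hK : IsFaceUnion K I) {A : SSet.{v}} (y : ∀ i ∈ I, A _⦋m⦌)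
    (hy : IsMatching I y) : ∃ g : (K : SSet) ⟶ A, ∀ j hj, hK.eval g j hj = y j hj := by
  choose j hj α hα hα' using fun (n : SimplexCategoryᵒᵖ) (s : (K : SSet).obj n) => hK.exists_eq s
  have key : ∀ (n : SimplexCategoryᵒᵖ) (s : (K : SSet).obj n) (i : Fin (m + 2)) (hi : i ∈ I)
      (β : n.unop ⟶ ⦋m⦌), SSet.stdSimplex.objEquiv s.1 = β ≫ SimplexCategory.δ i →
      A.map (α n s).op (y _ (hj n s)) = A.map β.op (y i hi) := fun n s i hi β h =>
    hy _ _ _ _ _ _ _ ((hα' n s).symm.trans h)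
  refine ⟨{ app := fun n => ↾fun s => A.map (α n s).op (y _ (hj n s)), naturality := ?_ }, ?_⟩
  · intro n n' θ
    refine ConcreteCategory.hom_ext _ _ fun s => ?_
    refine (key n' _ (j n s) (hj n s) (θ.unop ≫ α n s) ?_).trans ?_
    · rw [Category.assoc, ← hα' n s]
      rfl
    · rw [op_comp, Functor.map_comp_apply]
      rfl
  · intro i hi
    refine (key _ _ i hi (𝟙 _) ?_).trans ?_
    · rw [Category.id_comp]
      exact SSet.stdSimplex.objEquiv.apply_symm_apply _
    · rw [op_id, Functor.map_id_apply]

@[simp]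
lemma IsFaceUnion.eval_ι_comp (hK : IsFaceUnion K I) {A : SSet.{v}} (g : Δ[m + 1] ⟶ A)
    (j : Fin (m + 2)) (hj : j ∈ I) :
    hK.eval (K.ι ≫ g) j hj = A.δ j (SSet.yonedaEquiv g) := by
  obtain ⟨x, rfl⟩ := SSet.yonedaEquiv.symm.surjective g
  rw [Equiv.apply_symm_apply]
  exact SSet.yonedaEquiv_symm_app_objEquiv_symm x _

lemma IsFaceUnion.eval_comp (hK : IsFaceUnion K I) {A B : SSet.{v}} (g : (K : SSet) ⟶ A)
    (f : A ⟶ B) (j : Fin (m + 2)) (hj : j ∈ I) :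
    hK.eval (g ≫ f) j hj = f.app _ (hK.eval g j hj) := rfl

lemma IsFaceUnion.isMatching (hK : IsFaceUnion K I) {A : SSet.{v}} (g : (K : SSet) ⟶ A) :
    IsMatching I (hK.eval g) := by
  intro i j hi hj d α β h
  rw [← hK.app_eq g (n := op d), ← hK.app_eq g (n := op d)]
  congr 1
  apply Subtype.ext
  apply SSet.stdSimplex.objEquiv.injective
  exact h

lemma IsFaceUnion.δ_eval {m : ℕ} {K : (Δ[m + 2] : SSet.{v}).Subcomplex} {I : Set (Fin (m + 3))}
    (hK : IsFaceUnion K I) {A : SSet.{v}} (g : (K : SSet) ⟶ A) {i j : Fin (m + 2)} (hij : i ≤ j)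
    (hi : i.castSucc ∈ I) (hj : j.succ ∈ I) :
    A.δ i (hK.eval g _ hj) = A.δ j (hK.eval g _ hi) :=
  hK.isMatching g _ _ hj hi _ _ _ (SimplexCategory.δ_comp_δ hij)

end FaceUnions

/-! ### Morphisms of presheaves that are representable by covers -/

section LocalCovers

variable {C : Type u} [Category.{v} C] {W : MorphismProperty C}

/-- `φ` is representable by covers: its pullback to any representable presheaf is represented by
a cover. -/
def IsLocalCover (W : MorphismProperty C) {F G : Cᵒᵖ ⥤ Type v} (φ : F ⟶ G) : Prop :=
  ∀ (T : C) (g : G.obj (op T)), ∃ (P : C) (p : P ⟶ T) (s : F.obj (op P)), W p ∧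
    φ.app _ s = G.map p.op g ∧ ∀ (U : C) (w : U ⟶ T) (t : F.obj (op U)),
      φ.app _ t = G.map w.op g → ∃! q : U ⟶ P, q ≫ p = w ∧ F.map q.op s = t

/-- `F` is isomorphic to a representable presheaf. -/
def IsRep (F : Cᵒᵖ ⥤ Type v) : Prop :=
  ∃ B : C, Nonempty (yoneda.obj B ≅ F)

lemma IsCover.isRep_left {F G : Cᵒᵖ ⥤ Type v} {φ : F ⟶ G} (h : IsCover W φ) : IsRep F := by
  obtain ⟨A, B, p, a, b, -⟩ := h
  exact ⟨A, ⟨a⟩⟩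

lemma IsCover.isRep_right {F G : Cᵒᵖ ⥤ Type v} {φ : F ⟶ G} (h : IsCover W φ) : IsRep G := by
  obtain ⟨A, B, p, a, b, -⟩ := h
  exact ⟨B, ⟨b⟩⟩

lemma IsCover.isLocalCover (hW : IsPretopology W) {F G : Cᵒᵖ ⥤ Type v} {φ : F ⟶ G}
    (h : IsCover W φ) : IsLocalCover W φ := by
  obtain ⟨A, B, p, a, b, hp, hab⟩ := h
  have hab' : ∀ (U : Cᵒᵖ) (t : U.unop ⟶ A), φ.app U (a.hom.app U t) = b.hom.app U (t ≫ p) :=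
    fun U t => congrArg (fun k => k.app U t) hab
  have ha : ∀ U x, a.hom.app U (a.inv.app U x) = x := fun U x =>
    congrArg (fun k => k.app U x) a.inv_hom_id
  have hb : ∀ U x, b.hom.app U (b.inv.app U x) = x := fun U x =>
    congrArg (fun k => k.app U x) b.inv_hom_id
  have ha' : ∀ U x, a.inv.app U (a.hom.app U x) = x := fun U x =>
    congrArg (fun k => k.app U x) a.hom_inv_id
  have hb' : ∀ U x, b.inv.app U (b.hom.app U x) = x := fun U x =>
    congrArg (fun k => k.app U x) b.hom_inv_id
  intro T g
  obtain ⟨g, rfl⟩ : ∃ k, b.hom.app _ k = g := ⟨_, hb _ _⟩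
  obtain ⟨P, fst, snd, hP, hsnd⟩ := hW.pullback p g hp
  refine ⟨P, snd, a.hom.app _ fst, hsnd, ?_, ?_⟩
  · rw [hab', ← NatTrans.naturality_apply]
    exact congrArg _ hP.w
  · intro U w t ht
    obtain ⟨t, rfl⟩ : ∃ k, a.hom.app _ k = t := ⟨_, ha _ _⟩
    rw [hab', ← NatTrans.naturality_apply] at ht
    have ht' : t ≫ p = w ≫ g := by
      have := congrArg (b.inv.app _) ht
      rwa [hb', hb'] at this
    refine ⟨hP.lift t w ht', ⟨hP.lift_snd _ _ _, ?_⟩, ?_⟩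
    · rw [← NatTrans.naturality_apply]
      exact congrArg _ (hP.lift_fst t w ht')
    · rintro q ⟨hq, hq'⟩
      refine hP.hom_ext ?_ ?_
      · rw [hP.lift_fst]
        rw [← NatTrans.naturality_apply] at hq'
        have := congrArg (a.inv.app _) hq'
        rwa [ha', ha'] at this
      · rw [hP.lift_snd, hq]

/-- If `B` represents `G`, the pullback of `φ` along the universal element of `G` over `B`
represents `F` itself. -/
lemma IsLocalCover.isCover {F G : Cᵒᵖ ⥤ Type v} {φ : F ⟶ G}
    (h : IsLocalCover W φ) (hG : IsRep G) : IsCover W φ := by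
  obtain ⟨B, ⟨b⟩⟩ := hG
  have hb : ∀ U x, b.hom.app U (b.inv.app U x) = x := fun U x =>
    congrArg (fun k => k.app U x) b.inv_hom_id
  have hb' : ∀ U x, b.inv.app U (b.hom.app U x) = x := fun U x =>
    congrArg (fun k => k.app U x) b.hom_inv_id
  have hy : ∀ (U : Cᵒᵖ) (w : U.unop ⟶ B), b.hom.app U w = G.map w.op (b.hom.app (op B) (𝟙 B)) := by
    intro U w
    rw [← NatTrans.naturality_apply]
    exact congrArg _ (Category.comp_id w).symm
  obtain ⟨A, p, s, hp, hs, hu⟩ := h B (b.hom.app (op B) (𝟙 B))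
  have key : ∀ U, Function.Bijective ((yonedaEquiv.symm s).app U) := by
    intro U
    constructor
    · intro q q' hqq
      change F.map q.op s = F.map q'.op s at hqq
      have h1 : q ≫ p = q' ≫ p := by
        have := congrArg (φ.app _) hqq
        rw [NatTrans.naturality_apply, NatTrans.naturality_apply, hs,
          ← Functor.map_comp_apply, ← Functor.map_comp_apply, ← op_comp, ← op_comp, ← hy, ← hy]
          at this
        have := congrArg (b.inv.app _) this
        rwa [hb', hb'] at this
      refine (hu U.unop (q ≫ p) (F.map q.op s) ?_).unique ⟨rfl, rfl⟩ ⟨h1.symm, hqq.symm⟩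
      rw [NatTrans.naturality_apply, hs, op_comp, Functor.map_comp_apply]
    · intro t
      obtain ⟨q, ⟨-, hq⟩, -⟩ := hu U.unop (b.inv.app U (φ.app U t)) t (by rw [← hy, hb])
      exact ⟨q, hq⟩
  have : ∀ U, IsIso ((yonedaEquiv.symm s).app U) := fun U =>
    (CategoryTheory.isIso_iff_bijective _).2 (key U)
  have : IsIso (yonedaEquiv.symm s) := NatIso.isIso_of_isIso_app _
  refine ⟨A, B, p, asIso (yonedaEquiv.symm s), b, hp, ?_⟩
  ext U q
  change φ.app U (F.map q.op s) = b.hom.app U (q ≫ p)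
  rw [NatTrans.naturality_apply, hs, hy U (q ≫ p), op_comp, Functor.map_comp_apply]

lemma IsLocalCover.isRep {F G : Cᵒᵖ ⥤ Type v} {φ : F ⟶ G} (h : IsLocalCover W φ)
    (hG : IsRep G) : IsRep F := (h.isCover hG).isRep_left

lemma IsLocalCover.comp (hW : IsPretopology W) {F G H : Cᵒᵖ ⥤ Type v} {φ : F ⟶ G} {ψ : G ⟶ H}
    (hφ : IsLocalCover W φ) (hψ : IsLocalCover W ψ) : IsLocalCover W (φ ≫ ψ) := by
  intro T g
  obtain ⟨P, p, s, hp, hs, hu⟩ := hψ T g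
  obtain ⟨P', p', s', hp', hs', hu'⟩ := hφ P s
  refine ⟨P', p' ≫ p, s', hW.comp _ _ hp' hp, ?_, ?_⟩
  · change ψ.app _ (φ.app _ s') = _
    rw [hs', NatTrans.naturality_apply, hs, op_comp, Functor.map_comp_apply]
  · intro U w t ht
    obtain ⟨q, ⟨hq, hq'⟩, hq''⟩ := hu U w (φ.app _ t) ht
    obtain ⟨r, ⟨hr, hr'⟩, hr''⟩ := hu' U q t hq'.symm
    refine ⟨r, ⟨by rw [← Category.assoc, hr, hq], hr'⟩, ?_⟩
    rintro r₁ ⟨h1, h2⟩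
    refine hr'' _ ⟨hq'' _ ⟨by rw [Category.assoc, h1], ?_⟩, h2⟩
    rw [op_comp, Functor.map_comp_apply, ← hs', ← NatTrans.naturality_apply, h2]

/-- Base change of local covers, along a square that is a pullback square pointwise. -/
lemma IsLocalCover.base_change {F G F' G' : Cᵒᵖ ⥤ Type v} {φ' : F' ⟶ G'}
    (h : IsLocalCover W φ') (φ : F ⟶ G) (a : F ⟶ F') (b : G ⟶ G')
    (hab : ∀ T x, φ'.app T (a.app T x) = b.app T (φ.app T x))
    (hu : ∀ T (y : G.obj T) (x' : F'.obj T), φ'.app T x' = b.app T y →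
      ∃! x, φ.app T x = y ∧ a.app T x = x') : IsLocalCover W φ := by
  intro T g
  obtain ⟨P, p, s, hp, hs, hP⟩ := h T (b.app _ g)
  obtain ⟨x, ⟨hx, hx'⟩, -⟩ := hu _ (G.map p.op g) s (by rw [hs, NatTrans.naturality_apply])
  refine ⟨P, p, x, hp, hx, ?_⟩
  intro U w t ht
  obtain ⟨q, ⟨hq, hq'⟩, hq''⟩ := hP U w (a.app _ t) (by rw [hab, ht, NatTrans.naturality_apply])
  refine ⟨q, ⟨hq, ?_⟩, ?_⟩
  · refine (hu _ _ _ (hab _ _)).unique ⟨?_, ?_⟩ ⟨rfl, rfl⟩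
    · rw [NatTrans.naturality_apply, hx, ht, ← hq, op_comp, Functor.map_comp_apply]
    · rw [NatTrans.naturality_apply, hx', hq']
  · rintro r ⟨h1, h2⟩
    exact hq'' _ ⟨h1, by rw [← h2, NatTrans.naturality_apply, hx']⟩

/-- A morphism that is bijective pointwise is a local cover. -/
lemma IsLocalCover.of_bijective (hW : IsPretopology W) {F G : Cᵒᵖ ⥤ Type v} (φ : F ⟶ G)
    (h : ∀ T, Function.Bijective (φ.app T)) : IsLocalCover W φ := by
  intro T g
  obtain ⟨s, rfl⟩ := (h _).2 g
  refine ⟨T, 𝟙 T, s, hW.of_isIso _ inferInstance, ?_, ?_⟩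
  · rw [op_id, Functor.map_id_apply]
  · intro U w t ht
    refine ⟨w, ⟨Category.comp_id w, ?_⟩, ?_⟩
    · rw [← NatTrans.naturality_apply] at ht
      exact ((h _).1 ht).symm
    · rintro q ⟨hq, -⟩
      rw [← hq, Category.comp_id]

/-- Transport of local covers along pointwise bijections. -/
lemma IsLocalCover.of_bijective_square (hW : IsPretopology W) {F G F' G' : Cᵒᵖ ⥤ Type v}
    {φ : F ⟶ G} (h : IsLocalCover W φ) (φ' : F' ⟶ G') (a : F ⟶ F') (b : G ⟶ G')
    (hab : ∀ T x, φ'.app T (a.app T x) = b.app T (φ.app T x))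
    (ha : ∀ T, Function.Bijective (a.app T)) (hb : ∀ T, Function.Bijective (b.app T)) :
    IsLocalCover W φ' := by
  have : ∀ T, IsIso (a.app T) := fun T => (CategoryTheory.isIso_iff_bijective _).2 (ha T)
  have : IsIso a := NatIso.isIso_of_isIso_app _
  have e : φ' = inv a ≫ φ ≫ b := by
    rw [IsIso.eq_inv_comp]
    ext T x
    exact hab T x
  rw [e]
  refine IsLocalCover.comp hW (.of_bijective hW _ fun T => ?_) (h.comp hW (.of_bijective hW _ hb))
  exact (CategoryTheory.isIso_iff_bijective _).1 inferInstance

lemma IsRep.of_bijective {F G : Cᵒᵖ ⥤ Type v} (hF : IsRep F) (a : F ⟶ G)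
    (ha : ∀ T, Function.Bijective (a.app T)) : IsRep G := by
  have : ∀ T, IsIso (a.app T) := fun T => (CategoryTheory.isIso_iff_bijective _).2 (ha T)
  have : IsIso a := NatIso.isIso_of_isIso_app _
  obtain ⟨B, ⟨b⟩⟩ := hF
  exact ⟨B, ⟨b ≪≫ asIso a⟩⟩

lemma IsRep.of_bijective' {F G : Cᵒᵖ ⥤ Type v} (hG : IsRep G) (a : F ⟶ G)
    (ha : ∀ T, Function.Bijective (a.app T)) : IsRep F := by
  have : ∀ T, IsIso (a.app T) := fun T => (CategoryTheory.isIso_iff_bijective _).2 (ha T)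
  have : IsIso a := NatIso.isIso_of_isIso_app _
  obtain ⟨B, ⟨b⟩⟩ := hG
  exact ⟨B, ⟨b ≪≫ (asIso a).symm⟩⟩

/-- The form in which right cancellation is applied to presheaves. Representability of `G` and `H`
turns the hypotheses into statements about morphisms of `C`, where the axiom applies. -/
lemma IsLocalCover.isCover_of_comp (hW : IsPretopology W) (hcancel : IsRightCancellative W)
    {F G H : Cᵒᵖ ⥤ Type v} {φ : F ⟶ G} {ψ : G ⟶ H} (hφ : IsLocalCover W φ)
    (hφψ : IsLocalCover W (φ ≫ ψ)) (hG : IsRep G) (hH : IsRep H) : IsCover W ψ := by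
  obtain ⟨A, B, p, a, b, hp, hab⟩ := hφ.isCover hG
  obtain ⟨A', D, r, a', d, hr, had⟩ := hφψ.isCover hH
  obtain ⟨q, hq⟩ := yoneda.map_surjective (b.hom ≫ ψ ≫ d.inv)
  obtain ⟨e, he⟩ := yoneda.map_surjective (a.hom ≫ a'.inv)
  have : IsIso (yoneda.map e) := by rw [he]; infer_instance
  have : IsIso e := isIso_of_reflects_iso e yoneda
  have hpq : p ≫ q = e ≫ r := by
    apply yoneda.map_injective
    rw [Functor.map_comp, Functor.map_comp, hq, he, ← reassoc_of% hab, Category.assoc,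
      (Iso.eq_comp_inv d).2 had.symm]
    simp
  refine ⟨B, D, q, b, d, hcancel p q hp ?_, by rw [hq]; simp⟩
  rw [hpq]
  exact hW.comp _ _ (hW.of_isIso _ inferInstance) hr

end LocalCovers

/-! ### Fibre products of presheaves by elements -/

section Pairs

variable {C : Type u} [Category.{v} C] {W : MorphismProperty C}

/-- The fibre product of presheaves, given by pairs. -/
def pairs {F G H : Cᵒᵖ ⥤ Type v} (φ : F ⟶ H) (ψ : G ⟶ H) : Cᵒᵖ ⥤ Type v where
  obj T := { x : F.obj T × G.obj T // φ.app T x.1 = ψ.app T x.2 }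
  map t := ↾fun x => ⟨(F.map t x.1.1, G.map t x.1.2), by
    rw [NatTrans.naturality_apply, x.2, NatTrans.naturality_apply]⟩
  map_id T := ConcreteCategory.hom_ext _ _ fun x => Subtype.ext
    (Prod.ext (Functor.map_id_apply F T x.1.1) (Functor.map_id_apply G T x.1.2))
  map_comp s t := ConcreteCategory.hom_ext _ _ fun x => Subtype.ext
    (Prod.ext (Functor.map_comp_apply F s t x.1.1) (Functor.map_comp_apply G s t x.1.2))

variable {F G H : Cᵒᵖ ⥤ Type v} (φ : F ⟶ H) (ψ : G ⟶ H)

/-- The first projection of a fibre product. -/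
def pairs.fst : pairs φ ψ ⟶ F where
  app _ := ↾fun x => x.1.1
  naturality _ _ _ := rfl

/-- The second projection of a fibre product. -/
def pairs.snd : pairs φ ψ ⟶ G where
  app _ := ↾fun x => x.1.2
  naturality _ _ _ := rfl

/-- The morphism into a fibre product given by two morphisms. -/
def pairs.lift {φ : F ⟶ H} {ψ : G ⟶ H} {E : Cᵒᵖ ⥤ Type v} (a : E ⟶ F) (b : E ⟶ G)
    (h : ∀ T x, φ.app T (a.app T x) = ψ.app T (b.app T x)) : E ⟶ pairs φ ψ where
  app T := ↾fun x => ⟨(a.app T x, b.app T x), h T x⟩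
  naturality _ _ t := ConcreteCategory.hom_ext _ _ fun x => Subtype.ext
    (Prod.ext (NatTrans.naturality_apply a t x) (NatTrans.naturality_apply b t x))

lemma pairs.isLocalCover_fst (h : IsLocalCover W ψ) : IsLocalCover W (pairs.fst φ ψ) := by
  refine h.base_change _ (pairs.snd φ ψ) φ (fun T x => x.2.symm) fun T y x' hx => ?_
  refine ⟨⟨(y, x'), hx.symm⟩, ⟨rfl, rfl⟩, ?_⟩
  rintro x ⟨rfl, rfl⟩
  rfl

lemma pairs.isLocalCover_snd (h : IsLocalCover W φ) : IsLocalCover W (pairs.snd φ ψ) := by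
  refine h.base_change _ (pairs.fst φ ψ) ψ (fun T x => x.2) fun T y x' hx => ?_
  refine ⟨⟨(x', y), hx⟩, ⟨rfl, rfl⟩, ?_⟩
  rintro x ⟨rfl, rfl⟩
  rfl

lemma pairs.isPullback : IsPullback (pairs.fst φ ψ) (pairs.snd φ ψ) φ ψ := by
  refine ⟨⟨by ext T x; exact x.2⟩, ⟨PullbackCone.IsLimit.mk _
    (fun s => pairs.lift s.fst s.snd fun T x => congrArg (fun k => k.app T x) s.condition)
    (fun s => rfl) (fun s => rfl) ?_⟩⟩
  intro s m h1 h2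
  ext T x
  exact Subtype.ext (Prod.ext (congrArg (fun k => k.app T x) h1)
    (congrArg (fun k => k.app T x) h2))

lemma isCover_pullback_snd_iff {K : Cᵒᵖ ⥤ Type v} (ρ : G ⟶ K) :
    IsCover W (pullback.snd φ ψ ≫ ρ) ↔ IsCover W (pairs.snd φ ψ ≫ ρ) := by
  let e : pairs φ ψ ≅ pullback φ ψ := (pairs.isPullback φ ψ).isoPullback
  have he : e.hom ≫ pullback.snd φ ψ = pairs.snd φ ψ := IsPullback.isoPullback_hom_snd _
  constructor
  · rintro ⟨A, B, p, a, b, hp, hab⟩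
    refine ⟨A, B, p, a ≪≫ e.symm, b, hp, ?_⟩
    rw [← hab, ← he]
    simp
  · rintro ⟨A, B, p, a, b, hp, hab⟩
    refine ⟨A, B, p, a ≪≫ e, b, hp, ?_⟩
    rw [← hab, ← he]
    simp

end Pairs

/-! ### Whiskering by bigons and unique lifting in 2-groupoids of sets -/

section TwoGroupoids

/-- Horns of dimension at least three have unique fillers. -/
def HasUniqueFillers (A : SSet.{v}) : Prop :=
  ∀ (m : ℕ) (k : Fin (m + 2)), 2 ≤ m →
    Function.Bijective fun g : Δ[m + 1] ⟶ A => (SSet.horn.{v} (m + 1) k).ι ≫ g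

lemma IsGroupoidObject.hasUniqueFillers {C : Type u} [Category.{v} C] {W : MorphismProperty C}
    {X : SimplicialObject C} (hX : IsGroupoidObject W 2 X) (T : Cᵒᵖ) :
    HasUniqueFillers ((points X).obj T) := by
  intro m k hm
  have := hX.kan_unique (m + 1) k (by omega) (by omega)
  exact (CategoryTheory.isIso_iff_bijective
    ((diagramsRestrict (SSet.horn.{v} (m + 1) k).ι X).app T)).1 inferInstance

variable {A B : SSet.{v}}

lemma HasUniqueFillers.existsUnique (hA : HasUniqueFillers A) {m : ℕ} (hm : 2 ≤ m)
    (k : Fin (m + 2)) (y : ∀ i ∈ ({k}ᶜ : Set (Fin (m + 2))), A _⦋m⦌) (hy : IsMatching _ y) :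
    ∃! x : A _⦋m + 1⦌, ∀ i hi, A.δ i x = y i hi := by
  have hK := isFaceUnion_horn.{v} k
  obtain ⟨g, hg⟩ := hK.exists_hom y hy
  obtain ⟨x, rfl⟩ := (hA m k hm).2 g
  refine ⟨SSet.yonedaEquiv x, fun i hi => ?_, fun x' hx' => ?_⟩
  · rw [← hg i hi, hK.eval_ι_comp]
  · obtain ⟨x', rfl⟩ := SSet.yonedaEquiv.surjective x'
    congr 1
    apply (hA m k hm).1
    refine hK.hom_ext fun i hi => ?_
    rw [hg, hK.eval_ι_comp, hx']

lemma HasUniqueFillers.existsUnique_one (hA : HasUniqueFillers A) (y₀ y₂ y₃ : A _⦋2⦌)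
    (h₀₂ : A.δ 0 y₂ = A.δ 1 y₀) (h₀₃ : A.δ 0 y₃ = A.δ 2 y₀) (h₂₃ : A.δ 2 y₃ = A.δ 2 y₂) :
    ∃! x : A _⦋3⦌, A.δ 0 x = y₀ ∧ A.δ 2 x = y₂ ∧ A.δ 3 x = y₃ := by
  obtain ⟨x, hx, hx'⟩ := hA.existsUnique (m := 2) le_rfl 1
    -- The entry at 1 is a dummy value: the face 1 is absent from the horn.
    (fun i _ => (![y₀, y₀, y₂, y₃] : Fin 4 → A _⦋2⦌) i) (isMatching_of_δ _ (by
      intro i j hij hi hj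
      fin_cases i <;> fin_cases j <;>
        first | assumption | (exact (hi rfl).elim) | (exact (hj rfl).elim) |
          (exact (hij.not_gt (by decide)).elim)))
  refine ⟨x, ⟨hx 0 (by decide), hx 2 (by decide), hx 3 (by decide)⟩, fun x' h => hx' _ ?_⟩
  intro i hi
  fin_cases i
  exacts [h.1, absurd rfl hi, h.2.1, h.2.2]

lemma HasUniqueFillers.existsUnique_two (hA : HasUniqueFillers A) (y₀ y₁ y₃ : A _⦋2⦌)
    (h₀₁ : A.δ 0 y₁ = A.δ 0 y₀) (h₀₃ : A.δ 0 y₃ = A.δ 2 y₀) (h₁₃ : A.δ 1 y₃ = A.δ 2 y₁) :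
    ∃! x : A _⦋3⦌, A.δ 0 x = y₀ ∧ A.δ 1 x = y₁ ∧ A.δ 3 x = y₃ := by
  obtain ⟨x, hx, hx'⟩ := hA.existsUnique (m := 2) le_rfl 2
    (fun i _ => (![y₀, y₁, y₀, y₃] : Fin 4 → A _⦋2⦌) i) (isMatching_of_δ _ (by
      intro i j hij hi hj
      fin_cases i <;> fin_cases j <;>
        first | assumption | (exact (hi rfl).elim) | (exact (hj rfl).elim) |
          (exact (hij.not_gt (by decide)).elim)))
  refine ⟨x, ⟨hx 0 (by decide), hx 1 (by decide), hx 3 (by decide)⟩, fun x' h => hx' _ ?_⟩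
  intro i hi
  fin_cases i
  exacts [h.1, h.2.1, absurd rfl hi, h.2.2]

lemma HasUniqueFillers.existsUnique_three (hA : HasUniqueFillers A) (y₀ y₁ y₂ : A _⦋2⦌)
    (h₀₁ : A.δ 0 y₁ = A.δ 0 y₀) (h₀₂ : A.δ 0 y₂ = A.δ 1 y₀) (h₁₂ : A.δ 1 y₂ = A.δ 1 y₁) :
    ∃! x : A _⦋3⦌, A.δ 0 x = y₀ ∧ A.δ 1 x = y₁ ∧ A.δ 2 x = y₂ := by
  obtain ⟨x, hx, hx'⟩ := hA.existsUnique (m := 2) le_rfl 3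
    (fun i _ => (![y₀, y₁, y₂, y₀] : Fin 4 → A _⦋2⦌) i) (isMatching_of_δ _ (by
      intro i j hij hi hj
      fin_cases i <;> fin_cases j <;>
        first | assumption | (exact (hi rfl).elim) | (exact (hj rfl).elim) |
          (exact (hij.not_gt (by decide)).elim)))
  refine ⟨x, ⟨hx 0 (by decide), hx 1 (by decide), hx 2 (by decide)⟩, fun x' h => hx' _ ?_⟩
  intro i hi
  fin_cases i
  exacts [h.1, h.2.1, h.2.2, absurd rfl hi]

lemma δ_zero_δ_one (A : SSet.{v}) {n : ℕ} (x : A _⦋n + 2⦌) :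
    A.δ 0 (A.δ 1 x) = A.δ 0 (A.δ 0 x) := SSet.δ_comp_δ_apply (Fin.zero_le (0 : Fin (n + 2))) x

lemma δ_zero_δ_two (A : SSet.{v}) {n : ℕ} (x : A _⦋n + 2⦌) :
    A.δ 0 (A.δ 2 x) = A.δ 1 (A.δ 0 x) := SSet.δ_comp_δ_apply (Fin.zero_le (1 : Fin (n + 2))) x

lemma δ_one_δ_two (A : SSet.{v}) {n : ℕ} (x : A _⦋n + 2⦌) :
    A.δ 1 (A.δ 2 x) = A.δ 1 (A.δ 1 x) := SSet.δ_comp_δ_apply (le_refl (1 : Fin (n + 2))) x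

lemma δ_zero_δ_three (A : SSet.{v}) (x : A _⦋3⦌) : A.δ 0 (A.δ 3 x) = A.δ 2 (A.δ 0 x) :=
  SSet.δ_comp_δ_apply (i := (0 : Fin 3)) (j := 2) (by decide) x

lemma δ_one_δ_three (A : SSet.{v}) (x : A _⦋3⦌) : A.δ 1 (A.δ 3 x) = A.δ 2 (A.δ 1 x) :=
  SSet.δ_comp_δ_apply (i := (1 : Fin 3)) (j := 2) (by decide) x

lemma δ_two_δ_three (A : SSet.{v}) (x : A _⦋3⦌) : A.δ 2 (A.δ 3 x) = A.δ 2 (A.δ 2 x) :=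
  SSet.δ_comp_δ_apply (i := (2 : Fin 3)) (j := 2) (by decide) x

lemma δ_zero_σ_zero (A : SSet.{v}) {n : ℕ} (x : A _⦋n⦌) : A.δ 0 (A.σ 0 x) = x :=
  SSet.δ_comp_σ_self_apply (0 : Fin (n + 1)) x

lemma δ_one_σ_zero (A : SSet.{v}) {n : ℕ} (x : A _⦋n⦌) : A.δ 1 (A.σ 0 x) = x :=
  SSet.δ_comp_σ_succ_apply (0 : Fin (n + 1)) x

lemma δ_two_σ_zero (A : SSet.{v}) {n : ℕ} (x : A _⦋n + 1⦌) : A.δ 2 (A.σ 0 x) = A.σ 0 (A.δ 1 x) :=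
  SSet.δ_comp_σ_of_gt_apply (i := (1 : Fin (n + 2))) (j := 0) (Fin.succ_pos (0 : Fin (n + 1))) x

lemma δ_zero_σ_one (A : SSet.{v}) {n : ℕ} (x : A _⦋n + 1⦌) : A.δ 0 (A.σ 1 x) = A.σ 0 (A.δ 0 x) :=
  SSet.δ_comp_σ_of_le_apply (i := (0 : Fin (n + 2))) (j := 0) (Fin.zero_le _) x

lemma δ_one_σ_one (A : SSet.{v}) {n : ℕ} (x : A _⦋n + 1⦌) : A.δ 1 (A.σ 1 x) = x :=
  SSet.δ_comp_σ_self_apply (1 : Fin (n + 2)) x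

lemma δ_two_σ_one (A : SSet.{v}) {n : ℕ} (x : A _⦋n + 1⦌) : A.δ 2 (A.σ 1 x) = x :=
  SSet.δ_comp_σ_succ_apply (1 : Fin (n + 2)) x

lemma δ_three_σ_one (A : SSet.{v}) (x : A _⦋2⦌) : A.δ 3 (A.σ 1 x) = A.σ 1 (A.δ 2 x) :=
  SSet.δ_comp_σ_of_gt_apply (i := (2 : Fin 3)) (j := 1) (by decide) x

/-- The 2-simplex `z` is the composite of the bigon `b` from `δ 1 b = δ 2 z` to `δ 2 b = δ 2 y`
with the 2-simplex `y`. -/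
def IsWhiskering (b y z : A _⦋2⦌) : Prop :=
  ∃ w : A _⦋3⦌, A.δ 0 w = A.σ 0 (A.δ 0 y) ∧ A.δ 1 w = z ∧ A.δ 2 w = y ∧ A.δ 3 w = b

namespace IsWhiskering

variable {b y z : A _⦋2⦌}

lemma δ_zero (h : IsWhiskering b y z) : A.δ 0 z = A.δ 0 y := by
  obtain ⟨w, h0, rfl, rfl, rfl⟩ := h
  rw [δ_zero_δ_one, h0, δ_zero_σ_zero]

lemma δ_one (h : IsWhiskering b y z) : A.δ 1 z = A.δ 1 y := by
  obtain ⟨w, h0, rfl, rfl, rfl⟩ := h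
  rw [← δ_one_δ_two]

lemma δ_two (h : IsWhiskering b y z) : A.δ 2 z = A.δ 1 b := by
  obtain ⟨w, h0, rfl, rfl, rfl⟩ := h
  rw [δ_one_δ_three]

lemma bigon_δ_two (h : IsWhiskering b y z) : A.δ 2 b = A.δ 2 y := by
  obtain ⟨w, h0, rfl, rfl, rfl⟩ := h
  rw [δ_two_δ_three]

lemma bigon_δ_zero (h : IsWhiskering b y z) : A.δ 0 b = A.σ 0 (A.δ 1 (A.δ 0 y)) := by
  obtain ⟨w, h0, rfl, rfl, rfl⟩ := h
  rw [δ_zero_δ_three, h0, δ_two_σ_zero]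

lemma map (h : IsWhiskering b y z) (f : A ⟶ B) :
    IsWhiskering (f.app _ b) (f.app _ y) (f.app _ z) := by
  obtain ⟨w, h0, rfl, rfl, rfl⟩ := h
  refine ⟨f.app _ w, ?_, ?_, ?_, ?_⟩ <;>
    simp only [← SSet.δ_naturality_apply, ← SSet.σ_naturality_apply, h0]

/-- Identity bigons act trivially, as the 3-simplex `σ 1 y` shows. -/
lemma degenerate (y : A _⦋2⦌) : IsWhiskering (A.σ 1 (A.δ 2 y)) y y :=
  ⟨A.σ 1 y, δ_zero_σ_one _ _, δ_one_σ_one _ _, δ_two_σ_one _ _, δ_three_σ_one _ _⟩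

end IsWhiskering

namespace HasUniqueFillers

variable (hA : HasUniqueFillers A)

include hA

/-- The face 0 of the 3-simplex in `IsWhiskering` is prescribed, and `z`, `y`, `b` are the faces 1,
2, 3. Here and in the next two lemmas, two of the three are given and the unique filler of a horn
supplies the third. -/
lemma existsUnique_whiskering (b y : A _⦋2⦌) (h0 : A.δ 0 b = A.σ 0 (A.δ 1 (A.δ 0 y)))
    (h2 : A.δ 2 b = A.δ 2 y) : ∃! z, IsWhiskering b y z := by
  obtain ⟨w, hw, hu⟩ := hA.existsUnique_one (A.σ 0 (A.δ 0 y)) y b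
    (by rw [δ_one_σ_zero]) (by rw [h0, δ_two_σ_zero]) h2
  refine ⟨A.δ 1 w, ⟨w, hw.1, rfl, hw.2⟩, ?_⟩
  rintro z ⟨w', h0', rfl, h2', h3'⟩
  rw [hu w' ⟨h0', h2', h3'⟩]

lemma existsUnique_whiskered (b z : A _⦋2⦌) (h0 : A.δ 0 b = A.σ 0 (A.δ 1 (A.δ 0 z)))
    (h1 : A.δ 1 b = A.δ 2 z) : ∃! y, IsWhiskering b y z := by
  obtain ⟨w, hw, hu⟩ := hA.existsUnique_two (A.σ 0 (A.δ 0 z)) z b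
    (by rw [δ_zero_σ_zero]) (by rw [h0, δ_two_σ_zero]) h1
  refine ⟨A.δ 2 w, ⟨w, ?_, hw.2.1, rfl, hw.2.2⟩, ?_⟩
  · rw [hw.1, δ_zero_δ_two, hw.1, δ_one_σ_zero]
  · rintro y ⟨w', h0', h1', rfl, h3'⟩
    rw [hu w' ⟨?_, h1', h3'⟩]
    rw [h0', ← h1', δ_zero_δ_one, δ_zero_δ_two, h0', δ_one_σ_zero, δ_zero_σ_zero]

lemma existsUnique_bigon (y z : A _⦋2⦌) (h0 : A.δ 0 z = A.δ 0 y)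
    (h1 : A.δ 1 z = A.δ 1 y) : ∃! b, IsWhiskering b y z := by
  obtain ⟨w, hw, hu⟩ := hA.existsUnique_three (A.σ 0 (A.δ 0 y)) z y
    (by rw [δ_zero_σ_zero, h0]) (by rw [δ_one_σ_zero]) h1.symm
  refine ⟨A.δ 3 w, ⟨w, hw.1, hw.2.1, hw.2.2, rfl⟩, ?_⟩
  rintro b ⟨w', h0', h1', h2', rfl⟩
  rw [hu w' ⟨h0', h1', h2'⟩]

end HasUniqueFillers

/-- The map induced by `f` on groupoids of bigons is fully faithful. -/
def LiftsBigons (f : A ⟶ B) : Prop :=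
  ∀ (x x' : A _⦋1⦌) (y : B _⦋2⦌), A.δ 0 x = A.δ 0 x' → A.δ 1 x = A.δ 1 x' →
    B.δ 0 y = B.σ 0 (f.app _ (A.δ 0 x)) → B.δ 1 y = f.app _ x → B.δ 2 y = f.app _ x' →
    ∃! z : A _⦋2⦌, (A.δ 0 z = A.σ 0 (A.δ 0 x) ∧ A.δ 1 z = x ∧ A.δ 2 z = x') ∧ f.app _ z = y

/-- Triangles lift uniquely along `f` once their boundary is lifted. -/
def LiftsTriangles (f : A ⟶ B) : Prop :=
  ∀ (x₀ x₁ x₂ : A _⦋1⦌) (y : B _⦋2⦌), A.δ 0 x₁ = A.δ 0 x₀ → A.δ 0 x₂ = A.δ 1 x₀ →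
    A.δ 1 x₂ = A.δ 1 x₁ → B.δ 0 y = f.app _ x₀ → B.δ 1 y = f.app _ x₁ → B.δ 2 y = f.app _ x₂ →
    ∃! z : A _⦋2⦌, (A.δ 0 z = x₀ ∧ A.δ 1 z = x₁ ∧ A.δ 2 z = x₂) ∧ f.app _ z = y

/-- A bigon is a triangle whose face 0 is degenerate. -/
lemma LiftsTriangles.liftsBigons {f : A ⟶ B} (h : LiftsTriangles f) : LiftsBigons f := by
  intro x x' y h0 h1 hy0 hy1 hy2
  refine h _ x x' y ?_ ?_ h1.symm ?_ hy1 hy2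
  · rw [δ_zero_σ_zero]
  · rw [δ_one_σ_zero, h0]
  · rw [hy0, SSet.σ_naturality_apply]

/-- The triangles `z` and `z'` differ by a bigon `b` from an edge to itself. Its image is the
difference of `f z` from itself, hence degenerate; by uniqueness of lifts `b` is degenerate, so `z'
= z`. -/
lemma LiftsBigons.triangle_unique {f : A ⟶ B} (h : LiftsBigons f) (hA : HasUniqueFillers A)
    (hB : HasUniqueFillers B) (z z' : A _⦋2⦌) (h0 : A.δ 0 z' = A.δ 0 z) (h1 : A.δ 1 z' = A.δ 1 z)
    (h2 : A.δ 2 z' = A.δ 2 z) (hf : f.app _ z' = f.app _ z) : z' = z := by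
  obtain ⟨b, hb, -⟩ := hA.existsUnique_bigon z z' h0 h1
  have e : f.app _ b = B.σ 1 (f.app _ (A.δ 2 z)) := by
    refine (hB.existsUnique_bigon (f.app _ z) (f.app _ z) rfl rfl).unique ?_ ?_
    · simpa only [hf] using hb.map f
    · rw [SSet.δ_naturality_apply]
      exact .degenerate _
  have hb' : b = A.σ 1 (A.δ 2 z) := by
    refine (h (A.δ 2 z) (A.δ 2 z) (f.app _ b) rfl rfl ?_ ?_ ?_).unique
      ⟨⟨?_, ?_, ?_⟩, rfl⟩ ⟨⟨δ_zero_σ_one _ _, δ_one_σ_one _ _, δ_two_σ_one _ _⟩, ?_⟩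
    · rw [e, δ_zero_σ_one, ← SSet.δ_naturality_apply f 0]
    · rw [e, δ_one_σ_one]
    · rw [e, δ_two_σ_one]
    · rw [hb.bigon_δ_zero, δ_zero_δ_two]
    · rw [← hb.δ_two, h2]
    · rw [hb.bigon_δ_two]
    · rw [e, SSet.σ_naturality_apply]
  subst hb'
  refine (hA.existsUnique_whiskering _ z ?_ ?_).unique hb (.degenerate z)
  · exact hb.bigon_δ_zero
  · exact hb.bigon_δ_two

/-- The triangle `w` has the right faces 0 and 1, but not the right face 2 and not the right image.
In `B` the triangle `y` differs from `f w` by a bigon; this bigon is lifted to one from `x₂` to `A.δ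
2 w`, and `w` is corrected by it. -/
lemma LiftsBigons.triangle_exists {f : A ⟶ B} (h : LiftsBigons f) (hA : HasUniqueFillers A)
    (hB : HasUniqueFillers B) (x₂ : A _⦋1⦌) (w : A _⦋2⦌) (y : B _⦋2⦌)
    (h02 : A.δ 0 x₂ = A.δ 1 (A.δ 0 w)) (h12 : A.δ 1 x₂ = A.δ 1 (A.δ 1 w))
    (hy0 : B.δ 0 y = f.app _ (A.δ 0 w)) (hy1 : B.δ 1 y = f.app _ (A.δ 1 w))
    (hy2 : B.δ 2 y = f.app _ x₂) : ∃ z : A _⦋2⦌,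
      (A.δ 0 z = A.δ 0 w ∧ A.δ 1 z = A.δ 1 w ∧ A.δ 2 z = x₂) ∧ f.app _ z = y := by
  obtain ⟨b, hb, -⟩ := hB.existsUnique_bigon (f.app _ w) y
    (by rw [hy0, SSet.δ_naturality_apply]) (by rw [hy1, SSet.δ_naturality_apply])
  obtain ⟨c, ⟨⟨hc0, hc1, hc2⟩, rfl⟩, -⟩ := h x₂ (A.δ 2 w) b
    (by rw [h02, δ_zero_δ_two]) (by rw [h12, δ_one_δ_two])
    (by rw [hb.bigon_δ_zero, h02, SSet.δ_naturality_apply, SSet.δ_naturality_apply])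
    (by rw [← hb.δ_two, hy2]) (by rw [hb.bigon_δ_two, SSet.δ_naturality_apply])
  obtain ⟨z, hz, -⟩ := hA.existsUnique_whiskering c w (by rw [hc0, h02]) hc2
  refine ⟨z, ⟨hz.δ_zero, hz.δ_one, hz.δ_two.trans hc1⟩, ?_⟩
  exact (hB.existsUnique_whiskering _ (f.app _ w) hb.bigon_δ_zero hb.bigon_δ_two).unique
    (hz.map f) hb

/-- `k`-simplices lift uniquely along `f` once their boundary is lifted. -/
def LiftsSimplices (k : ℕ) (f : A ⟶ B) : Prop :=
  ∀ (p : ((SSet.boundary.{v} k : SSet) ⟶ A)) (y : Δ[k] ⟶ B),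
    (SSet.boundary.{v} k).ι ≫ y = p ≫ f → ∃! x, (SSet.boundary.{v} k).ι ≫ x = p ∧ x ≫ f = y

lemma liftsSimplices_two_iff (f : A ⟶ B) : LiftsSimplices 2 f ↔ LiftsTriangles f := by
  have hK := isFaceUnion_boundary.{v} (m := 1)
  constructor
  · intro h x₀ x₁ x₂ y h01 h02 h12 hy0 hy1 hy2
    obtain ⟨p, hp⟩ := hK.exists_hom (fun i _ => (![x₀, x₁, x₂] : Fin 3 → A _⦋1⦌) i)
      (isMatching_of_δ _ (by
        intro i j hij hi hj
        fin_cases i <;> fin_cases j <;>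
          first | assumption | (exact (hij.not_gt (by decide)).elim)))
    have hpy : (SSet.boundary.{v} 2).ι ≫ SSet.yonedaEquiv.symm y = p ≫ f := by
      refine hK.hom_ext fun j hj => ?_
      rw [hK.eval_ι_comp, hK.eval_comp, hp, Equiv.apply_symm_apply]
      fin_cases j
      exacts [hy0, hy1, hy2]
    obtain ⟨x, ⟨hx, hxf⟩, hu⟩ := h p (SSet.yonedaEquiv.symm y) hpy
    refine ⟨SSet.yonedaEquiv x, ⟨?_, ?_⟩, ?_⟩
    · subst hx
      simp only [hK.eval_ι_comp] at hp
      exact ⟨hp 0 trivial, hp 1 trivial, hp 2 trivial⟩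
    · rw [← SSet.yonedaEquiv_comp, hxf, Equiv.apply_symm_apply]
    · rintro z ⟨⟨h0, h1, h2⟩, hz⟩
      rw [← Equiv.symm_apply_eq]
      refine hu _ ⟨hK.hom_ext fun j hj => ?_, ?_⟩
      · rw [hK.eval_ι_comp, hp, Equiv.apply_symm_apply]
        fin_cases j
        exacts [h0, h1, h2]
      · rw [SSet.yonedaEquiv_symm_comp, hz]
  · intro h p y hpy
    have hy : ∀ j, B.δ j (SSet.yonedaEquiv y) = f.app _ (hK.eval p j trivial) := fun j => by
      rw [← hK.eval_ι_comp y j trivial]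
      exact congrArg (fun g => hK.eval g j trivial) hpy
    obtain ⟨z, ⟨⟨h0, h1, h2⟩, hz⟩, hu⟩ := h (hK.eval p 0 trivial) (hK.eval p 1 trivial)
      (hK.eval p 2 trivial) (SSet.yonedaEquiv y)
      (hK.δ_eval p (i := (0 : Fin 2)) (j := 0) le_rfl trivial trivial)
      (hK.δ_eval p (i := (0 : Fin 2)) (j := 1) (by decide) trivial trivial)
      (hK.δ_eval p (i := (1 : Fin 2)) (j := 1) le_rfl trivial trivial) (hy 0) (hy 1) (hy 2)
    refine ⟨SSet.yonedaEquiv.symm z, ⟨hK.hom_ext fun j hj => ?_, ?_⟩, ?_⟩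
    · rw [hK.eval_ι_comp, Equiv.apply_symm_apply]
      fin_cases j
      exacts [h0, h1, h2]
    · rw [SSet.yonedaEquiv_symm_comp, hz, Equiv.symm_apply_apply]
    · rintro x ⟨rfl, rfl⟩
      rw [Equiv.eq_symm_apply]
      refine hu _ ⟨⟨?_, ?_, ?_⟩, ?_⟩
      · exact (hK.eval_ι_comp x 0 trivial).symm
      · exact (hK.eval_ι_comp x 1 trivial).symm
      · exact (hK.eval_ι_comp x 2 trivial).symm
      · rw [SSet.yonedaEquiv_comp]

/-- All faces but the last determine the simplex of `A`, by unique filling of a horn. Its image is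
`y` by unique filling in `B`. Its last face has the boundary and the image of the prescribed one, so
the two agree by uniqueness in dimension `k`. -/
lemma LiftsSimplices.succ {f : A ⟶ B} {k : ℕ} (hk : 2 ≤ k) (h : LiftsSimplices k f)
    (hA : HasUniqueFillers A) (hB : HasUniqueFillers B) : LiftsSimplices (k + 1) f := by
  obtain ⟨k, rfl⟩ : ∃ l, k = l + 1 := ⟨k - 1, by omega⟩
  intro p y hpy
  have hK := isFaceUnion_boundary.{v} (m := k + 1)
  have hK' := isFaceUnion_boundary.{v} (m := k)
  have hL := isFaceUnion_horn.{v} (Fin.last (k + 2))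
  have hle : SSet.horn.{v} (k + 2) (Fin.last (k + 2)) ≤ SSet.boundary.{v} (k + 2) := by
    intro n s hs
    obtain ⟨j, -, hj⟩ := (hL n s).1 hs
    exact (hK n s).2 ⟨j, trivial, hj⟩
  obtain ⟨x, hx⟩ := (hA (k + 1) (Fin.last _) hk).2 (SSet.Subcomplex.homOfLE hle ≫ p)
  have hxj : ∀ j : Fin (k + 3), j ≠ Fin.last _ →
      A.δ j (SSet.yonedaEquiv x) = hK.eval p j trivial := fun j hj => by
    rw [← hL.eval_ι_comp x j hj]
    exact congrArg (fun g => hL.eval g j hj) hx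
  have hxf : x ≫ f = y := by
    apply (hB (k + 1) (Fin.last _) hk).1
    change (SSet.horn.{v} (k + 2) (Fin.last (k + 2))).ι ≫ x ≫ f = _
    rw [← Category.assoc]
    refine (congrArg (· ≫ f) hx).trans ?_
    rw [Category.assoc, ← hpy]
    rfl
  have hlast : A.δ (Fin.last _) (SSet.yonedaEquiv x) = hK.eval p (Fin.last _) trivial := by
    apply SSet.yonedaEquiv.symm.injective
    refine (h
      ((SSet.boundary.{v} (k + 1)).ι ≫ SSet.yonedaEquiv.symm (hK.eval p (Fin.last _) trivial))
      (SSet.yonedaEquiv.symm (hK.eval p (Fin.last _) trivial) ≫ f)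
      (Category.assoc _ _ _).symm).unique ⟨?_, ?_⟩ ⟨rfl, rfl⟩
    · refine hK'.hom_ext fun j hj => ?_
      rw [hK'.eval_ι_comp, hK'.eval_ι_comp, Equiv.apply_symm_apply, Equiv.apply_symm_apply]
      refine (SSet.δ_comp_δ_apply (Fin.le_last j) _).trans ?_
      refine Eq.trans ?_ (hK.δ_eval p (Fin.le_last j) trivial trivial).symm
      rw [hxj _ (Fin.castSucc_lt_last j).ne]
    · rw [SSet.yonedaEquiv_symm_comp, SSet.yonedaEquiv_symm_comp, SSet.δ_naturality_apply,
        ← SSet.yonedaEquiv_comp, hxf]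
      congr 1
      rw [← hK.eval_ι_comp y _ trivial, hpy]
      rfl
  refine ⟨x, ⟨hK.hom_ext fun j hj => ?_, hxf⟩, ?_⟩
  · rw [hK.eval_ι_comp]
    by_cases hj' : j = Fin.last _
    · subst hj'
      exact hlast
    · exact hxj j hj'
  · rintro x' ⟨rfl, -⟩
    apply (hA (k + 1) (Fin.last _) hk).1
    exact hx.symm

lemma LiftsTriangles.liftsSimplices {f : A ⟶ B} (h : LiftsTriangles f) (hA : HasUniqueFillers A)
    (hB : HasUniqueFillers B) {k : ℕ} (hk : 2 ≤ k) : LiftsSimplices k f := by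
  induction k, hk using Nat.le_induction with
  | base => exact (liftsSimplices_two_iff f).2 h
  | succ k hk ih => exact ih.succ hk hA hB

end TwoGroupoids

/-! ### The isomorphisms of `Δ[k] ⋆ Δ[0]` with a simplex and of `∂Δ[k] ⋆ Δ[0]` with a horn -/

section Cones

variable {k : ℕ}

/-- The image of the vertex `i` of a simplex of `Δ[k] ⋆ Δ[0]` in `Δ[k + 1]`. -/
noncomputable def JoinSimplex.vertex {n : SimplexCategory} (s : JoinSimplex.{v} Δ[k] Δ[0] n)
    (i : Fin (n.len + 1)) : Fin (k + 2) :=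
  open Classical in
  if h : i ∈ s.lower then
    ((SSet.stdSimplex.objEquiv (s.left ⦋0⦌ (SimplexCategory.const ⦋0⦌ n i)
      fun _ => h)).toOrderHom 0 : Fin (k + 1)).castSucc
  else Fin.last (k + 1)

lemma JoinSimplex.vertex_of_notMem {n : SimplexCategory} (s : JoinSimplex.{v} Δ[k] Δ[0] n)
    {i : Fin (n.len + 1)} (h : i ∉ s.lower) : s.vertex i = Fin.last (k + 1) :=
  dif_neg h

lemma JoinSimplex.vertex_left {n : SimplexCategory} (s : JoinSimplex.{v} Δ[k] Δ[0] n)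
    {m : SimplexCategory} (φ : m ⟶ n) (h : ∀ i, φ.toOrderHom i ∈ s.lower)
    (i : Fin (m.len + 1)) : s.vertex (φ.toOrderHom i) =
      ((SSet.stdSimplex.objEquiv (s.left m φ h)).toOrderHom i : Fin (k + 1)).castSucc := by
  have e := s.left_map m ⦋0⦌ (SimplexCategory.const ⦋0⦌ m i) φ h
  rw [vertex, dif_pos (h i)]
  congr 1
  exact congrArg (fun t => (SSet.stdSimplex.objEquiv t).toOrderHom 0) e.symm

lemma JoinSimplex.vertex_ne_last_iff {n : SimplexCategory} (s : JoinSimplex.{v} Δ[k] Δ[0] n)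
    (i : Fin (n.len + 1)) : s.vertex i ≠ Fin.last (k + 1) ↔ i ∈ s.lower := by
  by_cases h : i ∈ s.lower
  · refine iff_of_true ?_ h
    have := s.vertex_left (SimplexCategory.const ⦋0⦌ n i) (fun _ => h) 0
    change s.vertex i = _ at this
    rw [this]
    exact (Fin.castSucc_lt_last _).ne
  · simp [h, s.vertex_of_notMem h]

lemma JoinSimplex.vertex_monotone {n : SimplexCategory} (s : JoinSimplex.{v} Δ[k] Δ[0] n) :
    Monotone s.vertex := by
  intro i j hij
  by_cases hj : j ∈ s.lower
  · have hi : i ∈ s.lower := s.isLowerSet hij hj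
    have h : ∀ a, (SimplexCategory.mkOfLe (n := n.len) i j hij).toOrderHom a ∈ s.lower := by
      intro a
      change Fin 2 at a
      fin_cases a
      exacts [hi, hj]
    have h0 := s.vertex_left (SimplexCategory.mkOfLe (n := n.len) i j hij) h (0 : Fin 2)
    have h1 := s.vertex_left (SimplexCategory.mkOfLe (n := n.len) i j hij) h (1 : Fin 2)
    change s.vertex i = _ at h0
    change s.vertex j = _ at h1
    rw [h0, h1, Fin.castSucc_le_castSucc_iff]
    exact OrderHom.monotone _ (Fin.zero_le (1 : Fin 2))
  · rw [s.vertex_of_notMem hj]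
    exact Fin.le_last _

/-- The map `Δ[k] ⋆ Δ[0] ⟶ Δ[k + 1]`. -/
noncomputable def coneMap (k : ℕ) : join.{v} Δ[k] Δ[0] ⟶ Δ[k + 1] where
  app n := ↾fun (s : JoinSimplex.{v} Δ[k] Δ[0] n.unop) =>
    SSet.stdSimplex.objEquiv.symm (SimplexCategory.Hom.mk ⟨s.vertex, s.vertex_monotone⟩)
  naturality n n' θ := by
    refine ConcreteCategory.hom_ext _ _ fun (s : JoinSimplex.{v} Δ[k] Δ[0] n.unop) => ?_
    apply SSet.stdSimplex.objEquiv.injective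
    apply SimplexCategory.Hom.ext
    ext i : 2
    change (s.pull θ.unop).vertex i = s.vertex (θ.unop.toOrderHom i)
    by_cases h : θ.unop.toOrderHom i ∈ s.lower
    · have h1 := s.vertex_left (SimplexCategory.const ⦋0⦌ _ (θ.unop.toOrderHom i)) (fun _ => h) 0
      have h2 := (s.pull θ.unop).vertex_left (SimplexCategory.const ⦋0⦌ _ i) (fun _ => h) 0
      exact h2.trans h1.symm
    · rw [s.vertex_of_notMem h]
      exact (s.pull θ.unop).vertex_of_notMem h

lemma joinInl_coneMap (k : ℕ) :
    joinInl.{v} Δ[k] Δ[0] ≫ coneMap k = SSet.stdSimplex.δ (Fin.last (k + 1)) := by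
  refine SSet.hom_ext fun n => ConcreteCategory.hom_ext _ _ fun s => ?_
  apply SSet.stdSimplex.objEquiv.injective
  apply SimplexCategory.Hom.ext
  ext i : 2
  have h := JoinSimplex.vertex_left (k := k) ((joinInl.{v} Δ[k] Δ[0]).app n s)
    (𝟙 n.unop) (fun _ => trivial) i
  refine h.trans ?_
  refine Eq.trans ?_ (Fin.succAbove_last_apply _).symm
  congr 1

/-- The lower part consists of the vertices not sent to the last vertex; on it a simplex of `Δ[k]`
is determined by its vertices, and simplices of `Δ[0]` carry no information. -/
lemma coneMap_injective (k : ℕ) (n : SimplexCategoryᵒᵖ) :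
    Function.Injective ((coneMap.{v} k).app n) := by
  intro (s : JoinSimplex.{v} Δ[k] Δ[0] n.unop) (t : JoinSimplex.{v} Δ[k] Δ[0] n.unop) h
  have hst : s.vertex = t.vertex := by
    have := congrArg (fun q => (SSet.stdSimplex.objEquiv q).toOrderHom.toFun) h
    exact this
  have hl : s.lower = t.lower := by
    ext i
    rw [← s.vertex_ne_last_iff, hst, t.vertex_ne_last_iff]
  obtain ⟨L, hL, l, lm, r, rm⟩ := s
  obtain ⟨L', hL', l', lm', r', rm'⟩ := t
  obtain rfl : L = L' := hl
  refine JoinSimplex.ext rfl (heq_of_eq ?_) (heq_of_eq ?_)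
  · funext m φ hφ
    apply SSet.stdSimplex.objEquiv.injective
    apply SimplexCategory.Hom.ext
    ext i : 2
    have h1 := JoinSimplex.vertex_left ⟨L, hL, l, lm, r, rm⟩ φ hφ i
    have h2 := JoinSimplex.vertex_left ⟨L, hL, l', lm', r', rm'⟩ φ hφ i
    exact Fin.castSucc_injective _ (h1.symm.trans ((congrFun hst _).trans h2))
  · funext m φ hφ
    apply SSet.stdSimplex.objEquiv.injective
    exact Subsingleton.elim _ _

/-- A simplex of `Δ[k + 1]` belongs to the cone of `S` if its part away from the last vertex belongs
to `S`. -/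
def IsCone (S : (Δ[k] : SSet.{v}).Subcomplex) (K : (Δ[k + 1] : SSet.{v}).Subcomplex) : Prop :=
  ∀ (n : SimplexCategory) (θ : n ⟶ ⦋k + 1⦌), SSet.stdSimplex.objEquiv.symm θ ∈ K.obj (op n) ↔
    ∀ (m : SimplexCategory) (φ : m ⟶ n) (ψ : m ⟶ ⦋k⦌),
      φ ≫ θ = ψ ≫ SimplexCategory.δ (Fin.last (k + 1)) →
      SSet.stdSimplex.objEquiv.symm ψ ∈ S.obj (op m)

lemma isCone_top : IsCone (⊤ : (Δ[k] : SSet.{v}).Subcomplex) ⊤ :=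
  fun _ _ => iff_of_true trivial fun _ _ _ _ => trivial

/-- A simplex of `Δ[k + 1]` is outside the horn if and only if it hits every vertex but possibly the
last. In that case it has a face that is the whole of `Δ[k]`, which does not lie in the boundary. -/
lemma isCone_boundary (k : ℕ) :
    IsCone (SSet.boundary.{v} k) (SSet.horn.{v} (k + 1) (Fin.last (k + 1))) := by
  intro n θ
  rw [isFaceUnion_horn]
  constructor
  · rintro ⟨j, hj, hθ⟩ m φ ψ h hψ
    obtain ⟨j, rfl⟩ := Fin.eq_castSucc_of_ne_last hj
    obtain ⟨i, hi⟩ := hψ j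
    refine hθ (φ.toOrderHom i) ?_
    have := congrArg (fun t => t.toOrderHom i) h
    refine this.trans ?_
    change (Fin.last (k + 1)).succAbove (ψ.toOrderHom i) = _
    rw [Fin.succAbove_last_apply]
    exact congrArg Fin.castSucc hi
  · intro h
    by_contra! hθ
    choose! a ha using hθ
    have ha' : ∀ j : Fin (k + 1), θ.toOrderHom (a j.castSucc) = j.castSucc := fun j =>
      ha _ (Fin.castSucc_lt_last j).ne
    have hmono : Monotone fun j : Fin (k + 1) => a j.castSucc := by
      intro i j hij
      by_contra! hlt
      have := θ.toOrderHom.monotone hlt.le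
      rw [ha', ha', Fin.castSucc_le_castSucc_iff] at this
      obtain rfl := le_antisymm hij this
      exact lt_irrefl _ hlt
    -- The chosen preimages of the vertices `0, …, k` restrict `θ` to the last face of `Δ[k + 1]`,
    -- so the test simplex `ψ` is the identity.
    refine h ⦋k⦌ (SimplexCategory.Hom.mk ⟨_, hmono⟩) (𝟙 _) ?_ Function.surjective_id
    rw [Category.id_comp]
    apply SimplexCategory.Hom.ext
    ext i : 2
    refine (ha' i).trans ?_
    exact (Fin.succAbove_last_apply i).symm

/-- The simplex of `S ⋆ Δ[0]` given by a simplex of the cone of `S`. -/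
def IsCone.joinSimplex {S : (Δ[k] : SSet.{v}).Subcomplex} {K : (Δ[k + 1] : SSet.{v}).Subcomplex}
    (h : IsCone S K) {n : SimplexCategory} (θ : n ⟶ ⦋k + 1⦌)
    (hθ : SSet.stdSimplex.objEquiv.symm θ ∈ K.obj (op n)) : JoinSimplex.{v} (S : SSet) Δ[0] n where
  lower := { i | θ.toOrderHom i ≠ Fin.last (k + 1) }
  isLowerSet := fun a b hba ha hb => ha (Fin.last_le_iff.1 (hb ▸ θ.toOrderHom.monotone hba))
  left m φ hφ := ⟨SSet.stdSimplex.objEquiv.symm (SimplexCategory.Hom.mk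
      ⟨fun i => (θ.toOrderHom (φ.toOrderHom i)).castPred (hφ i), fun i j hij =>
        Fin.castPred_le_castPred (θ.toOrderHom.monotone (φ.toOrderHom.monotone hij)) _⟩), by
    refine (h n θ).1 hθ m φ _ ?_
    apply SimplexCategory.Hom.ext
    ext i : 2
    refine Eq.trans ?_ (Fin.succAbove_last_apply _).symm
    exact (Fin.castSucc_castPred _ (hφ i)).symm⟩
  left_map _ _ _ _ _ := rfl
  right m _ _ := SSet.stdSimplex.objEquiv.symm (SimplexCategory.const m ⦋0⦌ 0)
  right_map _ _ _ _ _ := rfl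

/-- A simplex of the join consists of its part in `S` and the vertices at the cone point. So the
image of `S ⋆ Δ[0]` is exactly what `IsCone` tests, and together with injectivity this identifies
`K` with the join. -/
lemma IsCone.coneMap_mem_iff {S : (Δ[k] : SSet.{v}).Subcomplex}
    {K : (Δ[k + 1] : SSet.{v}).Subcomplex} (h : IsCone S K) {n : SimplexCategoryᵒᵖ}
    (x : (Δ[k + 1] : SSet.{v}).obj n) :
    x ∈ K.obj n ↔ x ∈ Set.range ((joinMapLeft S.ι Δ[0] ≫ coneMap k).app n) := by
  obtain ⟨θ, rfl⟩ := SSet.stdSimplex.objEquiv.symm.surjective x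
  constructor
  · intro hθ
    refine ⟨h.joinSimplex θ hθ, ?_⟩
    apply SSet.stdSimplex.objEquiv.injective
    apply SimplexCategory.Hom.ext
    ext i : 2
    change JoinSimplex.vertex ((joinMapLeft S.ι Δ[0]).app n (h.joinSimplex θ hθ)) i =
      θ.toOrderHom i
    by_cases hi : θ.toOrderHom i = Fin.last (k + 1)
    · have hi' : i ∉ ((joinMapLeft S.ι Δ[0]).app n (h.joinSimplex θ hθ) :
          JoinSimplex Δ[k] Δ[0] n.unop).lower := fun h' => h' hi
      exact (JoinSimplex.vertex_of_notMem _ hi').trans hi.symm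
    · have := JoinSimplex.vertex_left
        (((joinMapLeft S.ι Δ[0]).app n (h.joinSimplex θ hθ) : JoinSimplex Δ[k] Δ[0] n.unop))
        (SimplexCategory.const ⦋0⦌ n.unop i) (fun _ => hi) 0
      exact this
  · rintro ⟨s, hs⟩
    refine (h n.unop θ).2 fun m φ ψ hψ => ?_
    have hθ : ∀ i, JoinSimplex.vertex ((joinMapLeft S.ι Δ[0]).app n s) i = θ.toOrderHom i :=
      fun i => congrArg (fun q => (SSet.stdSimplex.objEquiv q).toOrderHom i) hs
    have hv : ∀ i, JoinSimplex.vertex ((joinMapLeft S.ι Δ[0]).app n s) (φ.toOrderHom i) =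
        (ψ.toOrderHom i : Fin (k + 1)).castSucc := by
      intro i
      rw [hθ]
      refine (congrArg (fun t => t.toOrderHom i) hψ).trans ?_
      exact Fin.succAbove_last_apply _
    have hφ : ∀ i, φ.toOrderHom i ∈
        ((joinMapLeft S.ι Δ[0]).app n s : JoinSimplex Δ[k] Δ[0] n.unop).lower := by
      intro i
      refine (JoinSimplex.vertex_ne_last_iff _ _).1 ?_
      rw [hv]
      exact (Fin.castSucc_lt_last _).ne
    convert ((s : JoinSimplex (S : SSet) Δ[0] n.unop).left m φ hφ).2
    rw [Equiv.symm_apply_eq]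
    apply SimplexCategory.Hom.ext
    ext i : 2
    apply Fin.castSucc_injective
    rw [← hv]
    exact JoinSimplex.vertex_left _ φ hφ i

lemma joinMapLeft_injective {S S' : SSet.{v}} (g : S ⟶ S') (T : SSet.{v})
    (hg : ∀ n, Function.Injective (g.app n)) (n : SimplexCategoryᵒᵖ) :
    Function.Injective ((joinMapLeft g T).app n) := by
  intro s t h
  obtain ⟨L, hL, l, lm, r, rm⟩ := s
  obtain ⟨L', hL', l', lm', r', rm'⟩ := t
  have h := JoinSimplex.ext_iff.1 h
  obtain rfl : L = L' := h.1
  refine JoinSimplex.ext rfl (heq_of_eq ?_) h.2.2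
  funext m φ hφ
  exact hg _ (congrFun (congrFun (congrFun (eq_of_heq h.2.1) m) φ) hφ)

lemma IsCone.exists_iso {S : (Δ[k] : SSet.{v}).Subcomplex}
    {K : (Δ[k + 1] : SSet.{v}).Subcomplex} (h : IsCone S K) :
    ∃ e : join (S : SSet) Δ[0] ≅ (K : SSet), e.hom ≫ K.ι = joinMapLeft S.ι Δ[0] ≫ coneMap k := by
  let g : join (S : SSet) Δ[0] ⟶ (K : SSet) :=
    { app := fun n => ↾fun s => ⟨(joinMapLeft S.ι Δ[0] ≫ coneMap k).app n s,
        h.coneMap_mem_iff _ |>.2 ⟨s, rfl⟩⟩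
      naturality := fun n n' θ => ConcreteCategory.hom_ext _ _ fun s => Subtype.ext
        (NatTrans.naturality_apply (joinMapLeft S.ι Δ[0] ≫ coneMap k) θ s) }
  have : ∀ n, IsIso (g.app n) := by
    intro n
    rw [CategoryTheory.isIso_iff_bijective]
    constructor
    · intro s t hst
      refine joinMapLeft_injective S.ι Δ[0] (fun n => Subtype.val_injective) n ?_
      exact coneMap_injective k n (congrArg Subtype.val hst)
    · intro x
      obtain ⟨s, hs⟩ := (h.coneMap_mem_iff _).1 x.2
      exact ⟨s, Subtype.ext hs⟩
  have : IsIso g := NatIso.isIso_of_isIso_app g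
  exact ⟨asIso g, rfl⟩

lemma isIso_coneMap (k : ℕ) : IsIso (coneMap.{v} k) := by
  have : ∀ n, IsIso ((coneMap.{v} k).app n) := by
    intro n
    rw [CategoryTheory.isIso_iff_bijective]
    refine ⟨coneMap_injective k n, fun x => ?_⟩
    obtain ⟨s, hs⟩ := (isCone_top.coneMap_mem_iff x).1 trivial
    exact ⟨_, hs⟩
  exact NatIso.isIso_of_isIso_app _

/-- The isomorphism `Δ[k] ⋆ Δ[0] ≅ Δ[k + 1]`. -/
noncomputable def coneIso (k : ℕ) : join.{v} Δ[k] Δ[0] ≅ Δ[k + 1] :=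
  have := isIso_coneMap.{v} k
  asIso (coneMap k)

/-- The isomorphism of `∂Δ[k] ⋆ Δ[0]` with a horn. -/
noncomputable def boundaryConeIso (k : ℕ) :
    join.{v} (SSet.boundary k : SSet) Δ[0] ≅ SSet.horn (k + 1) (Fin.last (k + 1)) :=
  (isCone_boundary k).exists_iso.choose

lemma boundaryConeIso_hom_ι (k : ℕ) :
    (boundaryConeIso.{v} k).hom ≫ (SSet.horn (k + 1) (Fin.last (k + 1))).ι =
      joinMapLeft (SSet.boundary k).ι Δ[0] ≫ (coneIso k).hom :=
  (isCone_boundary k).exists_iso.choose_spec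

lemma joinInl_coneIso (k : ℕ) :
    joinInl.{v} Δ[k] Δ[0] ≫ (coneIso k).hom = SSet.stdSimplex.δ (Fin.last (k + 1)) :=
  joinInl_coneMap k

lemma joinInl_boundaryConeIso (k : ℕ) :
    joinInl.{v} (SSet.boundary k : SSet) Δ[0] ≫ (boundaryConeIso k).hom ≫
      (SSet.horn (k + 1) (Fin.last (k + 1))).ι =
      (SSet.boundary k).ι ≫ SSet.stdSimplex.δ (Fin.last (k + 1)) := by
  rw [boundaryConeIso_hom_ι, ← joinInl_coneIso]
  have := (joinSquare (SSet.boundary.{v} k).ι Δ[0]).w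
  exact (reassoc_of% this.symm) _

end Cones

/-! ### Restriction to unions of faces, and the last face map as a local cover -/

section FaceCovers

variable {C : Type u} [Category.{v} C] {W : MorphismProperty C}

/-- The face `d_i` on presheaves of simplices. -/
abbrev faceMap (G : Cᵒᵖ ⥤ SSet.{v}) {n : ℕ} (i : Fin (n + 2)) : level G (n + 1) ⟶ level G n :=
  Functor.whiskerLeft G (SSet.evaluation.map (SimplexCategory.δ i).op)

/-- The degeneracy `s_i` on presheaves of simplices. -/
abbrev degeneracyMap (G : Cᵒᵖ ⥤ SSet.{v}) {n : ℕ} (i : Fin (n + 1)) :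
    level G n ⟶ level G (n + 1) :=
  Functor.whiskerLeft G (SSet.evaluation.map (SimplexCategory.σ i).op)

lemma isRep_level (X : SimplicialObject C) (n : ℕ) : IsRep (level (points X) n) :=
  ⟨X _⦋n⦌, ⟨Iso.refl _⟩⟩

variable {X : SimplicialObject C} {m : ℕ} {K : (Δ[m + 1] : SSet.{v}).Subcomplex}
  {I : Set (Fin (m + 2))}

lemma IsFaceUnion.eval_map (hK : IsFaceUnion K I) {T T' : Cᵒᵖ} (t : T ⟶ T')
    (g : (diagrams (K : SSet) X).obj T) (i : Fin (m + 2)) (hi : i ∈ I) :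
    hK.eval ((diagrams (K : SSet) X).map t g) i hi =
      (level (points X) m).map t (hK.eval g i hi) := rfl

/-- The value of a diagram on a face. -/
def IsFaceUnion.evalMap (hK : IsFaceUnion K I) (X : SimplicialObject C) (i : Fin (m + 2))
    (hi : i ∈ I) : diagrams (K : SSet) X ⟶ level (points X) m where
  app _ := ↾fun g => hK.eval g i hi
  naturality _ _ _ := rfl

/-- The diagram given by a matching family of morphisms. -/
noncomputable def IsFaceUnion.desc (hK : IsFaceUnion K I) {G : Cᵒᵖ ⥤ Type v}
    (y : ∀ i ∈ I, (G ⟶ level (points X) m))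
    (hy : ∀ T (g : G.obj T), IsMatching I (A := (points X).obj T) fun i hi => (y i hi).app T g) :
    G ⟶ diagrams (K : SSet) X where
  app T := ↾fun g => (hK.exists_hom _ (hy T g)).choose
  naturality T T' t := by
    refine ConcreteCategory.hom_ext _ _ fun g => ?_
    refine hK.hom_ext fun i hi => ?_
    refine ((hK.exists_hom _ (hy T' (G.map t g))).choose_spec i hi).trans ?_
    refine (NatTrans.naturality_apply (y i hi) t g).trans ?_
    refine Eq.trans ?_ (hK.eval_map t _ i hi).symm
    exact congrArg _ ((hK.exists_hom _ (hy T g)).choose_spec i hi).symm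

lemma IsFaceUnion.eval_desc (hK : IsFaceUnion K I) {G : Cᵒᵖ ⥤ Type v}
    (y : ∀ i ∈ I, (G ⟶ level (points X) m))
    (hy : ∀ T (g : G.obj T), IsMatching I (A := (points X).obj T) fun i hi => (y i hi).app T g)
    (T : Cᵒᵖ) (g : G.obj T) (i : Fin (m + 2)) (hi : i ∈ I) :
    hK.eval ((hK.desc y hy).app T g) i hi = (y i hi).app T g :=
  (hK.exists_hom _ (hy T g)).choose_spec i hi

/-- The simplices of `X` as diagrams of shape `Δ[n]`. -/
def simplexDiagram (X : SimplicialObject C) (n : ℕ) : level (points X) n ⟶ diagrams Δ[n] X where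
  app _ := ↾fun x => SSet.yonedaEquiv.symm x
  naturality _ T' t := ConcreteCategory.hom_ext _ _ fun x =>
    (SSet.yonedaEquiv_symm_comp (Y := (points X).obj T') x ((points X).map t)).symm

/-- Base change of the restriction of simplices to a union of faces. -/
lemma IsFaceUnion.isLocalCover (hK : IsFaceUnion K I)
    (hX : IsLocalCover W (diagramsRestrict K.ι X)) {F G : Cᵒᵖ ⥤ Type v} (φ : F ⟶ G)
    (a : F ⟶ level (points X) (m + 1)) (y : ∀ i ∈ I, (G ⟶ level (points X) m))
    (hy : ∀ T (g : G.obj T), IsMatching I (A := (points X).obj T) fun i hi => (y i hi).app T g)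
    (hab : ∀ T x i hi, ((points X).obj T).δ i (a.app T x) = (y i hi).app T (φ.app T x))
    (hu : ∀ T (g : G.obj T) (z : ((points X).obj T) _⦋m + 1⦌),
      (∀ i hi, ((points X).obj T).δ i z = (y i hi).app T g) →
        ∃! x, φ.app T x = g ∧ a.app T x = z) : IsLocalCover W φ := by
  refine hX.base_change φ (a ≫ simplexDiagram X (m + 1)) (hK.desc y hy) ?_ ?_
  · intro T x
    refine hK.hom_ext fun i hi => ?_
    rw [hK.eval_desc, ← hab]
    refine (hK.eval_ι_comp _ i hi).trans ?_
    exact congrArg _ (SSet.yonedaEquiv.apply_symm_apply _)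
  · intro T g z hz
    obtain ⟨x, ⟨rfl, hx⟩, hx'⟩ := hu T g (SSet.yonedaEquiv z) (fun i hi => by
      rw [← hK.eval_desc y hy T g i hi, ← hK.eval_ι_comp z i hi]
      exact congrArg (fun q => hK.eval q i hi) hz)
    refine ⟨x, ⟨rfl, ?_⟩, ?_⟩
    · refine (congrArg SSet.yonedaEquiv.symm hx).trans ?_
      exact SSet.yonedaEquiv.symm_apply_apply z
    · rintro x' ⟨h1, rfl⟩
      exact hx' x' ⟨h1, (Equiv.apply_symm_apply (SSet.yonedaEquiv (X := (points X).obj T)) _).symm⟩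

lemma IsFaceUnion.isLocalCover_faceMap (hK : IsFaceUnion K I)
    (hX : IsLocalCover W (diagramsRestrict K.ι X)) {j : Fin (m + 2)} (hI : I = {j}) :
    IsLocalCover W (faceMap (points X) j) := by
  subst hI
  refine hK.isLocalCover hX (faceMap (points X) j) (𝟙 _) (fun _ _ => 𝟙 _) ?_ ?_ ?_
  · rintro T g i i' rfl rfl d α β h
    rw [cancel_mono] at h
    rw [h]
  · rintro T x i rfl
    rfl
  · intro T g z hz
    exact ⟨z, ⟨hz j rfl, rfl⟩, fun _ h => h.2⟩

/-- The union of the faces of `Δ[m + 1]` opposite to the vertices in `I`. -/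
def faceUnion (I : Set (Fin (m + 2))) : (Δ[m + 1] : SSet.{v}).Subcomplex where
  obj _ := { s | ∃ j ∈ I, ∀ i, SSet.stdSimplex.asOrderHom s i ≠ j }
  map θ s := by
    rintro ⟨j, hj, hs⟩
    exact ⟨j, hj, fun i => hs (θ.unop.toOrderHom i)⟩

lemma isFaceUnion_faceUnion (I : Set (Fin (m + 2))) : IsFaceUnion (faceUnion.{v} I) I :=
  fun _ _ => Iff.rfl

lemma IsFaceUnion.eq_faceUnion (hK : IsFaceUnion K I) : K = faceUnion I := by
  ext n s
  exact hK n s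

lemma IsGroupoidObject.isLocalCover_horn (hW : IsPretopology W) {n : ℕ}
    (hX : IsGroupoidObject W n X) (k : Fin (m + 2)) :
    IsLocalCover W (diagramsRestrict (SSet.horn.{v} (m + 1) k).ι X) :=
  (hX.kan _ _ (by omega)).isLocalCover hW

/-- The set of vertices greater than `r`. -/
def above (m r : ℕ) : Set (Fin (m + 2)) := { i | r < i.val }

/-- The restriction of diagrams along the union with one more face. -/
lemma isLocalCover_faceUnion_succ {p r : ℕ} (hr : r ≤ p)
    (h : IsLocalCover W (diagramsRestrict (faceUnion.{v} (above p r)).ι X))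
    (hle : faceUnion.{v} (above (p + 1) (r + 1)) ≤
      faceUnion.{v} (above (p + 1) r)) :
    IsLocalCover W (diagramsRestrict (SSet.Subcomplex.homOfLE hle) X) := by
  have hK := isFaceUnion_faceUnion.{v} (above p r)
  have hL := isFaceUnion_faceUnion.{v} (above (p + 1) r)
  have hL' := isFaceUnion_faceUnion.{v} (above (p + 1) (r + 1))
  -- The face to be added is opposite to `r + 1`. It meets the face opposite to `i.succ`, for `c ≤
  -- i`, in its own face `i`. Hence it meets the old union in `above p r`, one dimension lower, and
  -- adding it is a base change of `h`.
  let c : Fin (p + 2) := ⟨r + 1, by omega⟩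
  have hc : c.castSucc ∈ above (p + 1) r := Nat.lt_succ_self r
  have hs : ∀ i : Fin (p + 2), i ∈ above p r →
      i.succ ∈ above (p + 1) (r + 1) := fun i hi => Nat.succ_lt_succ hi
  refine hK.isLocalCover h _ (hL.evalMap X c.castSucc hc)
    (fun i hi => hL'.evalMap X i.succ (hs i hi) ≫ faceMap (points X) c) ?_ ?_ ?_
  · intro T g i j hi hj d α β hαβ
    change ((points X).obj T).map α.op (((points X).obj T).map _ _) =
      ((points X).obj T).map β.op (((points X).obj T).map _ _)
    rw [← Functor.map_comp_apply, ← Functor.map_comp_apply, ← op_comp, ← op_comp]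
    refine hL'.isMatching g i.succ j.succ (hs i hi) (hs j hj) _ _ _ ?_
    have hci : c ≤ i := hi
    have hcj : c ≤ j := hj
    rw [Category.assoc, Category.assoc, SimplexCategory.δ_comp_δ hci,
      SimplexCategory.δ_comp_δ hcj, reassoc_of% hαβ]
  · intro T g i hi
    exact (hL.δ_eval g (i := c) (j := i) hi hc
      ((Nat.lt_succ_self r).trans (hs i hi))).symm
  · intro T g z hz
    classical
    let y : ∀ i ∈ above (p + 1) r, ((points X).obj T) _⦋p + 1⦌ := fun i _ =>
      if h : i ∈ above (p + 1) (r + 1) then hL'.eval g i h else z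
    have hy : ∀ i hi (h : i ∈ (above (p + 1) (r + 1))), y i hi = hL'.eval g i h :=
      fun i hi h => dif_pos h
    have hyc : y c.castSucc hc = z := dif_neg (lt_irrefl (r + 1))
    have hcase : ∀ i : Fin (p + 3), i ∈ above (p + 1) r →
        i = c.castSucc ∨ i ∈ above (p + 1) (r + 1) := by
      intro i hi
      rcases (Nat.succ_le_of_lt hi).eq_or_lt with h | h
      · exact Or.inl (Fin.ext h.symm)
      · exact Or.inr h
    obtain ⟨q, hq⟩ := hL.exists_hom y (isMatching_of_δ y (by
      intro i j hij hi hj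
      have hj' : j.succ ∈ above (p + 1) (r + 1) := by
        have h1 : r < i.val := hi
        have h2 : i.val ≤ j.val := hij
        change r + 1 < j.val + 1
        omega
      rw [hy _ hj hj']
      rcases hcase _ hi with h | h
      · obtain rfl : i = c := Fin.castSucc_injective _ h
        rw [hyc]
        exact (hz j (Nat.lt_of_succ_lt_succ hj')).symm
      · rw [hy _ hi h]
        exact hL'.δ_eval g hij h hj'))
    refine ⟨q, ⟨?_, ?_⟩, ?_⟩
    · refine hL'.hom_ext fun i hi => ?_
      have hi' : i ∈ above (p + 1) r := (Nat.lt_succ_self r).trans hi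
      exact (hq i hi').trans (hy i hi' hi)
    · exact (hq _ hc).trans hyc
    · rintro q' ⟨rfl, rfl⟩
      refine hL.hom_ext fun i hi => ?_
      rw [hq]
      rcases hcase i hi with rfl | h
      · exact hyc.symm
      · exact (hy i hi h).symm

/-- For `r = 0` the union is the horn at 0. Increasing `r` by one drops one face, and the
restriction that forgets this face is a local cover by the previous lemma, so restrictions can be
composed. -/
lemma IsGroupoidObject.isLocalCover_faceUnion (hW : IsPretopology W) {n : ℕ}
    (hX : IsGroupoidObject W n X) (r : ℕ) : ∀ p : ℕ, r ≤ p →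
    IsLocalCover W (diagramsRestrict (faceUnion.{v} (above p r)).ι X) := by
  induction r with
  | zero =>
    intro p _
    have h := hX.isLocalCover_horn hW (0 : Fin (p + 2))
    have e : ({0}ᶜ : Set (Fin (p + 2))) = above p 0 := by
      ext i
      exact Fin.pos_iff_ne_zero.symm
    rwa [(isFaceUnion_horn.{v} (0 : Fin (p + 2))).eq_faceUnion, e] at h
  | succ r ih =>
    intro p hp
    obtain ⟨p, rfl⟩ : ∃ q, p = q + 1 := ⟨p - 1, by omega⟩
    have hle : faceUnion.{v} (above (p + 1) (r + 1)) ≤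
        faceUnion.{v} (above (p + 1) r) := by
      rintro n s ⟨j, hj, hs⟩
      exact ⟨j, (Nat.lt_succ_self r).trans hj, hs⟩
    exact (ih (p + 1) (by omega)).comp hW
      (isLocalCover_faceUnion_succ (by omega) (ih p (by omega)) hle)

/-- For `r = m` only the face opposite to `m + 1` remains. This is what makes the fibre products
`conePairs` representable. -/
lemma IsGroupoidObject.isLocalCover_last (hW : IsPretopology W) {n : ℕ}
    (hX : IsGroupoidObject W n X) (m : ℕ) :
    IsLocalCover W (faceMap (points X) (Fin.last (m + 1))) := by
  refine (isFaceUnion_faceUnion _).isLocalCover_faceMap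
    (hX.isLocalCover_faceUnion hW m m le_rfl) ?_
  ext i
  simp only [above, Set.mem_ofPred_eq, Set.mem_singleton_iff, Fin.ext_iff, Fin.val_last]
  omega

lemma IsGroupoidObject.isLocalCover_zero (hW : IsPretopology W) {n : ℕ}
    (hX : IsGroupoidObject W n X) :
    IsLocalCover W (faceMap (points X) (0 : Fin 2)) := by
  refine (isFaceUnion_horn.{v} (1 : Fin 2)).isLocalCover_faceMap (hX.isLocalCover_horn hW 1) ?_
  ext i
  fin_cases i <;> simp

end FaceCovers

/-! ### Squares over `Δ[k]` and `∂Δ[k]` as pairs of maps, and unique lifting for `k ≥ 2` -/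

section ConeSquares

variable {A B : SSet.{v}} {f : A ⟶ B} {k : ℕ}

/-- The inclusion of `∂Δ[k]` into the horn of `Δ[k + 1]` at the last vertex. -/
noncomputable def boundaryToHorn (k : ℕ) :
    (SSet.boundary.{v} k : SSet) ⟶ SSet.horn (k + 1) (Fin.last (k + 1)) :=
  joinInl _ Δ[0] ≫ (boundaryConeIso k).hom

lemma boundaryToHorn_ι (k : ℕ) :
    boundaryToHorn.{v} k ≫ (SSet.horn (k + 1) (Fin.last (k + 1))).ι =
      (SSet.boundary k).ι ≫ SSet.stdSimplex.δ (Fin.last (k + 1)) := by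
  rw [boundaryToHorn, Category.assoc, joinInl_boundaryConeIso]

lemma boundaryToHorn_inv (k : ℕ) :
    boundaryToHorn.{v} k ≫ (boundaryConeIso k).inv = joinInl _ Δ[0] := by
  simp [boundaryToHorn]

/-- The face of a horn on which the map from the boundary of the opposite face is evaluated. -/
lemma eval_boundaryToHorn_comp (g : (SSet.horn.{v} (k + 2) (Fin.last (k + 2)) : SSet) ⟶ B)
    (i : Fin (k + 2)) :
    isFaceUnion_boundary.eval (boundaryToHorn (k + 1) ≫ g) i trivial =
      B.δ (Fin.last (k + 1)) ((isFaceUnion_horn (Fin.last (k + 2))).eval g i.castSucc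
        (Fin.castSucc_lt_last i).ne) := by
  refine Eq.trans ?_ ((isFaceUnion_horn (Fin.last (k + 2))).app_eq g (n := op ⦋k⦌) i.castSucc
    (Fin.castSucc_lt_last i).ne (SimplexCategory.δ (Fin.last (k + 1))))
  change g.app _ ((boundaryToHorn (k + 1)).app _ _) = _
  congr 1
  apply Subtype.ext
  refine (congrArg (fun (q : (SSet.boundary.{v} (k + 1) : SSet) ⟶ Δ[k + 2]) => q.app (op ⦋k⦌)
    ⟨_, isFaceUnion_boundary.δ_mem (j := i) trivial⟩) (boundaryToHorn_ι (k + 1))).trans ?_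
  apply SSet.stdSimplex.objEquiv.injective
  exact SimplexCategory.δ_comp_δ (Fin.le_last i)

/-- The simplex of `A` in a square from `Δ[k] ⟶ Δ[k] ⋆ Δ[0]` to `f`. -/
def squareLeft (s : Arrow.mk (joinInl.{v} Δ[k] Δ[0]) ⟶ Arrow.mk f) : Δ[k] ⟶ A :=
  s.left

/-- The simplex of `B` in a square from `Δ[k] ⟶ Δ[k] ⋆ Δ[0]` to `f`. -/
noncomputable def squareRight (s : Arrow.mk (joinInl.{v} Δ[k] Δ[0]) ⟶ Arrow.mk f) :
    Δ[k + 1] ⟶ B :=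
  (coneIso k).inv ≫ s.right

lemma squareLeft_comp (s : Arrow.mk (joinInl.{v} Δ[k] Δ[0]) ⟶ Arrow.mk f) :
    squareLeft s ≫ f = SSet.stdSimplex.δ (Fin.last (k + 1)) ≫ squareRight s := by
  refine s.w.trans ?_
  rw [squareRight, ← joinInl_coneIso]
  simp

lemma map_squareLeft (s : Arrow.mk (joinInl.{v} Δ[k] Δ[0]) ⟶ Arrow.mk f) :
    f.app _ (SSet.yonedaEquiv (squareLeft s)) =
      B.δ (Fin.last (k + 1)) (SSet.yonedaEquiv (squareRight s)) := by
  rw [← SSet.yonedaEquiv_comp, squareLeft_comp, SSet.stdSimplex.yonedaEquiv_δ_comp]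

lemma square_ext {s t : Arrow.mk (joinInl.{v} Δ[k] Δ[0]) ⟶ Arrow.mk f}
    (h : squareLeft s = squareLeft t) (h' : squareRight s = squareRight t) : s = t :=
  Arrow.hom_ext _ _ h ((cancel_epi (coneIso k).inv).1 h')

lemma exists_square (x : Δ[k] ⟶ A) (y : Δ[k + 1] ⟶ B)
    (h : x ≫ f = SSet.stdSimplex.δ (Fin.last (k + 1)) ≫ y) :
    ∃ s : Arrow.mk (joinInl.{v} Δ[k] Δ[0]) ⟶ Arrow.mk f,
      squareLeft s = x ∧ squareRight s = y := by
  refine ⟨Arrow.homMk x ((coneIso k).hom ≫ y) ?_, rfl, ?_⟩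
  · refine h.trans ?_
    rw [← joinInl_coneIso, Category.assoc]
    rfl
  · simp [squareRight]

/-- The diagram in `A` in a square from `∂Δ[k] ⟶ ∂Δ[k] ⋆ Δ[0]` to `f`. -/
def bdSquareLeft (s : Arrow.mk (joinInl.{v} (SSet.boundary k : SSet) Δ[0]) ⟶ Arrow.mk f) :
    (SSet.boundary k : SSet) ⟶ A :=
  s.left

/-- The diagram in `B` in a square from `∂Δ[k] ⟶ ∂Δ[k] ⋆ Δ[0]` to `f`. -/
noncomputable def bdSquareRight
    (s : Arrow.mk (joinInl.{v} (SSet.boundary k : SSet) Δ[0]) ⟶ Arrow.mk f) :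
    (SSet.horn (k + 1) (Fin.last (k + 1)) : SSet) ⟶ B :=
  (boundaryConeIso k).inv ≫ s.right

lemma bdSquareLeft_comp
    (s : Arrow.mk (joinInl.{v} (SSet.boundary k : SSet) Δ[0]) ⟶ Arrow.mk f) :
    bdSquareLeft s ≫ f = boundaryToHorn k ≫ bdSquareRight s := by
  refine s.w.trans ?_
  rw [bdSquareRight, ← Category.assoc, boundaryToHorn_inv]
  rfl

lemma bdSquare_ext {s t : Arrow.mk (joinInl.{v} (SSet.boundary k : SSet) Δ[0]) ⟶ Arrow.mk f}
    (h : bdSquareLeft s = bdSquareLeft t) (h' : bdSquareRight s = bdSquareRight t) : s = t :=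
  Arrow.hom_ext _ _ h ((cancel_epi (boundaryConeIso k).inv).1 h')

lemma exists_bdSquare (x : (SSet.boundary.{v} k : SSet) ⟶ A)
    (y : (SSet.horn (k + 1) (Fin.last (k + 1)) : SSet) ⟶ B) (h : x ≫ f = boundaryToHorn k ≫ y) :
    ∃ s : Arrow.mk (joinInl.{v} (SSet.boundary k : SSet) Δ[0]) ⟶ Arrow.mk f,
      bdSquareLeft s = x ∧ bdSquareRight s = y := by
  refine ⟨Arrow.homMk x ((boundaryConeIso k).hom ≫ y) ?_, rfl, ?_⟩
  · refine h.trans ?_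
    rw [boundaryToHorn, Category.assoc]
    rfl
  · simp [bdSquareRight]

lemma bdSquareLeft_restrict (s : Arrow.mk (joinInl.{v} Δ[k] Δ[0]) ⟶ Arrow.mk f) :
    bdSquareLeft (joinSquare (SSet.boundary k).ι Δ[0] ≫ s) =
      (SSet.boundary k).ι ≫ squareLeft s := rfl

lemma bdSquareRight_restrict (s : Arrow.mk (joinInl.{v} Δ[k] Δ[0]) ⟶ Arrow.mk f) :
    bdSquareRight (joinSquare (SSet.boundary k).ι Δ[0] ≫ s) =
      (SSet.horn (k + 1) (Fin.last (k + 1))).ι ≫ squareRight s := by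
  change (boundaryConeIso k).inv ≫ joinMapLeft (SSet.boundary k).ι Δ[0] ≫ s.right = _
  rw [Iso.inv_comp_eq, ← Category.assoc, boundaryConeIso_hom_ι, squareRight]
  simp

/-- The `(k + 1)`-simplex of `B` in a square is determined by its horn and exists for every horn.
What is left is a `k`-simplex of `A` with prescribed boundary and image. -/
lemma restrict_bijective_iff (hB : HasUniqueFillers B) (hk : 2 ≤ k) :
    Function.Bijective (fun s : Arrow.mk (joinInl.{v} Δ[k] Δ[0]) ⟶ Arrow.mk f =>
      joinSquare (SSet.boundary k).ι Δ[0] ≫ s) ↔ LiftsSimplices k f := by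
  constructor
  · intro h p y hpy
    -- A lifting problem only contains a `k`-simplex of `B`. Its last degeneracy is a `(k +
    -- 1)`-simplex with `y` as last face, and turns the problem into a square.
    let y' : Δ[k + 1] ⟶ B := SSet.stdSimplex.σ (Fin.last k) ≫ y
    have hy' : SSet.stdSimplex.δ (Fin.last (k + 1)) ≫ y' = y := by
      have := SSet.stdSimplex.{v}.δ_comp_σ_succ (i := Fin.last k)
      rw [Fin.succ_last] at this
      exact (reassoc_of% this) y
    have key : ∀ x : Δ[k] ⟶ A, x ≫ f = y → (SSet.boundary k).ι ≫ x = p →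
        ∃ s : Arrow.mk (joinInl.{v} Δ[k] Δ[0]) ⟶ Arrow.mk f, squareLeft s = x ∧
          bdSquareLeft (joinSquare (SSet.boundary k).ι Δ[0] ≫ s) = p ∧
          bdSquareRight (joinSquare (SSet.boundary k).ι Δ[0] ≫ s) = (SSet.horn _ _).ι ≫ y' := by
      intro x hx hx'
      obtain ⟨s, hs, hs'⟩ := exists_square x y' (hx.trans hy'.symm)
      refine ⟨s, hs, ?_, ?_⟩
      · rw [bdSquareLeft_restrict, hs, hx']
      · rw [bdSquareRight_restrict, hs']
    obtain ⟨t, ht, ht'⟩ := exists_bdSquare (f := f) p ((SSet.horn _ _).ι ≫ y') (by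
      rw [← Category.assoc, boundaryToHorn_ι, Category.assoc, hy', hpy])
    obtain ⟨s, rfl⟩ := h.2 t
    rw [bdSquareLeft_restrict] at ht
    rw [bdSquareRight_restrict] at ht'
    have hs := (hB k (Fin.last _) hk).1 ht'
    refine ⟨squareLeft s, ⟨ht, ?_⟩, ?_⟩
    · rw [squareLeft_comp, hs, hy']
    · rintro x ⟨hx, hxf⟩
      obtain ⟨s', rfl, h1, h2⟩ := key x hxf hx
      congr 1
      apply h.1
      apply bdSquare_ext
      · exact h1.trans ht.symm
      · exact h2.trans (ht'.symm.trans (bdSquareRight_restrict s).symm)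
  · intro h
    constructor
    · intro s t hst
      have h1 := congrArg bdSquareLeft hst
      have h2 := congrArg bdSquareRight hst
      simp only [bdSquareLeft_restrict, bdSquareRight_restrict] at h1 h2
      have h3 := (hB k (Fin.last _) hk).1 h2
      refine square_ext ((h _ (squareLeft t ≫ f) (Category.assoc _ _ _).symm).unique
        ⟨h1, ?_⟩ ⟨rfl, rfl⟩) h3
      rw [squareLeft_comp, squareLeft_comp, h3]
    · intro t
      obtain ⟨y, hy⟩ := (hB k (Fin.last _) hk).2 (bdSquareRight t)
      dsimp only at hy
      obtain ⟨x, ⟨hx, hxf⟩, -⟩ := h (bdSquareLeft t)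
        (SSet.stdSimplex.δ (Fin.last (k + 1)) ≫ y) (by
          rw [bdSquareLeft_comp, ← hy, ← Category.assoc, ← boundaryToHorn_ι, Category.assoc])
      obtain ⟨s, hs, hs'⟩ := exists_square x y hxf
      refine ⟨s, bdSquare_ext ?_ ?_⟩
      · rw [bdSquareLeft_restrict, hs, hx]
      · rw [bdSquareRight_restrict, hs', hy]

end ConeSquares

/-! ### The acyclicity conditions in dimensions 0 and 1 as statements on fibre products -/

section ConePresheaves

variable {C : Type u} [Category.{v} C] {W : MorphismProperty C} {X Y : SimplicialObject C}
  (f : X ⟶ Y)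

/-- A simplex of `X` with a simplex of `Y` whose last face is its image. -/
abbrev conePairs (k : ℕ) : Cᵒᵖ ⥤ Type v :=
  pairs (levelMap (pointsMap f) k) (faceMap (points Y) (Fin.last (k + 1)))

lemma IsGroupoidObject.isRep_conePairs (hW : IsPretopology W) {n : ℕ}
    (hY : IsGroupoidObject W n Y) (k : ℕ) : IsRep (conePairs f k) :=
  (pairs.isLocalCover_fst _ _ (hY.isLocalCover_last hW k)).isRep (isRep_level X k)

/-- The comparison of squares from `Δ[k] ⟶ Δ[k] ⋆ Δ[0]` with pairs of simplices. -/
noncomputable def toConePairs (k : ℕ) :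
    squares (Arrow.mk (joinInl.{v} Δ[k] Δ[0])) f ⟶ conePairs f k where
  app _ := ↾fun s => ⟨(SSet.yonedaEquiv (squareLeft s), SSet.yonedaEquiv (squareRight s)),
    map_squareLeft s⟩
  naturality _ _ _ := rfl

lemma toConePairs_bijective (k : ℕ) (T : Cᵒᵖ) :
    Function.Bijective ((toConePairs f k).app T) := by
  constructor
  · intro s t h
    have h1 := congrArg (fun p => p.1.1) h
    have h2 := congrArg (fun p => p.1.2) h
    exact square_ext (SSet.yonedaEquiv.injective h1) (SSet.yonedaEquiv.injective h2)
  · rintro ⟨⟨x, y⟩, h⟩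
    obtain ⟨s, hs, hs'⟩ := exists_square (A := (points X).obj T) (B := (points Y).obj T)
      (f := (pointsMap f).app T) (SSet.yonedaEquiv.symm x)
      (SSet.yonedaEquiv.symm y) (by
        rw [SSet.yonedaEquiv_symm_comp, SSet.stdSimplex.δ_comp_yonedaEquiv_symm]
        exact congrArg _ h)
    refine ⟨s, Subtype.ext (Prod.ext ?_ ?_)⟩
    · refine (congrArg SSet.yonedaEquiv hs).trans ?_
      exact Equiv.apply_symm_apply _ _
    · refine (congrArg SSet.yonedaEquiv hs').trans ?_
      exact Equiv.apply_symm_apply _ _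

lemma isIso_squaresRestrict_iff {k : ℕ} (hY : IsGroupoidObject W 2 Y) (hk : 2 ≤ k) :
    IsIso (squaresRestrict (joinSquare (SSet.boundary.{v} k).ι Δ[0]) f) ↔
      ∀ T, LiftsSimplices k ((pointsMap f).app T) := by
  rw [NatTrans.isIso_iff_isIso_app]
  refine forall_congr' fun T => ?_
  rw [CategoryTheory.isIso_iff_bijective]
  exact restrict_bijective_iff (f := (pointsMap f).app T) (hY.hasUniqueFillers T) hk

/-- The other end of a 1-simplex of `Y` that starts in the image of a vertex of `X`. -/
abbrev coneTarget : conePairs f 0 ⟶ level (points Y) 0 :=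
  pairs.snd _ _ ≫ faceMap (points Y) 0

/-- The comparison of squares from `∂Δ[0] ⟶ ∂Δ[0] ⋆ Δ[0]` with vertices. -/
noncomputable def toVertex :
    squares (Arrow.mk (joinInl.{v} (SSet.boundary 0 : SSet) Δ[0])) f ⟶ level (points Y) 0 where
  app T := ↾fun s => (isFaceUnion_horn (Fin.last 1)).eval (bdSquareRight s) 0 (by decide)
  naturality _ _ _ := rfl

/-- The boundary of `Δ[0]` is empty, and the horn of `Δ[1]` at the last vertex is this vertex alone,
the face opposite to 0. -/
lemma toVertex_bijective (T : Cᵒᵖ) : Function.Bijective ((toVertex f).app T) := by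
  have hL := isFaceUnion_horn.{v} (Fin.last 1)
  constructor
  · intro s t h
    refine bdSquare_ext SSet.boundary.hom_ext₀ (hL.hom_ext fun j hj => ?_)
    fin_cases j
    · exact h
    · exact (hj rfl).elim
  · intro y
    obtain ⟨g, hg⟩ := hL.exists_hom (A := (points Y).obj T) (fun _ _ => y) (isMatching_of_zero _)
    have hempty : ∀ n (x : (SSet.boundary.{v} 0 : SSet).obj n), False := fun n x =>
      x.2 (Function.surjective_to_subsingleton (α := Fin (n.unop.len + 1)) (β := Fin 1) _)
    obtain ⟨s, -, hs⟩ := exists_bdSquare (f := (pointsMap f).app T)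
      { app := fun n => ↾fun x => (hempty n x).elim
        naturality := fun n n' θ => ConcreteCategory.hom_ext _ _ fun x => (hempty n x).elim } g
      SSet.boundary.hom_ext₀
    refine ⟨s, ?_⟩
    refine Eq.trans ?_ (hg 0 (by decide))
    exact congrArg (fun q => hL.eval q 0 _) hs

lemma isLocalCover_iff_of_bijective (hW : IsPretopology W) {F G F' G' : Cᵒᵖ ⥤ Type v} {φ : F ⟶ G}
    {φ' : F' ⟶ G'} (a : F ⟶ F') (b : G ⟶ G')
    (hab : ∀ T x, φ'.app T (a.app T x) = b.app T (φ.app T x))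
    (ha : ∀ T, Function.Bijective (a.app T)) (hb : ∀ T, Function.Bijective (b.app T)) :
    IsLocalCover W φ ↔ IsLocalCover W φ' := by
  refine ⟨fun h => h.of_bijective_square hW φ' a b hab ha hb, fun h => ?_⟩
  refine h.base_change φ a b hab fun T y x' hx => ?_
  obtain ⟨x, rfl⟩ := (ha T).2 x'
  rw [hab] at hx
  exact ⟨x, ⟨(hb T).1 hx, rfl⟩, fun z hz => (ha T).1 hz.2⟩

lemma isCover_iff_of_bijective (hW : IsPretopology W) {F G F' G' : Cᵒᵖ ⥤ Type v} {φ : F ⟶ G}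
    {φ' : F' ⟶ G'} (a : F ⟶ F') (b : G ⟶ G')
    (hab : ∀ T x, φ'.app T (a.app T x) = b.app T (φ.app T x))
    (ha : ∀ T, Function.Bijective (a.app T)) (hb : ∀ T, Function.Bijective (b.app T)) :
    IsCover W φ ↔ IsCover W φ' :=
  ⟨fun h => ((isLocalCover_iff_of_bijective hW a b hab ha hb).1 (h.isLocalCover hW)).isCover
    (h.isRep_right.of_bijective b hb),
  fun h => ((isLocalCover_iff_of_bijective hW a b hab ha hb).2 (h.isLocalCover hW)).isCover
    (h.isRep_right.of_bijective' b hb)⟩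

lemma isCover_squaresRestrict_zero_iff (hW : IsPretopology W) :
    IsCover W (squaresRestrict (joinSquare (SSet.boundary.{v} 0).ι Δ[0]) f) ↔
      IsCover W (coneTarget f) := by
  refine isCover_iff_of_bijective hW (toConePairs f 0) (toVertex f) (fun T s => ?_)
    (toConePairs_bijective f 0) (toVertex_bijective f)
  have hL := isFaceUnion_horn.{v} (Fin.last 1)
  change ((points Y).obj T).δ 0 (SSet.yonedaEquiv (squareRight s)) = hL.eval
    (bdSquareRight (joinSquare (SSet.boundary.{v} 0).ι Δ[0] ≫ s)) 0 (by decide)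
  refine (hL.eval_ι_comp (squareRight s) 0 (by decide)).symm.trans ?_
  exact congrArg (fun q => hL.eval q 0 _) (bdSquareRight_restrict s).symm

/-- The two horn edges of a triangle under an edge of `X`, together with the vertices of the
latter. -/
abbrev hornPairs : Cᵒᵖ ⥤ Type v := pairs (coneTarget f) (coneTarget f)

lemma conePairs_w {k : ℕ} {T : Cᵒᵖ} (x : (conePairs f k).obj T) :
    ((pointsMap f).app T).app _ x.1.1 = ((points Y).obj T).δ (Fin.last (k + 1)) x.1.2 :=
  x.2

/-- The boundary of a triangle under an edge of `X`. -/
def coneBoundary : conePairs f 1 ⟶ hornPairs f :=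
  pairs.lift
    (pairs.lift (pairs.fst _ _ ≫ faceMap (points X) 1) (pairs.snd _ _ ≫ faceMap (points Y) 1)
      (fun T x => (SSet.δ_naturality_apply ((pointsMap f).app T) 1 x.1.1).trans <|
        (congrArg _ (conePairs_w f x)).trans (δ_one_δ_two ((points Y).obj T) (n := 0) x.1.2)))
    (pairs.lift (pairs.fst _ _ ≫ faceMap (points X) 0) (pairs.snd _ _ ≫ faceMap (points Y) 0)
      (fun T x => (SSet.δ_naturality_apply ((pointsMap f).app T) 0 x.1.1).trans <|
        (congrArg _ (conePairs_w f x)).trans (δ_zero_δ_two ((points Y).obj T) (n := 0) x.1.2)))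
    (fun T x => δ_zero_δ_one ((points Y).obj T) (n := 0) x.1.2)

lemma bdSquare_eval {A B : SSet.{v}} {g : A ⟶ B} {k : ℕ}
    (s : Arrow.mk (joinInl.{v} (SSet.boundary (k + 1) : SSet) Δ[0]) ⟶ Arrow.mk g)
    (i : Fin (k + 2)) :
    g.app _ (isFaceUnion_boundary.eval (bdSquareLeft s) i trivial) =
      B.δ (Fin.last (k + 1)) ((isFaceUnion_horn (Fin.last (k + 2))).eval (bdSquareRight s)
        i.castSucc (Fin.castSucc_lt_last i).ne) := by
  rw [← eval_boundaryToHorn_comp, ← bdSquareLeft_comp]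
  rfl

/-- The comparison of squares from `∂Δ[1] ⟶ ∂Δ[1] ⋆ Δ[0]` with pairs of edges. -/
noncomputable def toHornPairs :
    squares (Arrow.mk (joinInl.{v} (SSet.boundary 1 : SSet) Δ[0])) f ⟶ hornPairs f where
  app T := ↾fun s => ⟨(⟨((isFaceUnion_boundary (m := 0)).eval (bdSquareLeft s) 1 trivial,
      (isFaceUnion_horn (Fin.last 2)).eval (bdSquareRight s) 1 (by decide)), bdSquare_eval s 1⟩,
    ⟨((isFaceUnion_boundary (m := 0)).eval (bdSquareLeft s) 0 trivial,
      (isFaceUnion_horn (Fin.last 2)).eval (bdSquareRight s) 0 (by decide)), bdSquare_eval s 0⟩),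
    (isFaceUnion_horn (Fin.last 2)).δ_eval (bdSquareRight s) (i := (0 : Fin 2)) (j := 0) le_rfl
      (by decide) (by decide)⟩
  naturality _ _ _ := rfl

lemma toHornPairs_bijective (T : Cᵒᵖ) : Function.Bijective ((toHornPairs f).app T) := by
  have hK := isFaceUnion_boundary.{v} (m := 0)
  have hL := isFaceUnion_horn.{v} (Fin.last 2)
  constructor
  · intro s t h
    refine bdSquare_ext (hK.hom_ext fun j hj => ?_) (hL.hom_ext fun j hj => ?_)
    · fin_cases j
      · exact congrArg (fun p => p.1.2.1.1) h
      · exact congrArg (fun p => p.1.1.1.1) h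
    · fin_cases j
      · exact congrArg (fun p => p.1.2.1.2) h
      · exact congrArg (fun p => p.1.1.1.2) h
      · exact (hj rfl).elim
  · rintro ⟨⟨⟨⟨a, e⟩, h⟩, ⟨⟨a', e'⟩, h'⟩⟩, hee⟩
    obtain ⟨p, hp⟩ := hK.exists_hom (A := (points X).obj T)
      -- The order is reversed, since the face opposite to 0 is the vertex 1.
      (fun i _ => (![a', a] : Fin 2 → ((points X).obj T) _⦋0⦌) i) (isMatching_of_zero _)
    obtain ⟨q, hq⟩ := hL.exists_hom (A := (points Y).obj T)
      -- The last entry is a dummy value, outside the horn.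
      (fun i _ => (![e', e, e'] : Fin 3 → ((points Y).obj T) _⦋1⦌) i) (isMatching_of_δ _ (by
        intro i j hij hi hj
        fin_cases i <;> fin_cases j <;> first | (exact (hj rfl).elim) | (exact hee) |
          (exact (hij.not_gt (by decide)).elim)))
    obtain ⟨s, hs, hs'⟩ := exists_bdSquare (f := (pointsMap f).app T) p q (by
      refine hK.hom_ext fun i hi => ?_
      rw [eval_boundaryToHorn_comp, hK.eval_comp, hp]
      refine Eq.trans ?_ (congrArg _ (hq i.castSucc (Fin.castSucc_lt_last i).ne)).symm
      fin_cases i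
      · exact h'
      · exact h)
    have hs1 : ∀ i, hK.eval (bdSquareLeft s) i trivial = _ := fun i =>
      (congrArg (fun g => hK.eval g i trivial) hs).trans (hp i trivial)
    have hs2 : ∀ i hi, hL.eval (bdSquareRight s) i hi = _ := fun i hi =>
      (congrArg (fun g => hL.eval g i hi) hs').trans (hq i hi)
    exact ⟨s, Subtype.ext (Prod.ext (Subtype.ext (Prod.ext (hs1 1) (hs2 1 (by decide))))
      (Subtype.ext (Prod.ext (hs1 0) (hs2 0 (by decide)))))⟩

lemma isCover_squaresRestrict_one_iff (hW : IsPretopology W) :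
    IsCover W (squaresRestrict (joinSquare (SSet.boundary.{v} 1).ι Δ[0]) f) ↔
      IsCover W (coneBoundary f) := by
  refine isCover_iff_of_bijective hW (toConePairs f 1) (toHornPairs f) (fun T s => ?_)
    (toConePairs_bijective f 1) (toHornPairs_bijective f)
  have hK := isFaceUnion_boundary.{v} (m := 0)
  have hL := isFaceUnion_horn.{v} (Fin.last 2)
  have h1 : ∀ i, ((points X).obj T).δ i (SSet.yonedaEquiv (squareLeft s)) =
      hK.eval (bdSquareLeft (joinSquare (SSet.boundary.{v} 1).ι Δ[0] ≫ s)) i trivial := fun i =>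
    (hK.eval_ι_comp _ i trivial).symm.trans
      (congrArg (fun g => hK.eval g i trivial) (bdSquareLeft_restrict s).symm)
  have h2 : ∀ i hi, ((points Y).obj T).δ i (SSet.yonedaEquiv (squareRight s)) =
      hL.eval (bdSquareRight (joinSquare (SSet.boundary.{v} 1).ι Δ[0] ≫ s)) i hi := fun i hi =>
    (hL.eval_ι_comp _ i hi).symm.trans
      (congrArg (fun g => hL.eval g i hi) (bdSquareRight_restrict s).symm)
  refine Subtype.ext (Prod.ext (Subtype.ext (Prod.ext ?_ ?_))
    (Subtype.ext (Prod.ext ?_ ?_)))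
  · exact h1 1
  · exact h2 1 (by decide)
  · exact h1 0
  · exact h2 0 (by decide)

end ConePresheaves

/-! ### Essential surjectivity on vertices and the direction of edges -/

section EssSurj

variable {C : Type u} [Category.{v} C] {W : MorphismProperty C} {X Y : SimplicialObject C}

/-- The triangles whose middle edge is degenerate. -/
abbrev loops (Y : SimplicialObject C) : Cᵒᵖ ⥤ Type v :=
  pairs (faceMap (points Y) (1 : Fin 3)) (degeneracyMap (points Y) (0 : Fin 1))

/-- The triangles whose first face is degenerate. -/
abbrev bigonPairs (Y : SimplicialObject C) : Cᵒᵖ ⥤ Type v :=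
  pairs (faceMap (points Y) (0 : Fin 3)) (degeneracyMap (points Y) (0 : Fin 1))

lemma loops_w {T : Cᵒᵖ} (x : (loops Y).obj T) :
    ((points Y).obj T).δ 1 x.1.1 = ((points Y).obj T).σ 0 x.1.2 := x.2

lemma bigonPairs_w {T : Cᵒᵖ} (x : (bigonPairs Y).obj T) :
    ((points Y).obj T).δ 0 x.1.1 = ((points Y).obj T).σ 0 x.1.2 := x.2

lemma σ_zero_injective (A : SSet.{v}) {n : ℕ} : Function.Injective (A.σ (0 : Fin (n + 1))) :=
  Function.LeftInverse.injective (g := A.δ 0) (δ_zero_σ_zero A)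

/-- An edge `g` and the degenerate edge on its initial vertex form a horn at 0; a filler is a loop
with first half `g`. The next lemma uses the horn at 2 for the second half. -/
lemma IsGroupoidObject.isLocalCover_loops_two (hW : IsPretopology W) {n : ℕ}
    (hY : IsGroupoidObject W n Y) :
    IsLocalCover W ((pairs.fst _ _ : loops Y ⟶ _) ≫ faceMap (points Y) 2) := by
  refine (isFaceUnion_horn.{v} (0 : Fin 3)).isLocalCover (hY.isLocalCover_horn hW 0)
    _ (pairs.fst _ _) (fun i _ => (![faceMap (points Y) 1 ≫ degeneracyMap (points Y) 0,
      faceMap (points Y) 1 ≫ degeneracyMap (points Y) 0, 𝟙 _] :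
        Fin 3 → (level (points Y) 1 ⟶ level (points Y) 1)) i) ?_ ?_ ?_
  · intro T g
    refine isMatching_of_δ _ ?_
    intro i j hij hi hj
    fin_cases i <;> fin_cases j <;> first | (exact (hi rfl).elim) | skip
    · exact (hij.not_gt (by decide)).elim
    · exact (δ_one_σ_zero ((points Y).obj T) (((points Y).obj T).δ 1 g)).symm
  · intro T x i hi
    have h := loops_w x
    fin_cases i
    · exact (hi rfl).elim
    · refine h.trans (congrArg (((points Y).obj T).σ 0) ?_)
      refine Eq.trans ?_ (δ_one_δ_two ((points Y).obj T) (n := 0) x.1.1).symm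
      rw [h, δ_one_σ_zero]
    · rfl
  · intro T g z hz
    have h1 : ((points Y).obj T).δ 1 z = ((points Y).obj T).σ 0 (((points Y).obj T).δ 1 g) :=
      hz 1 (by decide)
    have h2 : ((points Y).obj T).δ 2 z = g := hz 2 (by decide)
    refine ⟨⟨(z, ((points Y).obj T).δ 1 g), h1⟩, ⟨h2, rfl⟩, ?_⟩
    rintro ⟨⟨x, b⟩, hx⟩ ⟨-, rfl⟩
    have hb : b = ((points Y).obj T).δ 1 g :=
      σ_zero_injective ((points Y).obj T) (n := 0) (hx.symm.trans h1)
    exact Subtype.ext (Prod.ext rfl hb)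

lemma IsGroupoidObject.isLocalCover_loops_zero (hW : IsPretopology W) {n : ℕ}
    (hY : IsGroupoidObject W n Y) :
    IsLocalCover W ((pairs.fst _ _ : loops Y ⟶ _) ≫ faceMap (points Y) 0) := by
  refine (isFaceUnion_horn.{v} (2 : Fin 3)).isLocalCover (hY.isLocalCover_horn hW 2)
    _ (pairs.fst _ _) (fun i _ => (![𝟙 _, faceMap (points Y) 0 ≫ degeneracyMap (points Y) 0,
      𝟙 _] : Fin 3 → (level (points Y) 1 ⟶ level (points Y) 1)) i) ?_ ?_ ?_
  · intro T g
    refine isMatching_of_δ _ ?_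
    intro i j hij hi hj
    fin_cases i <;> fin_cases j <;> first | (exact (hj rfl).elim) | skip
    · exact δ_zero_σ_zero ((points Y).obj T) (((points Y).obj T).δ 0 g)
    · exact (hij.not_gt (by decide)).elim
  · intro T x i hi
    have h := loops_w x
    fin_cases i
    · rfl
    · refine h.trans (congrArg (((points Y).obj T).σ 0) ?_)
      refine Eq.trans ?_ (δ_zero_δ_one ((points Y).obj T) (n := 0) x.1.1)
      rw [h, δ_zero_σ_zero]
    · exact (hi rfl).elim
  · intro T g z hz
    have h1 : ((points Y).obj T).δ 1 z = ((points Y).obj T).σ 0 (((points Y).obj T).δ 0 g) :=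
      hz 1 (by decide)
    have h2 : ((points Y).obj T).δ 0 z = g := hz 0 (by decide)
    refine ⟨⟨(z, ((points Y).obj T).δ 0 g), h1⟩, ⟨h2, rfl⟩, ?_⟩
    rintro ⟨⟨x, b⟩, hx⟩ ⟨-, rfl⟩
    have hb : b = ((points Y).obj T).δ 0 g :=
      σ_zero_injective ((points Y).obj T) (n := 0) (hx.symm.trans h1)
    exact Subtype.ext (Prod.ext rfl hb)

/-- Bigons with a given source are represented by covers. -/
lemma IsGroupoidObject.isLocalCover_bigonPairs (hW : IsPretopology W) {n : ℕ}
    (hY : IsGroupoidObject W n Y) :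
    IsLocalCover W ((pairs.fst _ _ : bigonPairs Y ⟶ _) ≫ faceMap (points Y) 1) := by
  refine (isFaceUnion_horn.{v} (2 : Fin 3)).isLocalCover (hY.isLocalCover_horn hW 2)
    _ (pairs.fst _ _) (fun i _ => (![faceMap (points Y) 0 ≫ degeneracyMap (points Y) 0, 𝟙 _,
      𝟙 _] : Fin 3 → (level (points Y) 1 ⟶ level (points Y) 1)) i) ?_ ?_ ?_
  · intro T g
    refine isMatching_of_δ _ ?_
    intro i j hij hi hj
    fin_cases i <;> fin_cases j <;> first | (exact (hj rfl).elim) | skip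
    · exact (δ_zero_σ_zero ((points Y).obj T) (((points Y).obj T).δ 0 g)).symm
    · exact (hij.not_gt (by decide)).elim
  · intro T x i hi
    have h := bigonPairs_w x
    fin_cases i
    · refine h.trans (congrArg (((points Y).obj T).σ 0) ?_)
      refine Eq.trans ?_ (δ_zero_δ_one ((points Y).obj T) (n := 0) x.1.1).symm
      rw [h, δ_zero_σ_zero]
    · rfl
    · exact (hi rfl).elim
  · intro T g z hz
    have h1 : ((points Y).obj T).δ 0 z = ((points Y).obj T).σ 0 (((points Y).obj T).δ 0 g) :=
      hz 0 (by decide)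
    have h2 : ((points Y).obj T).δ 1 z = g := hz 1 (by decide)
    refine ⟨⟨(z, ((points Y).obj T).δ 0 g), h1⟩, ⟨h2, rfl⟩, ?_⟩
    rintro ⟨⟨x, b⟩, hx⟩ ⟨-, rfl⟩
    have hb : b = ((points Y).obj T).δ 0 g :=
      σ_zero_injective ((points Y).obj T) (n := 0) (hx.symm.trans h1)
    exact Subtype.ext (Prod.ext rfl hb)

variable (f : X ⟶ Y)

/-- The vertices of `X` with a 1-simplex of `Y` that ends in the image of the vertex. -/
abbrev coconePairs : Cᵒᵖ ⥤ Type v :=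
  pairs (levelMap (pointsMap f) 0) (faceMap (points Y) (0 : Fin 2))

/-- The other end of a 1-simplex of `Y` that ends in the image of a vertex of `X`. -/
abbrev coconeSource : coconePairs f ⟶ level (points Y) 0 :=
  pairs.snd _ _ ≫ faceMap (points Y) 1

/-- Loops at the images of vertices of `X`, subdivided at another vertex. -/
abbrev loopPairs : Cᵒᵖ ⥤ Type v :=
  pairs (levelMap (pointsMap f) 0) (pairs.snd _ _ : loops Y ⟶ _)

/-- The second half of a subdivided loop. -/
def loopPairsToCocone : loopPairs f ⟶ coconePairs f :=
  pairs.lift (pairs.fst _ _) (pairs.snd _ _ ≫ pairs.fst _ _ ≫ faceMap (points Y) 0) (fun T x => by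
    refine x.2.trans ?_
    have h := loops_w x.1.2
    refine Eq.trans ?_ (δ_zero_δ_one ((points Y).obj T) (n := 0) x.1.2.1.1)
    rw [h, δ_zero_σ_zero]
    rfl)

/-- The first half of a subdivided loop. -/
def loopPairsToCone : loopPairs f ⟶ conePairs f 0 :=
  pairs.lift (pairs.fst _ _) (pairs.snd _ _ ≫ pairs.fst _ _ ≫ faceMap (points Y) 2) (fun T x => by
    refine x.2.trans ?_
    have h := loops_w x.1.2
    refine Eq.trans ?_ (δ_one_δ_two ((points Y).obj T) (n := 0) x.1.2.1.1).symm
    rw [h, δ_one_σ_zero]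
    rfl)

lemma loopPairs_comm : loopPairsToCocone f ≫ coconeSource f = loopPairsToCone f ≫ coneTarget f := by
  ext T x
  exact (δ_zero_δ_two ((points Y).obj T) (n := 0) x.1.2.1.1).symm

lemma isLocalCover_loopPairsToCocone (hW : IsPretopology W) {n : ℕ}
    (hY : IsGroupoidObject W n Y) : IsLocalCover W (loopPairsToCocone f) := by
  refine (hY.isLocalCover_loops_zero hW).base_change _ (pairs.snd _ _) (pairs.snd _ _)
    (fun _ _ => rfl) ?_
  rintro T ⟨⟨x, y⟩, hxy⟩ z hz
  have hz' : ((points Y).obj T).δ 0 z.1.1 = y := hz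
  have hx : ((pointsMap f).app T).app _ x = z.1.2 := by
    refine hxy.trans ?_
    change ((points Y).obj T).δ 0 y = _
    rw [← hz', ← δ_zero_δ_one, loops_w z, δ_zero_σ_zero]
  refine ⟨⟨(x, z), hx⟩, ⟨Subtype.ext (Prod.ext rfl hz'), rfl⟩, ?_⟩
  rintro ⟨⟨x', z'⟩, h'⟩ ⟨h1, rfl⟩
  exact Subtype.ext (Prod.ext (congrArg (fun q => q.1.1) h1) rfl)

lemma isLocalCover_loopPairsToCone (hW : IsPretopology W) {n : ℕ}
    (hY : IsGroupoidObject W n Y) : IsLocalCover W (loopPairsToCone f) := by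
  refine (hY.isLocalCover_loops_two hW).base_change _ (pairs.snd _ _) (pairs.snd _ _)
    (fun _ _ => rfl) ?_
  rintro T ⟨⟨x, y⟩, hxy⟩ z hz
  have hz' : ((points Y).obj T).δ 2 z.1.1 = y := hz
  have hx : ((pointsMap f).app T).app _ x = z.1.2 := by
    refine hxy.trans ?_
    change ((points Y).obj T).δ 1 y = _
    rw [← hz', δ_one_δ_two, loops_w z, δ_one_σ_zero]
  refine ⟨⟨(x, z), hx⟩, ⟨Subtype.ext (Prod.ext rfl hz'), rfl⟩, ?_⟩
  rintro ⟨⟨x', z'⟩, h'⟩ ⟨h1, rfl⟩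
  exact Subtype.ext (Prod.ext (congrArg (fun q => q.1.1) h1) rfl)

/-- Subdivided loops at images of vertices of `X` map to both spaces of edges by local covers. The
midpoint of the loop is the free end of either half, so the two composites to `Y_0` agree, and right
cancellation carries the cover property across. -/
lemma isCover_coconeSource_iff (hW : IsPretopology W) (hcancel : IsRightCancellative W) {n : ℕ}
    (hY : IsGroupoidObject W n Y) : IsCover W (coconeSource f) ↔ IsCover W (coneTarget f) := by
  have h1 := isLocalCover_loopPairsToCocone f hW hY
  have h2 := isLocalCover_loopPairsToCone f hW hY
  constructor
  · intro h
    refine h2.isCover_of_comp hW hcancel ?_ (hY.isRep_conePairs f hW 0) (isRep_level Y 0)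
    rw [← loopPairs_comm]
    exact h1.comp hW (h.isLocalCover hW)
  · intro h
    refine h1.isCover_of_comp hW hcancel ?_ ?_ (isRep_level Y 0)
    · rw [loopPairs_comm]
      exact h2.comp hW (h.isLocalCover hW)
    · exact (pairs.isLocalCover_fst _ _ (hY.isLocalCover_zero hW)).isRep (isRep_level X 0)

lemma isEssSurj_pointsMap_iff (hW : IsPretopology W) (hcancel : IsRightCancellative W) {n : ℕ}
    (hY : IsGroupoidObject W n Y) :
    IsEssSurj W (pointsMap f) ↔ IsCover W (coneTarget f) :=
  (isCover_pullback_snd_iff _ _ _).trans (isCover_coconeSource_iff f hW hcancel hY)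

end EssSurj

/-! ### Faces and vertices of bigons in terms of the underlying 2-groupoid -/

section Bigons

lemma toShift_app (n : ℕ) : toShift.app ⦋n⦌ = SimplexCategory.δ (0 : Fin (n + 2)) := by
  ext i : 3
  rfl

lemma const_zero : SimplexCategory.const ⦋0⦌ ⦋0⦌ 0 = 𝟙 _ := by
  ext i : 3
  fin_cases i
  rfl

lemma const_one : SimplexCategory.const ⦋1⦌ ⦋0⦌ 0 = SimplexCategory.σ (0 : Fin 1) := by
  ext i : 3
  fin_cases i <;> rfl

lemma const_vertex_one :
    SimplexCategory.const ⦋0⦌ ⦋1⦌ 0 = SimplexCategory.δ (1 : Fin 2) := by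
  ext i : 3
  fin_cases i
  rfl

lemma shift_δ_zero : shift.map (SimplexCategory.δ (0 : Fin 2)) = SimplexCategory.δ (1 : Fin 3) := by
  ext i : 3
  fin_cases i <;> rfl

lemma shift_δ_one : shift.map (SimplexCategory.δ (1 : Fin 2)) = SimplexCategory.δ (2 : Fin 3) := by
  ext i : 3
  fin_cases i <;> rfl

variable {A : SSet.{v}}

/-- The vertex recorded in an object of `bigons` is redundant: it is the end of the edge. -/
lemma decProj_zero_iff (x : A _⦋1⦌) (a : A _⦋0⦌) :
    (decProj A).app (op ⦋0⦌) x = A.map (SimplexCategory.const ⦋0⦌ ⦋0⦌ 0).op a ↔ A.δ 0 x = a := by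
  rw [const_zero, op_id, Functor.map_id_apply]
  change A.map (toShift.app ⦋0⦌).op x = a ↔ _
  rw [toShift_app]
  rfl

lemma decProj_one_iff (x : A _⦋2⦌) (a : A _⦋0⦌) :
    (decProj A).app (op ⦋1⦌) x = A.map (SimplexCategory.const ⦋1⦌ ⦋0⦌ 0).op a ↔
      A.δ 0 x = A.σ 0 a := by
  rw [const_one]
  change A.map (toShift.app ⦋1⦌).op x = _ ↔ _
  rw [toShift_app]
  rfl

lemma bigonVertices_zero (p : (bigons A) _⦋0⦌) :
    bigonVertices p = (A.δ (n := 0) 1 p.1.1, p.1.2) := by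
  refine Prod.ext ?_ rfl
  change A.map (SimplexCategory.const ⦋0⦌ ⦋1⦌ 0).op p.1.1 = _
  rw [const_vertex_one]
  rfl

/-- The décalage raises the indices of faces by one, so the source and the target of a bigon are the
faces 1 and 2 of its triangle. -/
lemma bigons_δ_zero (p : (bigons A) _⦋1⦌) :
    ((bigons A).δ 0 p).1 = (A.δ (n := 1) 1 p.1.1, p.1.2) := by
  refine Prod.ext ?_ rfl
  change A.map (shift.map (SimplexCategory.δ (0 : Fin 2))).op p.1.1 = _
  rw [shift_δ_zero]
  rfl

lemma bigons_δ_one (p : (bigons A) _⦋1⦌) :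
    ((bigons A).δ 1 p).1 = (A.δ (n := 1) 2 p.1.1, p.1.2) := by
  refine Prod.ext ?_ rfl
  change A.map (shift.map (SimplexCategory.δ (1 : Fin 2))).op p.1.1 = _
  rw [shift_δ_one]
  rfl

end Bigons

/-! ### Essential surjectivity of the functor on bigons -/

section BigonFunctor

variable {C : Type u} [Category.{v} C] {W : MorphismProperty C} {X Y : SimplicialObject C}
  (f : X ⟶ Y)

/-- The 1-simplices of `Y` between the images of two vertices of `X`. -/
abbrev edgePairs : Cᵒᵖ ⥤ Type v := pairs (coneTarget f) (levelMap (pointsMap f) 0)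

/-- The objects of the groupoid of bigons over pairs of vertices of `X`. -/
def toEdgePairs : level (bigonGroupoidOver f) 0 ⟶ edgePairs f where
  app _ := ↾fun q => ⟨(⟨(q.1.1.1, q.1.2.1.1),
      (congrArg Prod.fst q.2).symm.trans (congrArg Prod.fst (bigonVertices_zero q.1.2))⟩,
        q.1.1.2),
    ((decProj_zero_iff _ _).1 q.1.2.2).trans (congrArg Prod.snd q.2)⟩
  naturality _ _ _ := rfl

lemma toEdgePairs_bijective (T : Cᵒᵖ) : Function.Bijective ((toEdgePairs f).app T) := by
  constructor
  · rintro ⟨⟨⟨a, a'⟩, ⟨⟨x, b⟩, hx⟩⟩, h⟩ ⟨⟨⟨c, c'⟩, ⟨⟨y, d⟩, hy⟩⟩, h'⟩ heq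
    obtain rfl : a = c := congrArg (fun q => q.1.1.1.1) heq
    obtain rfl : a' = c' := congrArg (fun q => q.1.2) heq
    obtain rfl : x = y := congrArg (fun q => q.1.1.1.2) heq
    obtain rfl : b = d := (congrArg Prod.snd h).trans (congrArg Prod.snd h').symm
    rfl
  · rintro ⟨⟨⟨⟨a, e⟩, h⟩, a'⟩, h'⟩
    let p : (bigons ((points Y).obj T)) _⦋0⦌ :=
      ⟨(e, ((pointsMap f).app T).app _ a'), (decProj_zero_iff _ _).2 h'⟩
    exact ⟨⟨((a, a'), p), (bigonVertices_zero p).trans (Prod.ext h.symm rfl)⟩, rfl⟩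

/-- The 1-simplices of `X` with a bigon of `Y` that starts in the image of the 1-simplex. -/
abbrev sourcePairs : Cᵒᵖ ⥤ Type v :=
  pairs (levelMap (pointsMap f) 1)
    ((pairs.fst _ _ : bigonPairs Y ⟶ _) ≫ faceMap (points Y) (1 : Fin 3))

lemma sourcePairs_w {T : Cᵒᵖ} (x : (sourcePairs f).obj T) :
    ((pointsMap f).app T).app _ x.1.1 = ((points Y).obj T).δ 1 x.1.2.1.1 := x.2

lemma sourcePairs_vertex {T : Cᵒᵖ} (x : (sourcePairs f).obj T) :
    x.1.2.1.2 = ((pointsMap f).app T).app _ (((points X).obj T).δ 0 x.1.1) := by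
  refine Eq.trans ?_ (SSet.δ_naturality_apply ((pointsMap f).app T) 0 x.1.1).symm
  refine Eq.trans ?_ (congrArg _ (sourcePairs_w f x)).symm
  refine Eq.trans ?_ (δ_zero_δ_one ((points Y).obj T) (n := 0) x.1.2.1.1).symm
  exact ((congrArg _ (bigonPairs_w x.1.2)).trans (δ_zero_σ_zero ((points Y).obj T) _)).symm

/-- The target of a bigon, with the vertices of the 1-simplex of `X`. -/
def sourceTarget : sourcePairs f ⟶ edgePairs f :=
  pairs.lift
    (pairs.lift (pairs.fst _ _ ≫ faceMap (points X) 1)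
      (pairs.snd _ _ ≫ pairs.fst _ _ ≫ faceMap (points Y) 2)
      (fun T x => (SSet.δ_naturality_apply ((pointsMap f).app T) 1 x.1.1).trans <|
        (congrArg _ (sourcePairs_w f x)).trans
          (δ_one_δ_two ((points Y).obj T) (n := 0) x.1.2.1.1).symm))
    (pairs.fst _ _ ≫ faceMap (points X) 0)
    (fun T x => by
      refine Eq.trans ?_ (sourcePairs_vertex f x)
      refine (δ_zero_δ_two ((points Y).obj T) (n := 0) x.1.2.1.1).trans ?_
      exact (congrArg _ (bigonPairs_w x.1.2)).trans (δ_one_σ_zero ((points Y).obj T) _))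

/-- The comparison of the essential surjectivity data of the functor on bigons with pairs. -/
def toSourcePairs : pairs (levelMap (bigonFunctor f) 0) (face (bigonGroupoidOver f) 0) ⟶
    sourcePairs f where
  app T := ↾fun q => ⟨(q.1.1.1.1, ⟨(q.1.2.1.2.1.1, q.1.2.1.2.1.2),
      (decProj_one_iff _ _).1 q.1.2.1.2.2⟩), by
    have h := congrArg (fun r => r.1.2.1.1) q.2
    exact h.trans (congrArg Prod.fst (bigons_δ_zero q.1.2.1.2))⟩
  naturality _ _ _ := rfl

lemma toSourcePairs_w {T : Cᵒᵖ}
    (q : (pairs (levelMap (bigonFunctor f) 0) (face (bigonGroupoidOver f) 0)).obj T) :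
    q.1.2.1.1 = bigonVertices q.1.1 := (congrArg (fun r => r.1.1) q.2).symm

/-- The components that are forgotten, namely the end of the edge of `X` and the endpoints attached
to the bigon, can be read off from the edge. -/
lemma toSourcePairs_bijective (T : Cᵒᵖ) : Function.Bijective ((toSourcePairs f).app T) := by
  constructor
  · intro q q' heq
    have h1 : q.1.1.1.1 = q'.1.1.1.1 := congrArg (fun r => r.1.1) heq
    have h2 : q.1.2.1.2.1 = q'.1.2.1.2.1 := congrArg (fun r => r.1.2.1) heq
    have h3 : q.1.1 = q'.1.1 := by
      refine Subtype.ext (Prod.ext h1 ?_)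
      refine ((decProj_zero_iff _ _).1 q.1.1.2).symm.trans ?_
      exact (congrArg _ h1).trans ((decProj_zero_iff _ _).1 q'.1.1.2)
    refine Subtype.ext (Prod.ext h3 (Subtype.ext (Prod.ext ?_ (Subtype.ext h2))))
    rw [toSourcePairs_w, toSourcePairs_w, h3]
  · intro x
    let p : (bigons ((points X).obj T)) _⦋0⦌ :=
      ⟨(x.1.1, ((points X).obj T).δ 0 x.1.1), (decProj_zero_iff _ _).2 rfl⟩
    let b : (bigons ((points Y).obj T)) _⦋1⦌ :=
      ⟨(x.1.2.1.1, x.1.2.1.2), (decProj_one_iff _ _).2 (bigonPairs_w x.1.2)⟩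
    have hb : (bigons ((points Y).obj T)).δ 0 b = (bigonsMap ((pointsMap f).app T)).app _ p := by
      refine Subtype.ext ((bigons_δ_zero b).trans (Prod.ext (sourcePairs_w f x).symm ?_))
      exact sourcePairs_vertex f x
    refine ⟨⟨(p, ⟨(bigonVertices p, b), ?_⟩), ?_⟩, rfl⟩
    · rw [← bigonVertices_bigonsMap, ← hb]
      exact (bigonVertices_map _ b).symm
    · exact Subtype.ext (Prod.ext rfl hb.symm)

lemma isEssSurj_bigonFunctor_iff (hW : IsPretopology W) :
    IsEssSurj W (bigonFunctor f) ↔ IsCover W (sourceTarget f) := by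
  refine (isCover_pullback_snd_iff _ _ _).trans ?_
  refine isCover_iff_of_bijective hW (toSourcePairs f) (toEdgePairs f) (fun T q => ?_)
    (toSourcePairs_bijective f) (toEdgePairs_bijective f)
  have h := toSourcePairs_w f q
  refine Subtype.ext (Prod.ext (Subtype.ext (Prod.ext ?_ ?_)) ?_)
  · refine Eq.trans ?_ (congrArg Prod.fst h).symm
    exact (congrArg Prod.fst (bigonVertices_zero q.1.1)).symm
  · exact (congrArg Prod.fst (bigons_δ_one q.1.2.1.2)).symm
  · refine Eq.trans ?_ (congrArg Prod.snd h).symm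
    exact (decProj_zero_iff _ _).1 q.1.1.2

end BigonFunctor

/-! ### Full faithfulness on bigons as unique lifting -/

section FullyFaithful

variable {C : Type u} [Category.{v} C]

lemma yonedaEquiv_symm_comp_apply {F G : Cᵒᵖ ⥤ Type v} {T : C} (x : F.obj (op T)) (φ : F ⟶ G) :
    yonedaEquiv.symm x ≫ φ = yonedaEquiv.symm (φ.app _ x) := by
  apply yonedaEquiv.injective
  rw [yonedaEquiv_comp, Equiv.apply_symm_apply, Equiv.apply_symm_apply]

/-- Pullback squares along products of presheaves, in terms of elements. -/
lemma isPullback_prod_lift_iff {E F G H : Cᵒᵖ ⥤ Type v} (a : E ⟶ F) (b c : E ⟶ G) (d e : F ⟶ H)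
    (g : G ⟶ H) (hd : b ≫ g = a ≫ d) (he : c ≫ g = a ≫ e) :
    IsPullback a (prod.lift b c) (prod.lift d e) (prod.map g g) ↔
      ∀ T (y : F.obj T) (x x' : G.obj T), d.app T y = g.app T x → e.app T y = g.app T x' →
        ∃! z, a.app T z = y ∧ b.app T z = x ∧ c.app T z = x' := by
  constructor
  · intro h T y x x' hx hx'
    induction T using Opposite.rec with | _ T
    -- An element is a morphism from a representable presheaf, so `y`, `x` and `x'` form a cone on
    -- the square, and its universal property gives `z`.
    have hw : yonedaEquiv.symm y ≫ prod.lift d e =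
        prod.lift (yonedaEquiv.symm x) (yonedaEquiv.symm x') ≫ prod.map g g := by
      ext1
      · rw [Category.assoc, prod.lift_fst, prod.lift_map, prod.lift_fst,
          yonedaEquiv_symm_comp_apply, yonedaEquiv_symm_comp_apply, hx]
      · rw [Category.assoc, prod.lift_snd, prod.lift_map, prod.lift_snd,
          yonedaEquiv_symm_comp_apply, yonedaEquiv_symm_comp_apply, hx']
    have h1 := h.lift_fst _ _ hw
    have h2 := h.lift_snd _ _ hw
    have key : ∀ z : E.obj (op T), (a.app _ z = y ∧ b.app _ z = x ∧ c.app _ z = x') ↔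
        yonedaEquiv.symm z = h.lift _ _ hw := by
      intro z
      constructor
      · rintro ⟨rfl, rfl, rfl⟩
        refine h.hom_ext ?_ ?_
        · rw [h1, yonedaEquiv_symm_comp_apply]
        · rw [h2, prod.comp_lift, yonedaEquiv_symm_comp_apply, yonedaEquiv_symm_comp_apply]
      · intro hz
        rw [← hz, yonedaEquiv_symm_comp_apply] at h1
        rw [← hz, prod.comp_lift, yonedaEquiv_symm_comp_apply, yonedaEquiv_symm_comp_apply] at h2
        refine ⟨yonedaEquiv.symm.injective h1, yonedaEquiv.symm.injective ?_,
          yonedaEquiv.symm.injective ?_⟩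
        · exact (prod.lift_fst _ _).symm.trans ((h2 =≫ prod.fst).trans (prod.lift_fst _ _))
        · exact (prod.lift_snd _ _).symm.trans ((h2 =≫ prod.snd).trans (prod.lift_snd _ _))
    refine ⟨yonedaEquiv (h.lift _ _ hw), (key _).2 (Equiv.symm_apply_apply _ _), fun z hz => ?_⟩
    exact (Equiv.symm_apply_eq _).1 ((key z).1 hz)
  · intro h
    have hw : a ≫ prod.lift d e = prod.lift b c ≫ prod.map g g := by
      rw [prod.comp_lift, prod.lift_map, hd, he]
    have hs : ∀ (s : PullbackCone (prod.lift d e) (prod.map g g)) T (k : s.pt.obj T),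
        ∃! z, a.app T z = s.fst.app T k ∧ b.app T z = (s.snd ≫ prod.fst).app T k ∧
          c.app T z = (s.snd ≫ prod.snd).app T k := by
      intro s T k
      have h1 : s.fst ≫ d = (s.snd ≫ prod.fst) ≫ g := by
        have h := s.condition =≫ prod.fst
        rw [prod.comp_lift, Category.assoc, prod.map_fst, ← Category.assoc] at h
        exact (prod.lift_fst _ _).symm.trans h
      have h2 : s.fst ≫ e = (s.snd ≫ prod.snd) ≫ g := by
        have h := s.condition =≫ prod.snd
        rw [prod.comp_lift, Category.assoc, prod.map_snd, ← Category.assoc] at h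
        exact (prod.lift_snd _ _).symm.trans h
      exact h T _ _ _ (congrArg (fun q => q.app T k) h1) (congrArg (fun q => q.app T k) h2)
    -- The elements given by unique existence at each stage form a natural transformation, by
    -- uniqueness.
    let l : ∀ s : PullbackCone (prod.lift d e) (prod.map g g), s.pt ⟶ E := fun s =>
      { app := fun T => ↾fun k => (hs s T k).choose
        naturality := fun T T' t => ConcreteCategory.hom_ext _ _ fun k => by
          refine (hs s T' (s.pt.map t k)).unique (hs s T' (s.pt.map t k)).choose_spec.1 ?_
          have h1 := (hs s T k).choose_spec.1
          refine ⟨?_, ?_, ?_⟩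
          · exact (NatTrans.naturality_apply _ _ _).trans
              ((congrArg _ h1.1).trans (NatTrans.naturality_apply _ _ _).symm)
          · exact (NatTrans.naturality_apply _ _ _).trans
              ((congrArg _ h1.2.1).trans (NatTrans.naturality_apply _ _ _).symm)
          · exact (NatTrans.naturality_apply _ _ _).trans
              ((congrArg _ h1.2.2).trans (NatTrans.naturality_apply _ _ _).symm) }
    have hl : ∀ s T k, a.app T ((l s).app T k) = s.fst.app T k ∧
        b.app T ((l s).app T k) = (s.snd ≫ prod.fst).app T k ∧
          c.app T ((l s).app T k) = (s.snd ≫ prod.snd).app T k := fun s T k =>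
      (hs s T k).choose_spec.1
    refine ⟨⟨hw⟩, ⟨PullbackCone.IsLimit.mk _ l ?_ ?_ ?_⟩⟩
    · intro s
      ext T k
      exact (hl s T k).1
    · intro s
      ext1
      · rw [Category.assoc, prod.lift_fst]
        ext T k
        exact (hl s T k).2.1
      · rw [Category.assoc, prod.lift_snd]
        ext T k
        exact (hl s T k).2.2
    · intro s m h1 h2
      ext T k
      refine (hs s T k).unique ⟨congrArg (fun q => q.app T k) h1, ?_, ?_⟩ (hl s T k)
      · rw [← h2, Category.assoc, prod.lift_fst]
        rfl
      · rw [← h2, Category.assoc, prod.lift_snd]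
        rfl

variable {X Y : SimplicialObject C} (f : X ⟶ Y)

/-- By the elementwise criterion, the pullback square asks for a unique arrow with given source,
target and image. The vertices carried along by `bigons` and `bigonsOver` are determined by the
edges. -/
lemma isFullyFaithful_bigonFunctor_iff :
    IsFullyFaithful (bigonFunctor f) ↔ ∀ T, LiftsBigons ((pointsMap f).app T) := by
  refine (isPullback_prod_lift_iff _ _ _ _ _ _ ?_ ?_).trans (forall_congr' fun T => ?_)
  · ext T p
    exact SSet.δ_naturality_apply ((bigonFunctor f).app T) 0 p
  · ext T p
    exact SSet.δ_naturality_apply ((bigonFunctor f).app T) 1 p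
  constructor
  · intro h x x' y h0 h1 hy0 hy1 hy2
    let p : (bigons ((points X).obj T)) _⦋0⦌ :=
      ⟨(x, ((points X).obj T).δ 0 x), (decProj_zero_iff _ _).2 rfl⟩
    let p' : (bigons ((points X).obj T)) _⦋0⦌ :=
      ⟨(x', ((points X).obj T).δ 0 x), (decProj_zero_iff _ _).2 h0.symm⟩
    let b : (bigons ((points Y).obj T)) _⦋1⦌ :=
      ⟨(y, ((pointsMap f).app T).app _ (((points X).obj T).δ 0 x)), (decProj_one_iff _ _).2 hy0⟩
    have hpp : bigonVertices p = bigonVertices p' :=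
      ((bigonVertices_zero p).trans (congrArg (fun e => (e, ((points X).obj T).δ 0 x)) h1)).trans
        (bigonVertices_zero p').symm
    have hb0 : (bigons ((points Y).obj T)).δ 0 b = (bigonsMap ((pointsMap f).app T)).app _ p :=
      Subtype.ext ((bigons_δ_zero b).trans (Prod.ext hy1 rfl))
    have hb1 : (bigons ((points Y).obj T)).δ 1 b = (bigonsMap ((pointsMap f).app T)).app _ p' :=
      Subtype.ext ((bigons_δ_one b).trans (Prod.ext hy2 rfl))
    let q : (bigonsOver ((pointsMap f).app T)) _⦋1⦌ := ⟨(bigonVertices p, b), by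
      rw [← bigonVertices_bigonsMap, ← hb0]
      exact (bigonVertices_map _ b).symm⟩
    obtain ⟨z, ⟨hz, hz0, hz1⟩, hu⟩ := h q p p' (Subtype.ext (Prod.ext rfl hb0))
      (Subtype.ext (Prod.ext hpp hb1))
    refine ⟨z.1.1, ⟨⟨?_, ?_, ?_⟩, ?_⟩, ?_⟩
    · refine ((decProj_one_iff _ _).1 z.2).trans (congrArg _ ?_)
      exact congrArg (fun r => r.1.2) hz0
    · exact (congrArg Prod.fst (bigons_δ_zero z)).symm.trans (congrArg (fun r => r.1.1) hz0)
    · exact (congrArg Prod.fst (bigons_δ_one z)).symm.trans (congrArg (fun r => r.1.1) hz1)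
    · exact congrArg (fun r => r.1.2.1.1) hz
    · rintro w ⟨⟨hw0, hw1, hw2⟩, hw⟩
      let k : (bigons ((points X).obj T)) _⦋1⦌ :=
        ⟨(w, ((points X).obj T).δ 0 x), (decProj_one_iff _ _).2 hw0⟩
      have hk0 : (bigons ((points X).obj T)).δ 0 k = p :=
        Subtype.ext ((bigons_δ_zero k).trans (Prod.ext hw1 rfl))
      have hk1 : (bigons ((points X).obj T)).δ 1 k = p' :=
        Subtype.ext ((bigons_δ_one k).trans (Prod.ext hw2 rfl))
      refine congrArg (fun r => r.1.1) (hu k ⟨Subtype.ext (Prod.ext ?_ ?_), hk0, hk1⟩)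
      · exact (bigonVertices_map _ k).symm.trans (congrArg bigonVertices hk0)
      · exact Subtype.ext (Prod.ext hw rfl)
  · intro h q p p' hp hp'
    have hv : q.1.1 = bigonVertices p := congrArg (fun r => r.1.1) hp
    have hv' : q.1.1 = bigonVertices p' := congrArg (fun r => r.1.1) hp'
    have hvv := (bigonVertices_zero p).symm.trans
      (hv.symm.trans (hv'.trans (bigonVertices_zero p')))
    have hpp : p.1.2 = p'.1.2 := (Prod.mk.inj hvv).2
    have h0 := (decProj_zero_iff _ _).1 p.2
    have h0' := (decProj_zero_iff _ _).1 p'.2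
    have hb : (bigons ((points Y).obj T)).δ 0 q.1.2 = (bigonsMap ((pointsMap f).app T)).app _ p :=
      congrArg (fun r => r.1.2) hp
    have hb' : (bigons ((points Y).obj T)).δ 1 q.1.2 =
        (bigonsMap ((pointsMap f).app T)).app _ p' := congrArg (fun r => r.1.2) hp'
    have e := (bigons_δ_zero q.1.2).symm.trans (congrArg Subtype.val hb)
    have e' := (bigons_δ_one q.1.2).symm.trans (congrArg Subtype.val hb')
    have he2 : q.1.2.1.2 = ((pointsMap f).app T).app _ p.1.2 := congrArg Prod.snd e
    obtain ⟨z, ⟨⟨hz0, hz1, hz2⟩, hz⟩, hu⟩ := h p.1.1 p'.1.1 q.1.2.1.1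
      (h0.trans (hpp.trans h0'.symm)) (congrArg Prod.fst hvv)
      (((decProj_one_iff _ _).1 q.1.2.2).trans (congrArg _ (he2.trans (congrArg _ h0.symm))))
      (congrArg Prod.fst e) (congrArg Prod.fst e')
    let k : (bigons ((points X).obj T)) _⦋1⦌ :=
      ⟨(z, p.1.2), (decProj_one_iff _ _).2 (hz0.trans (congrArg _ h0))⟩
    have hk0 : (bigons ((points X).obj T)).δ 0 k = p :=
      Subtype.ext ((bigons_δ_zero k).trans (Prod.ext hz1 rfl))
    have hk1 : (bigons ((points X).obj T)).δ 1 k = p' :=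
      Subtype.ext ((bigons_δ_one k).trans (Prod.ext hz2 hpp))
    refine ⟨k, ⟨Subtype.ext (Prod.ext ?_ (Subtype.ext (Prod.ext hz he2.symm))), hk0, hk1⟩, ?_⟩
    · refine Eq.trans ?_ hv.symm
      exact (bigonVertices_map _ k).symm.trans (congrArg bigonVertices hk0)
    · rintro w ⟨hw, hw0, hw1⟩
      have hw2 : w.1.2 = p.1.2 := congrArg (fun r => r.1.2) hw0
      refine Subtype.ext (Prod.ext (hu w.1.1 ⟨⟨?_, ?_, ?_⟩, ?_⟩) hw2)
      · exact ((decProj_one_iff _ _).1 w.2).trans (congrArg _ (hw2.trans h0.symm))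
      · exact (congrArg Prod.fst (bigons_δ_zero w)).symm.trans (congrArg (fun r => r.1.1) hw0)
      · exact (congrArg Prod.fst (bigons_δ_one w)).symm.trans (congrArg (fun r => r.1.1) hw1)
      · exact congrArg (fun r => r.1.2.1.1) hw

end FullyFaithful

/-! ### Comparison of bigons with a given target and triangles on a given horn -/

section Whiskering

variable {C : Type u} [Category.{v} C] {W : MorphismProperty C} {X Y : SimplicialObject C}

lemma exists_natTrans {F G : Cᵒᵖ ⥤ Type v} (P : ∀ T, F.obj T → G.obj T → Prop)
    (h : ∀ T x, ∃! y, P T x y)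
    (hP : ∀ {T T'} (t : T ⟶ T') x y, P T x y → P T' (F.map t x) (G.map t y)) :
    ∃ φ : F ⟶ G, ∀ T x, P T x (φ.app T x) := by
  choose s hs hu using h
  exact ⟨{ app := fun T => ↾(s T)
           naturality := fun T T' t => ConcreteCategory.hom_ext _ _ fun x =>
             (hu _ _ _ (hP t x _ (hs T x))).symm }, hs⟩

/-- The composite of a bigon with a triangle is unique over each `T` and preserved by restriction,
hence a morphism of presheaves. -/
lemma IsGroupoidObject.exists_whiskering (hY : IsGroupoidObject W 2 Y) {F : Cᵒᵖ ⥤ Type v}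
    (b y : F ⟶ level (points Y) 2)
    (h0 : ∀ T x, ((points Y).obj T).δ 0 (b.app T x) =
      ((points Y).obj T).σ 0 (((points Y).obj T).δ (n := 0) 1 (((points Y).obj T).δ 0 (y.app T x))))
    (h2 : ∀ T x, ((points Y).obj T).δ 2 (b.app T x) = ((points Y).obj T).δ 2 (y.app T x)) :
    ∃ z : F ⟶ level (points Y) 2, ∀ T x,
      IsWhiskering (A := (points Y).obj T) (b.app T x) (y.app T x) (z.app T x) := by
  refine exists_natTrans (G := level (points Y) 2) (fun T x z =>
    IsWhiskering (A := (points Y).obj T) (b.app T x) (y.app T x) z) (fun T x =>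
      (hY.hasUniqueFillers T).existsUnique_whiskering _ _ (h0 T x) (h2 T x)) fun t x z h => ?_
  have := h.map ((points Y).map t)
  rw [NatTrans.naturality_apply, NatTrans.naturality_apply]
  exact this

variable (f : X ⟶ Y)

lemma sourcePairs_δ_two {T : Cᵒᵖ} (x : (sourcePairs f).obj T) :
    ((points Y).obj T).δ (n := 0) 0 (((points Y).obj T).δ 2 x.1.2.1.1) = x.1.2.1.2 := by
  refine (δ_zero_δ_two ((points Y).obj T) (n := 0) x.1.2.1.1).trans ?_
  exact (congrArg _ (bigonPairs_w x.1.2)).trans (δ_one_σ_zero ((points Y).obj T) _)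

/-- The horn with a degenerate first edge on a 1-simplex of `Y`. -/
def edgeToHorn : edgePairs f ⟶ hornPairs f :=
  pairs.lift (pairs.fst _ _)
    (pairs.lift (pairs.snd _ _)
      (pairs.snd _ _ ≫ levelMap (pointsMap f) 0 ≫ degeneracyMap (points Y) 0)
      (fun T _ => (δ_one_σ_zero ((points Y).obj T) _).symm))
    (fun T x => x.2.trans (δ_zero_σ_zero ((points Y).obj T) _).symm)

/-- Composing a bigon from `f x` to `e` with `σ 1 e` turns it around: the result has face 1 equal to
`e`, face 2 equal to `f x` and a degenerate face 0. Such triangles are the fillers of degenerate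
horns counted by `coneBoundary`, so `sourceTarget` is its base change along `edgeToHorn`. -/
lemma isLocalCover_sourceTarget (hY : IsGroupoidObject W 2 Y)
    (h : IsLocalCover W (coneBoundary f)) : IsLocalCover W (sourceTarget f) := by
  obtain ⟨z, hz⟩ := hY.exists_whiskering (F := sourcePairs f) (pairs.snd _ _ ≫ pairs.fst _ _)
    (pairs.snd _ _ ≫ pairs.fst _ _ ≫ faceMap (points Y) 2 ≫ degeneracyMap (points Y) 1)
    (fun T x => by
      refine (bigonPairs_w x.1.2).trans (congrArg (((points Y).obj T).σ 0) ?_)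
      refine (sourcePairs_δ_two f x).symm.trans ?_
      refine (δ_one_σ_zero ((points Y).obj T) (n := 0) _).symm.trans ?_
      exact congrArg _ (δ_zero_σ_one ((points Y).obj T) (n := 0) _).symm)
    (fun T x => (δ_two_σ_one ((points Y).obj T) (n := 0) _).symm)
  have hz' : ∀ T (x : (sourcePairs f).obj T), IsWhiskering (A := (points Y).obj T) x.1.2.1.1
      (((points Y).obj T).σ (n := 1) 1 (((points Y).obj T).δ 2 x.1.2.1.1)) (z.app T x) := hz
  refine h.base_change (sourceTarget f)
    (pairs.lift (pairs.fst _ _) z fun T x => (sourcePairs_w f x).trans (hz' T x).δ_two.symm)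
    (edgeToHorn f) ?_ ?_
  · intro T x
    refine Subtype.ext (Prod.ext (Subtype.ext (Prod.ext rfl ?_)) (Subtype.ext (Prod.ext rfl ?_)))
    · exact (hz' T x).δ_one.trans (δ_one_σ_one ((points Y).obj T) (n := 0) _)
    · refine (hz' T x).δ_zero.trans ((δ_zero_σ_one ((points Y).obj T) (n := 0) _).trans ?_)
      exact congrArg _ ((sourcePairs_δ_two f x).trans (sourcePairs_vertex f x))
  · intro T y x' hx'
    have e1 : ((points X).obj T).δ 1 x'.1.1 = y.1.1.1.1 := congrArg (fun q => q.1.1.1.1) hx'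
    have e2 : ((points Y).obj T).δ 1 x'.1.2 = y.1.1.1.2 := congrArg (fun q => q.1.1.1.2) hx'
    have e3 : ((points X).obj T).δ 0 x'.1.1 = y.1.2 := congrArg (fun q => q.1.2.1.1) hx'
    have e4 : ((points Y).obj T).δ 0 x'.1.2 =
        ((points Y).obj T).σ 0 (((pointsMap f).app T).app _ y.1.2) :=
      congrArg (fun q => q.1.2.1.2) hx'
    have hy : ((points Y).obj T).δ 0 y.1.1.1.2 = ((pointsMap f).app T).app _ y.1.2 := y.2
    -- Turning around is invertible: `b` is the only bigon whose composite with `σ 1 e` is the given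
    -- triangle.
    obtain ⟨b, hb, hu⟩ := (hY.hasUniqueFillers T).existsUnique_bigon
      (((points Y).obj T).σ (n := 1) 1 y.1.1.1.2) x'.1.2
      (e4.trans (Eq.trans (congrArg _ hy.symm)
        (δ_zero_σ_one ((points Y).obj T) (n := 0) _).symm))
      (e2.trans (δ_one_σ_one ((points Y).obj T) (n := 0) _).symm)
    have hb2 : ((points Y).obj T).δ 2 b = y.1.1.1.2 :=
      hb.bigon_δ_two.trans (δ_two_σ_one ((points Y).obj T) (n := 0) _)
    have hb0 : ((points Y).obj T).δ 0 b =
        ((points Y).obj T).σ 0 (((pointsMap f).app T).app _ y.1.2) := by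
      refine hb.bigon_δ_zero.trans (congrArg _ ?_)
      refine (congrArg _ (δ_zero_σ_one ((points Y).obj T) (n := 0) _)).trans ?_
      exact (δ_one_σ_zero ((points Y).obj T) (n := 0) _).trans hy
    refine ⟨⟨(x'.1.1, ⟨(b, _), hb0⟩), (conePairs_w f x').trans hb.δ_two⟩, ⟨?_, ?_⟩, ?_⟩
    · exact Subtype.ext (Prod.ext (Subtype.ext (Prod.ext e1 hb2)) e3)
    · refine Subtype.ext (Prod.ext rfl ?_)
      have hk := hz' T ⟨(x'.1.1, ⟨(b, _), hb0⟩), (conePairs_w f x').trans hb.δ_two⟩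
      refine ((hY.hasUniqueFillers T).existsUnique_whiskering _ _ hk.bigon_δ_zero
        hk.bigon_δ_two).unique hk ?_
      dsimp only
      rw [hb2]
      exact hb
    · rintro x ⟨hx1, hx2⟩
      have g1 : x.1.1 = x'.1.1 := congrArg (fun q => q.1.1) hx2
      have g2 : z.app T x = x'.1.2 := congrArg (fun q => q.1.2) hx2
      have g3 : ((points Y).obj T).δ 2 x.1.2.1.1 = y.1.1.1.2 := congrArg (fun q => q.1.1.1.2) hx1
      have g4 : x.1.2.1.1 = b := by
        refine hu _ ?_
        have := hz' T x
        rw [g2, g3] at this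
        exact this
      have g5 := sourcePairs_vertex f x
      refine Subtype.ext (Prod.ext g1 (Subtype.ext (Prod.ext g4 (g5.trans (congrArg _ ?_)))))
      exact (congrArg _ g1).trans e3

/-- The pairs of 1-simplices with the same end. -/
abbrev cospans (Y : SimplicialObject C) : Cᵒᵖ ⥤ Type v :=
  pairs (faceMap (points Y) (0 : Fin 2)) (faceMap (points Y) (0 : Fin 2))

/-- The second and the first face of a triangle. -/
def triangleToCospan (Y : SimplicialObject C) : level (points Y) 2 ⟶ cospans Y :=
  pairs.lift (faceMap (points Y) 1) (faceMap (points Y) 0)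
    fun T x => δ_zero_δ_one ((points Y).obj T) (n := 0) x

/-- Two edges with a common end form a horn at the last vertex of `Δ[2]`. -/
lemma IsGroupoidObject.isLocalCover_triangleToCospan (hW : IsPretopology W) {n : ℕ}
    (hY : IsGroupoidObject W n Y) : IsLocalCover W (triangleToCospan Y) := by
  refine (isFaceUnion_horn.{v} (2 : Fin 3)).isLocalCover (hY.isLocalCover_horn hW 2)
    _ (𝟙 _) (fun i _ => (![pairs.snd _ _, pairs.fst _ _, pairs.fst _ _] :
      Fin 3 → (cospans Y ⟶ level (points Y) 1)) i) ?_ ?_ ?_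
  · intro T g
    refine isMatching_of_δ _ ?_
    intro i j hij hi hj
    fin_cases i <;> fin_cases j <;> first | (exact (hj rfl).elim) | skip
    · exact g.2
    · exact (hij.not_gt (by decide)).elim
  · intro T x i hi
    fin_cases i
    · rfl
    · rfl
    · exact (hi rfl).elim
  · intro T g z hz
    exact ⟨z, ⟨Subtype.ext (Prod.ext (hz 1 (by decide)) (hz 0 (by decide))), rfl⟩,
      fun _ h => h.2⟩

/-- The edges of `Y` in a horn. -/
def hornToCospan : hornPairs f ⟶ cospans Y :=
  pairs.lift (pairs.fst _ _ ≫ pairs.snd _ _) (pairs.snd _ _ ≫ pairs.snd _ _) fun _ x => x.2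

/-- The fillers in `Y` of the horns with vertices in `X`. -/
abbrev filledHorns : Cᵒᵖ ⥤ Type v := pairs (hornToCospan f) (triangleToCospan Y)

lemma filledHorns_one {T : Cᵒᵖ} (x : (filledHorns f).obj T) :
    x.1.1.1.1.1.2 = ((points Y).obj T).δ 1 x.1.2 := congrArg (fun q => q.1.1) x.2

lemma filledHorns_zero {T : Cᵒᵖ} (x : (filledHorns f).obj T) :
    x.1.1.1.2.1.2 = ((points Y).obj T).δ 0 x.1.2 := congrArg (fun q => q.1.2) x.2

/-- The third edge of a filled horn. -/
def filledToEdge : filledHorns f ⟶ edgePairs f :=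
  pairs.lift
    (pairs.lift (pairs.fst _ _ ≫ pairs.fst _ _ ≫ pairs.fst _ _)
      (pairs.snd _ _ ≫ faceMap (points Y) 2) (fun T x => by
        refine x.1.1.1.1.2.trans (Eq.trans ?_
          (δ_one_δ_two ((points Y).obj T) (n := 0) x.1.2).symm)
        exact congrArg (((points Y).obj T).δ 1) (filledHorns_one f x)))
    (pairs.fst _ _ ≫ pairs.snd _ _ ≫ pairs.fst _ _) (fun T x => by
      refine (δ_zero_δ_two ((points Y).obj T) (n := 0) x.1.2).trans ?_
      refine Eq.trans ?_ x.1.1.1.2.2.symm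
      exact congrArg (((points Y).obj T).δ 1) (filledHorns_zero f x).symm)

/-- The bigons from the image of a 1-simplex of `X` to the third edge of a filled horn. -/
abbrev filledPairs : Cᵒᵖ ⥤ Type v := pairs (sourceTarget f) (filledToEdge f)

lemma filledPairs_δ_two {T : Cᵒᵖ} (x : (filledPairs f).obj T) :
    ((points Y).obj T).δ 2 x.1.1.1.2.1.1 = ((points Y).obj T).δ 2 x.1.2.1.2 :=
  congrArg (fun q => q.1.1.1.2) x.2

/-- A point of `filledPairs` is a filler of a horn with a bigon from the image of an edge of `X` to
its third edge; composing them gives a filler whose third edge comes from `X`, which defines `φ`.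
Since the triangle can be recovered from the composite and the bigon, `φ` is a base change of the
source map on bigons. Followed by `coneBoundary`, it just forgets the bigon and then the filler, and
both steps are local covers. -/
lemma IsLocalCover.exists_coneBoundary_cover (hW : IsPretopology W) (hY : IsGroupoidObject W 2 Y)
    (h : IsLocalCover W (sourceTarget f)) : ∃ φ : filledPairs f ⟶ conePairs f 1,
      IsLocalCover W φ ∧ IsLocalCover W (φ ≫ coneBoundary f) := by
  obtain ⟨z, hz⟩ := hY.exists_whiskering (F := filledPairs f)
    (pairs.fst _ _ ≫ pairs.snd _ _ ≫ pairs.fst _ _) (pairs.snd _ _ ≫ pairs.snd _ _)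
    (fun T x => by
      refine (bigonPairs_w x.1.1.1.2).trans (congrArg (((points Y).obj T).σ 0) ?_)
      refine (sourcePairs_δ_two f x.1.1).symm.trans ?_
      refine Eq.trans (congrArg _ (filledPairs_δ_two f x)) ?_
      exact δ_zero_δ_two ((points Y).obj T) (n := 0) _)
    (fun T x => filledPairs_δ_two f x)
  have hz' : ∀ T (x : (filledPairs f).obj T), IsWhiskering (A := (points Y).obj T)
      x.1.1.1.2.1.1 x.1.2.1.2 (z.app T x) := hz
  let φ : filledPairs f ⟶ conePairs f 1 := pairs.lift (pairs.fst _ _ ≫ pairs.fst _ _) z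
    fun T x => (sourcePairs_w f x.1.1).trans (hz' T x).δ_two.symm
  have hφ : φ ≫ coneBoundary f = pairs.snd _ _ ≫ pairs.fst _ _ := by
    ext T x
    refine Subtype.ext (Prod.ext (Subtype.ext (Prod.ext ?_ ?_)) (Subtype.ext (Prod.ext ?_ ?_)))
    · exact congrArg (fun q => q.1.1.1.1) x.2
    · exact (hz' T x).δ_one.trans (filledHorns_one f x.1.2).symm
    · exact congrArg (fun q => q.1.2) x.2
    · exact (hz' T x).δ_zero.trans (filledHorns_zero f x.1.2).symm
  refine ⟨φ, ?_, ?_⟩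
  · refine (hY.isLocalCover_bigonPairs hW).base_change φ (pairs.fst _ _ ≫ pairs.snd _ _)
      (pairs.fst _ _ ≫ levelMap (pointsMap f) 1) (fun T x => (sourcePairs_w f x.1.1).symm) ?_
    intro T y b hb
    have hb' : ((points Y).obj T).δ 1 b.1.1 = ((points Y).obj T).δ 2 y.1.2 :=
      Eq.trans hb (conePairs_w f y)
    have hb0 : b.1.2 = ((points Y).obj T).δ (n := 0) 1 (((points Y).obj T).δ 0 y.1.2) := by
      refine Eq.trans ?_ (δ_zero_δ_two ((points Y).obj T) (n := 0) _)
      refine Eq.trans ?_ (congrArg _ hb')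
      refine Eq.trans ?_ (δ_zero_δ_one ((points Y).obj T) (n := 0) _).symm
      exact ((congrArg _ (bigonPairs_w b)).trans (δ_zero_σ_zero ((points Y).obj T) _)).symm
    obtain ⟨w, hw, hu⟩ := (hY.hasUniqueFillers T).existsUnique_whiskered b.1.1 y.1.2
      ((bigonPairs_w b).trans (congrArg _ hb0)) hb'
    let s : (sourcePairs f).obj T := ⟨(y.1.1, b), hb.symm⟩
    let r : (filledHorns f).obj T := ⟨((coneBoundary f).app T y, w),
      Subtype.ext (Prod.ext hw.δ_one hw.δ_zero)⟩
    let q : (filledPairs f).obj T := ⟨(s, r),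
      Subtype.ext (Prod.ext (Subtype.ext (Prod.ext rfl hw.bigon_δ_two)) rfl)⟩
    refine ⟨q, ⟨Subtype.ext (Prod.ext rfl ?_), rfl⟩, ?_⟩
    · exact ((hY.hasUniqueFillers T).existsUnique_whiskering _ _ hw.bigon_δ_zero
        hw.bigon_δ_two).unique (hz' T q) hw
    · rintro q' ⟨h1, h2⟩
      have g1 : q'.1.1.1.1 = y.1.1 := congrArg (fun k => k.1.1) h1
      have g2 : z.app T q' = y.1.2 := congrArg (fun k => k.1.2) h1
      have g3 : q'.1.1.1.2 = b := h2
      have g4 : q'.1.2.1.1 = (coneBoundary f).app T y :=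
        (congrArg (fun k => k.app T q') hφ).symm.trans (congrArg ((coneBoundary f).app T) h1)
      refine Subtype.ext (Prod.ext (Subtype.ext (Prod.ext g1 g3))
        (Subtype.ext (Prod.ext g4 (hu _ ?_))))
      have := hz' T q'
      rw [g2, g3] at this
      exact this
  · rw [hφ]
    exact (pairs.isLocalCover_snd _ _ h).comp hW
      (pairs.isLocalCover_fst _ _ (hY.isLocalCover_triangleToCospan hW))

/-- The cover `coneTarget` makes `hornPairs` and `edgePairs` representable, so that local covers
onto them are covers. -/
lemma isCover_sourceTarget_iff (hW : IsPretopology W) (hcancel : IsRightCancellative W)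
    (hY : IsGroupoidObject W 2 Y) (h : IsCover W (coneTarget f)) :
    IsCover W (sourceTarget f) ↔ IsCover W (coneBoundary f) := by
  have h' := h.isLocalCover hW
  constructor
  · intro hs
    obtain ⟨φ, hφ, hφ'⟩ := (hs.isLocalCover hW).exists_coneBoundary_cover f hW hY
    exact hφ.isCover_of_comp hW hcancel hφ' (hY.isRep_conePairs f hW 1)
      ((pairs.isLocalCover_fst _ _ h').isRep (hY.isRep_conePairs f hW 0))
  · intro hc
    exact (isLocalCover_sourceTarget f hY (hc.isLocalCover hW)).isCover
      ((pairs.isLocalCover_snd _ _ h').isRep (isRep_level X 0))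

end Whiskering

/-! ### Lifting triangles locally and descending along a cover -/

section Descent

variable {C : Type u} [Category.{v} C] {W : MorphismProperty C} {X Y : SimplicialObject C}

/-- This is the uniqueness half of the sheaf condition for representable presheaves. -/
lemma IsSubcanonical.epi (hW : IsPretopology W) (hsub : IsSubcanonical W) {A B : C} {p : A ⟶ B}
    (hp : W p) : Epi p := by
  refine ⟨fun {Z} a b hab => ?_⟩
  obtain ⟨P, p₁, p₂, hP, -⟩ := hW.pullback p p hp
  exact (hsub Z p p₁ p₂ hp hP (p ≫ b)
    (by simpa using congrArg (· ≫ b) hP.w)).unique hab rfl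

/-- Triangles lift uniquely along `f` if bigons do. -/
lemma liftsTriangles_of_liftsBigons (hW : IsPretopology W) (hsub : IsSubcanonical W)
    (hX : IsGroupoidObject W 2 X) (hY : IsGroupoidObject W 2 Y) (f : X ⟶ Y)
    (h : ∀ T, LiftsBigons ((pointsMap f).app T)) (T : Cᵒᵖ) :
    LiftsTriangles ((pointsMap f).app T) := by
  intro x₀ x₁ x₂ y h01 h02 h12 hy0 hy1 hy2
  have huniq := fun U => (h U).triangle_unique (hX.hasUniqueFillers U) (hY.hasUniqueFillers U)
  -- The horn formed by `x₁` and `x₀` has a filler in `X` only after passing to a cover `P` of `T`.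
  obtain ⟨P, p, w, hp, hw, -⟩ := hX.isLocalCover_triangleToCospan hW T.unop ⟨(x₁, x₀), h01⟩
  have : Epi p := hsub.epi hW hp
  have hw1 : ((points X).obj (op P)).δ 1 w = p ≫ x₁ := congrArg (fun q => q.1.1) hw
  have hw0 : ((points X).obj (op P)).δ 0 w = p ≫ x₀ := congrArg (fun q => q.1.2) hw
  have hδX : ∀ {m : ℕ} {A B : C} (t : A ⟶ B) (i : Fin (m + 2)) (x : B ⟶ X _⦋m + 1⦌),
      ((points X).obj (op A)).δ i (t ≫ x : A ⟶ X _⦋m + 1⦌) =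
        t ≫ (((points X).obj (op B)).δ i x : B ⟶ X _⦋m⦌) := fun t i x =>
    (SSet.δ_naturality_apply ((points X).map t.op) i x).symm
  have hδY : ∀ {m : ℕ} {A B : C} (t : A ⟶ B) (i : Fin (m + 2)) (x : B ⟶ Y _⦋m + 1⦌),
      ((points Y).obj (op A)).δ i (t ≫ x : A ⟶ Y _⦋m + 1⦌) =
        t ≫ (((points Y).obj (op B)).δ i x : B ⟶ Y _⦋m⦌) := fun t i x =>
    (SSet.δ_naturality_apply ((points Y).map t.op) i x).symm
  have hf : ∀ {m : ℕ} {A B : C} (t : A ⟶ B) (x : B ⟶ X _⦋m⦌),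
      ((pointsMap f).app (op A)).app _ (t ≫ x : A ⟶ X _⦋m⦌) =
        t ≫ (((pointsMap f).app (op B)).app _ x : B ⟶ Y _⦋m⦌) := fun t x => Category.assoc _ _ _
  obtain ⟨z, ⟨hz0, hz1, hz2⟩, hz⟩ := (h (op P)).triangle_exists (hX.hasUniqueFillers _)
    (hY.hasUniqueFillers _) (p ≫ x₂) w (p ≫ y)
    ((hδX p 0 x₂).trans <| (congrArg (p ≫ ·) h02).trans <|
      (hδX p 1 x₀).symm.trans (congrArg _ hw0.symm))
    ((hδX p 1 x₂).trans <| (congrArg (p ≫ ·) h12).trans <|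
      (hδX p 1 x₁).symm.trans (congrArg _ hw1.symm))
    ((hδY p 0 y).trans <| (congrArg (p ≫ ·) hy0).trans <| (hf p x₀).symm.trans
      (congrArg _ hw0.symm))
    ((hδY p 1 y).trans <| (congrArg (p ≫ ·) hy1).trans <| (hf p x₁).symm.trans
      (congrArg _ hw1.symm))
    ((hδY p 2 y).trans <| (congrArg (p ≫ ·) hy2).trans (hf p x₂).symm)
  have hz0' := hz0.trans hw0
  have hz1' := hz1.trans hw1
  obtain ⟨P', p₁, p₂, hP, -⟩ := hW.pullback p p hp
  have key : ∀ {n : ℕ} {Z : SimplicialObject C} (x : T.unop ⟶ Z _⦋n⦌),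
      p₁ ≫ p ≫ x = p₂ ≫ p ≫ x := fun x => by rw [reassoc_of% hP.w]
  -- The two pullbacks of the lift `z` to the overlap have the same boundary and the same image,
  -- since these come from `T`. By uniqueness of lifts they agree, and `z` descends.
  obtain ⟨x, hx, -⟩ := hsub _ p p₁ p₂ hp hP z (by
    refine huniq (op P') _ _ ?_ ?_ ?_ ?_
    · exact (hδX p₁ 0 z).trans <| (congrArg (p₁ ≫ ·) hz0').trans <| (key x₀).trans <|
        (congrArg (p₂ ≫ ·) hz0'.symm).trans (hδX p₂ 0 z).symm
    · exact (hδX p₁ 1 z).trans <| (congrArg (p₁ ≫ ·) hz1').trans <| (key x₁).trans <|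
        (congrArg (p₂ ≫ ·) hz1'.symm).trans (hδX p₂ 1 z).symm
    · exact (hδX p₁ 2 z).trans <| (congrArg (p₁ ≫ ·) hz2).trans <| (key x₂).trans <|
        (congrArg (p₂ ≫ ·) hz2.symm).trans (hδX p₂ 2 z).symm
    · exact (hf p₁ z).trans <| (congrArg (p₁ ≫ ·) hz).trans <| (key y).trans <|
        (congrArg (p₂ ≫ ·) hz.symm).trans (hf p₂ z).symm)
  have hx' : p ≫ x = z := hx
  have e0 : ((points X).obj T).δ 0 x = x₀ := (cancel_epi p).1
    ((hδX p 0 x).symm.trans ((congrArg _ hx').trans hz0'))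
  have e1 : ((points X).obj T).δ 1 x = x₁ := (cancel_epi p).1
    ((hδX p 1 x).symm.trans ((congrArg _ hx').trans hz1'))
  have e2 : ((points X).obj T).δ 2 x = x₂ := (cancel_epi p).1
    ((hδX p 2 x).symm.trans ((congrArg _ hx').trans hz2))
  have e : ((pointsMap f).app T).app _ x = y := (cancel_epi p).1
    ((hf p x).symm.trans ((congrArg _ hx').trans hz))
  refine ⟨x, ⟨⟨e0, e1, e2⟩, e⟩, ?_⟩
  rintro x' ⟨⟨g0, g1, g2⟩, g⟩
  exact huniq T x x' (g0.trans e0.symm) (g1.trans e1.symm) (g2.trans e2.symm) (g.trans e.symm)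

end Descent

/-! ### Both notions as lists of three conditions -/

section Main

variable {C : Type u} [Category.{v} C] {W : MorphismProperty C} {X Y : SimplicialObject C}
  (f : X ⟶ Y)

lemma isWeakEquivalence_iff (hW : IsPretopology W) (hcancel : IsRightCancellative W)
    (hY : IsGroupoidObject W 2 Y) : IsWeakEquivalence W f ↔
      IsCover W (coneTarget f) ∧ IsCover W (coneBoundary f) ∧
        ∀ T, LiftsBigons ((pointsMap f).app T) := by
  rw [← isFullyFaithful_bigonFunctor_iff]
  constructor
  · rintro ⟨h, h', hf⟩
    have h0 := (isEssSurj_pointsMap_iff f hW hcancel hY).1 h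
    exact ⟨h0, (isCover_sourceTarget_iff f hW hcancel hY h0).1
      ((isEssSurj_bigonFunctor_iff f hW).1 h'), hf⟩
  · rintro ⟨h0, h1, hf⟩
    exact ⟨(isEssSurj_pointsMap_iff f hW hcancel hY).2 h0, (isEssSurj_bigonFunctor_iff f hW).2
      ((isCover_sourceTarget_iff f hW hcancel hY h0).2 h1), hf⟩

lemma isWeakAcyclicFibration_iff (hW : IsPretopology W) (hX : IsGroupoidObject W 2 X)
    (hY : IsGroupoidObject W 2 Y) : IsWeakAcyclicFibration W f ↔
      IsCover W (coneTarget f) ∧ IsCover W (coneBoundary f) ∧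
        ∀ T, LiftsTriangles ((pointsMap f).app T) := by
  constructor
  · intro h
    refine ⟨(isCover_squaresRestrict_zero_iff f hW).1 (h.acyc 0),
      (isCover_squaresRestrict_one_iff f hW).1 (h.acyc 1), fun T => ?_⟩
    exact (liftsSimplices_two_iff _).1
      ((isIso_squaresRestrict_iff f hY le_rfl).1 (h.acyc_unique 2 le_rfl) T)
  · rintro ⟨h0, h1, h2⟩
    have hiso : ∀ k : ℕ, 2 ≤ k →
        IsIso (squaresRestrict (joinSquare (SSet.boundary.{v} k).ι Δ[0]) f) := fun k hk =>
      (isIso_squaresRestrict_iff f hY hk).2 fun T =>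
        (h2 T).liftsSimplices (hX.hasUniqueFillers T) (hY.hasUniqueFillers T) hk
    refine ⟨fun k => ?_, hiso⟩
    rcases k with _ | _ | k
    · exact (isCover_squaresRestrict_zero_iff f hW).2 h0
    · exact (isCover_squaresRestrict_one_iff f hW).2 h1
    -- An isomorphism of presheaves is a cover only if its ends are representable. The source is, by
    -- comparison with `conePairs`, and therefore the target is too.
    · have := hiso (k + 2) (by omega)
      have hb : ∀ T, Function.Bijective
          ((squaresRestrict (joinSquare (SSet.boundary.{v} (k + 2)).ι Δ[0]) f).app T) :=
        fun T => (CategoryTheory.isIso_iff_bijective _).1 inferInstance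
      refine (IsLocalCover.of_bijective hW _ hb).isCover (IsRep.of_bijective ?_ _ hb)
      exact (hY.isRep_conePairs f hW (k + 2)).of_bijective' _ (toConePairs_bijective f (k + 2))

end Main

end HigherGroupoid

theorem mainTheorem5 {C : Type u} [Category.{v} C] (W : MorphismProperty C)
    (hW : HigherGroupoid.IsPretopology W) (hsub : HigherGroupoid.IsSubcanonical W)
    (hcancel : HigherGroupoid.IsRightCancellative W) {X Y : SimplicialObject C}
    (hX : HigherGroupoid.IsGroupoidObject W 2 X) (hY : HigherGroupoid.IsGroupoidObject W 2 Y)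
    (f : X ⟶ Y) :
    HigherGroupoid.IsWeakEquivalence W f ↔ HigherGroupoid.IsWeakAcyclicFibration W f := by
  rw [HigherGroupoid.isWeakEquivalence_iff f hW hcancel hY,
    HigherGroupoid.isWeakAcyclicFibration_iff f hW hX hY]
  refine and_congr_right fun _ => and_congr_right fun _ => ⟨fun h T => ?_, fun h T => ?_⟩
  · exact HigherGroupoid.liftsTriangles_of_liftsBigons hW hsub hX hY f h T
  · exact (h T).liftsBigons
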